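/- Let $B$ be a smooth (Hausdorff, second countable, finite-dimensional) manifold and let $V=\bigoplus_{q\ge 0}V^q$ be a graded smooth complex vector bundle over $B$, each $V^q$ of finite rank. For an open set $U\subseteq B$ let $\Omega(U,V|U)=\bigoplus_{p,q}\Omega^p(U,V^q)$ be the space of smooth $V$-valued differential forms on $U$, where $\Omega^p(U,V^q)$ has total degree $p+q$. A superconnection on $V|U$ is a $\mathbb C$-linear operator $D$ on $\Omega(U,V|U)$ of total degree $1$ such that $D(\alpha\wedge\omega)=d\alpha\wedge\omega+(-1)^{|\alpha|}\alpha\wedge D\omega$ for all scalar forms $\alpha$ on $U$ and all $\omega\in\Omega(U,V|U)$; it is flat if $D^2=0$. Let $D$ be a flat superconnection on $V$ over $B$, and let $U\subseteq B$ be a contractible open subset. Then: 1. There is a unique superconnection on $V|U$, again denoted $D$, such that $D(\omega|_U)=(D\omega)|_U$ for all $\omega\in\Omega(B,V)$, and it is flat. 2. There is a unique family of linear maps $A_0(x):V^q_x\to V^{q+1}_x$ ($x\in B$, $q\ge0$) such that for every smooth section $s$ of $V^q$ the component of $Ds$ in $\Omega^0(B,V^{q+1})$ is $-A_0s$, and $A_0(x)^2=0$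 for all $x\in B$. 3. For every $n\ge 0$ and every point $x\in U$, restriction to $x$ (sending a form to the value at $x$ of its component of form degree $0$, an element of $V_x=\bigoplus_q V^q_x$) maps $D$-cocycles of degree $n$ to $A_0(x)$-cocycles of degree $n$ and induces an isomorphism of complex vector spaces $$H^n(\Omega(U,V|U),D)\;\cong\;H^n(V_x,A_0(x)).$$ -/

import Mathlib

open Bundle TopologicalSpace
open scoped Manifold ContDiff DirectSum

noncomputable section

namespace SuperConn

set_option linter.unusedSectionVars false

theorem continuousSMul_real {M : Type*} [AddCommGroup M] [Module ℂ M]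
    [TopologicalSpace M] [ContinuousSMul ℂ M] : ContinuousSMul ℝ M where
  continuous_smul := by
    have h : Continuous fun p : ℝ × M => ((p.1 : ℂ)) • p.2 :=
      (Complex.continuous_ofReal.comp continuous_fst).smul continuous_snd
    exact h

/-! ### The exterior product of alternating forms -/

section Wedge

variable {T N N' T' : Type*} [AddCommGroup T] [Module ℝ T] [TopologicalSpace T]
  [AddCommGroup T'] [Module ℝ T'] [TopologicalSpace T']
  [AddCommGroup N] [Module ℂ N] [TopologicalSpace N] [AddCommGroup N'] [Module ℂ N']
  [TopologicalSpace N']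

/-- The exterior product as an algebraic alternating map: `AlternatingMap.domCoprod` (the sum over
shuffles), followed by the scalar multiplication `ℂ ⊗ N → N`. -/
def wedgeAlt {k p : ℕ} (α : T [⋀^Fin k]→L[ℝ] ℂ) (η : T [⋀^Fin p]→L[ℝ] N) :
    T [⋀^Fin (k + p)]→ₗ[ℝ] N :=
  ((TensorProduct.lift (Algebra.lsmul ℝ ℝ N).toLinearMap).compAlternatingMap
    (α.toAlternatingMap.domCoprod η.toAlternatingMap)).domDomCongr finSumFinEquiv

theorem wedgeAlt_apply {k p : ℕ} (α : T [⋀^Fin k]→L[ℝ] ℂ) (η : T [⋀^Fin p]→L[ℝ] N)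
    (v : Fin (k + p) → T) :
    wedgeAlt α η v = ∑ σ : Equiv.Perm.ModSumCongr (Fin k) (Fin p),
      Equiv.Perm.sign (Quotient.out σ) •
        (α (fun i => v (finSumFinEquiv (Quotient.out σ (Sum.inl i)))) •
          η (fun i => v (finSumFinEquiv (Quotient.out σ (Sum.inr i))))) := by
  change TensorProduct.lift (Algebra.lsmul ℝ ℝ N).toLinearMap
    (α.toAlternatingMap.domCoprod η.toAlternatingMap (fun i => v (finSumFinEquiv i))) = _
  rw [AlternatingMap.domCoprod_apply, sum_apply, map_sum]
  refine Finset.sum_congr rfl fun σ _ => ?_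
  conv_lhs => rw [← Quotient.out_eq' σ]
  rw [AlternatingMap.domCoprod.summand_mk'']
  simp

variable [IsTopologicalAddGroup N] [ContinuousSMul ℂ N] [IsTopologicalAddGroup N']
  [ContinuousSMul ℂ N']

/-- The exterior product `α ∧ η` of a complex valued `k`-form and an `N`-valued `p`-form on a real
vector space `T`: the sum over `(k, p)`-shuffles `σ` of
`sign σ • α (v (σ 0), …, v (σ (k-1))) • η (v (σ k), …, v (σ (k+p-1)))`. -/
def wedge {k p : ℕ} (α : T [⋀^Fin k]→L[ℝ] ℂ) (η : T [⋀^Fin p]→L[ℝ] N) :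
    T [⋀^Fin (k + p)]→L[ℝ] N :=
  { wedgeAlt α η with
    cont := by
      change Continuous fun v => wedgeAlt α η v
      simp only [wedgeAlt_apply]
      refine continuous_finsetSum _ fun σ _ => Continuous.const_smul ?_ _
      exact (α.cont.comp (continuous_pi fun i => continuous_apply _)).smul
        (η.cont.comp (continuous_pi fun i => continuous_apply _)) }

theorem wedge_apply {k p : ℕ} (α : T [⋀^Fin k]→L[ℝ] ℂ) (η : T [⋀^Fin p]→L[ℝ] N)
    (v : Fin (k + p) → T) :
    wedge α η v = ∑ σ : Equiv.Perm.ModSumCongr (Fin k) (Fin p),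
      Equiv.Perm.sign (Quotient.out σ) •
        (α (fun i => v (finSumFinEquiv (Quotient.out σ (Sum.inl i)))) •
          η (fun i => v (finSumFinEquiv (Quotient.out σ (Sum.inr i))))) :=
  wedgeAlt_apply α η v

theorem wedge_natural {k p : ℕ} (α : T [⋀^Fin k]→L[ℝ] ℂ) (η : T [⋀^Fin p]→L[ℝ] N)
    (f : T' →L[ℝ] T) (L : N →L[ℝ] N') (hL : ∀ (c : ℂ) n, L (c • n) = c • L n) :
    (L.compContinuousAlternatingMap (wedge α η)).compContinuousLinearMap f =
      wedge (α.compContinuousLinearMap f)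
        ((L.compContinuousAlternatingMap η).compContinuousLinearMap f) := by
  ext v
  simp [wedge_apply, map_sum, hL, Function.comp_def, Units.smul_def]

theorem wedge_add_right {k p : ℕ} (α : T [⋀^Fin k]→L[ℝ] ℂ) (η η' : T [⋀^Fin p]→L[ℝ] N) :
    wedge α (η + η') = wedge α η + wedge α η' := by
  ext v
  simp [wedge_apply, Finset.sum_add_distrib]

theorem wedge_add_left {k p : ℕ} (α α' : T [⋀^Fin k]→L[ℝ] ℂ) (η : T [⋀^Fin p]→L[ℝ] N) :
    wedge (α + α') η = wedge α η + wedge α' η := by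
  ext v
  simp [wedge_apply, Finset.sum_add_distrib, add_smul]

theorem wedge_smul_right {k p : ℕ} (c : ℂ) (α : T [⋀^Fin k]→L[ℝ] ℂ) (η : T [⋀^Fin p]→L[ℝ] N) :
    wedge α (c • η) = c • wedge α η := by
  ext v
  simp [wedge_apply, Finset.smul_sum, Units.smul_def, smul_comm c]

theorem wedge_smul_left {k p : ℕ} (c : ℂ) (α : T [⋀^Fin k]→L[ℝ] ℂ) (η : T [⋀^Fin p]→L[ℝ] N) :
    wedge (c • α) η = c • wedge α η := by
  ext v
  simp [wedge_apply, Finset.smul_sum, Units.smul_def, smul_comm c, mul_smul]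

end Wedge

theorem isBoundedBilinearMap_wedge {T N : Type*} [NormedAddCommGroup T] [NormedSpace ℝ T]
    [NormedAddCommGroup N] [NormedSpace ℂ N] (k p : ℕ) :
    IsBoundedBilinearMap ℝ fun q : (T [⋀^Fin k]→L[ℝ] ℂ) × (T [⋀^Fin p]→L[ℝ] N) =>
      wedge q.1 q.2 where
  add_left := wedge_add_left
  smul_left c α η := wedge_smul_left (c : ℂ) α η
  add_right := wedge_add_right
  smul_right c α η := wedge_smul_right (c : ℂ) α η
  bound := by
    refine ⟨(Fintype.card (Equiv.Perm.ModSumCongr (Fin k) (Fin p)) : ℝ) + 1, by positivity,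
      fun α η => ?_⟩
    refine ContinuousAlternatingMap.opNorm_le_bound _ (by positivity) fun v => ?_
    have key : ∀ σ : Equiv.Perm.ModSumCongr (Fin k) (Fin p),
        ‖Equiv.Perm.sign (Quotient.out σ) •
        (α (fun i => v (finSumFinEquiv (Quotient.out σ (Sum.inl i)))) •
          η (fun i => v (finSumFinEquiv (Quotient.out σ (Sum.inr i)))))‖
          ≤ ‖α‖ * ‖η‖ * ∏ i, ‖v i‖ := by
      intro σ
      have h1 := α.le_opNorm (fun i => v (finSumFinEquiv (Quotient.out σ (Sum.inl i))))
      have h2 := η.le_opNorm (fun i => v (finSumFinEquiv (Quotient.out σ (Sum.inr i))))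
      have h3 : ∏ i, ‖v i‖ =
          (∏ i, ‖v (finSumFinEquiv (Quotient.out σ (Sum.inl i)))‖) *
            ∏ i, ‖v (finSumFinEquiv (Quotient.out σ (Sum.inr i)))‖ := by
        rw [← Fintype.prod_sumElim,
          ← Equiv.prod_comp ((Quotient.out σ).trans finSumFinEquiv) fun i => ‖v i‖]
        refine Finset.prod_congr rfl fun i _ => ?_
        cases i <;> rfl
      have h4 : ∀ (s : ℤˣ) (n : N), ‖s • n‖ = ‖n‖ := by
        intro s n
        rcases Int.units_eq_one_or s with rfl | rfl <;> simp
      rw [h4, norm_smul, h3]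
      calc _ ≤ _ := mul_le_mul h1 h2 (norm_nonneg _) (by positivity)
        _ = _ := by ring
    rw [wedge_apply]
    refine (norm_sum_le _ _).trans ((Finset.sum_le_sum fun σ _ => key σ).trans ?_)
    rw [Finset.sum_const, nsmul_eq_mul, Finset.card_univ]
    have h5 : 0 ≤ ‖α‖ * ‖η‖ * ∏ i, ‖v i‖ := by positivity
    nlinarith

set_option synthInstance.maxHeartbeats 200000 in
theorem contDiffAt_extDeriv {T N : Type*} [NormedAddCommGroup T] [NormedSpace ℝ T]
    [NormedAddCommGroup N] [NormedSpace ℝ N] {k : ℕ} {f : T → T [⋀^Fin k]→L[ℝ] N} {x : T}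
    (h : ContDiffAt ℝ ∞ f x) : ContDiffAt ℝ ∞ (extDeriv f) x := by
  have h' : ContDiffAt ℝ ∞ (fderiv ℝ f) x := h.fderiv_right (by simp)
  exact h'.continuousLinearMap_comp
    (ContinuousAlternatingMap.alternatizeUncurryFinCLM ℝ T N (n := k))

/-! ### Smooth differential forms with values in a complex vector bundle -/

section Forms

attribute [local instance] continuousSMul_real

variable {E : Type*} [NormedAddCommGroup E] [NormedSpace ℝ E]
  {B : Type*} [TopologicalSpace B] [ChartedSpace E B] [IsManifold 𝓘(ℝ, E) ∞ B]

section

variable (F : Type*) [NormedAddCommGroup F] [NormedSpace ℂ F]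
  (V : B → Type*) [TopologicalSpace (TotalSpace F V)] [∀ x, AddCommGroup (V x)]
  [∀ x, Module ℂ (V x)] [∀ x, TopologicalSpace (V x)] [∀ x, IsTopologicalAddGroup (V x)]
  [∀ x, ContinuousSMul ℂ (V x)] [FiberBundle F V] [VectorBundle ℂ F V] [VectorBundle ℝ F V]

theorem trivialization_map_smul (x₀ x : B) (c : ℂ) (v : V x) :
    (trivializationAt F V x₀).continuousLinearMapAt ℝ x (c • v) =
      c • (trivializationAt F V x₀).continuousLinearMapAt ℝ x v := by
  have h : ∀ w : V x, (trivializationAt F V x₀).continuousLinearMapAt ℝ x w =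
      (trivializationAt F V x₀).continuousLinearMapAt ℂ x w := by
    intro w
    simp [Trivialization.coe_linearMapAt]
  rw [h, h, map_smul]

variable (E) in
/-- The fibre at `x` of the bundle `Λᵖ T^*B ⊗ V` of `V`-valued `p`-forms. -/
abbrev FormFibre (p : ℕ) (x : B) : Type _ := TangentSpace 𝓘(ℝ, E) x [⋀^Fin p]→L[ℝ] V x

/-- Smoothness, on the set `U`, of a section of the bundle of `V`-valued `p`-forms. -/
def IsSmoothOn {p : ℕ} (η : ∀ x : B, FormFibre E V p x) (U : Set B) : Prop :=
  ContMDiffOn 𝓘(ℝ, E) (𝓘(ℝ, E).prod 𝓘(ℝ, E [⋀^Fin p]→L[ℝ] F)) ∞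
    (fun x => TotalSpace.mk' (E [⋀^Fin p]→L[ℝ] F) (E := FormFibre E V p) x (η x)) U

/-- A `p`-form written in the preferred chart and the preferred trivialization at `x₀`. -/
def coordForm {p : ℕ} (x₀ : B) (η : ∀ x : B, FormFibre E V p x) (x : B) : E [⋀^Fin p]→L[ℝ] F :=
  ContinuousAlternatingMap.inCoordinates E F (E₁ := TangentSpace 𝓘(ℝ, E)) (E₂ := V) x₀ x x₀ x (η x)

theorem isSmoothOn_iff {p : ℕ} (η : ∀ x : B, FormFibre E V p x) (U : Opens B) :
    IsSmoothOn F V η U ↔ ∀ x₀ ∈ U, ContMDiffAt 𝓘(ℝ, E) 𝓘(ℝ, E [⋀^Fin p]→L[ℝ] F) ∞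
      (coordForm F V x₀ η) x₀ := by
  unfold IsSmoothOn
  refine forall₂_congr fun x₀ hx₀ => ?_
  rw [Bundle.contMDiffWithinAt_section]
  exact ⟨fun h => h.contMDiffAt (U.isOpen.mem_nhds hx₀), fun h => h.contMDiffWithinAt⟩

variable (E) in
/-- `Ωᵖ(U, V)`: the smooth `V`-valued `p`-forms on the open set `U`. Such a form is recorded as a
section over `B` that is smooth on `U` and takes the junk value `0` outside `U`. -/
def Form (p : ℕ) (U : Opens B) : Submodule ℂ (∀ x : B, FormFibre E V p x) where
  carrier := {η | IsSmoothOn F V η U ∧ ∀ x ∉ U, η x = 0}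
  add_mem' := by
    rintro η η' ⟨h, h0⟩ ⟨h', h0'⟩
    refine ⟨?_, fun x hx => by simp [h0 x hx, h0' x hx]⟩
    rw [isSmoothOn_iff] at *
    intro x₀ hx₀
    refine ((h x₀ hx₀).add (h' x₀ hx₀)).congr_of_eventuallyEq (.of_forall fun x => ?_)
    ext v
    simp [coordForm, ContinuousAlternatingMap.inCoordinates]
  zero_mem' := by
    refine ⟨?_, fun x _ => rfl⟩
    rw [isSmoothOn_iff]
    intro x₀ _
    refine (contMDiffAt_const (c := 0)).congr_of_eventuallyEq (.of_forall fun x => ?_)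
    ext v
    simp [coordForm, ContinuousAlternatingMap.inCoordinates]
  smul_mem' := by
    rintro c η ⟨h, h0⟩
    refine ⟨?_, fun x hx => by simp [h0 x hx]⟩
    rw [isSmoothOn_iff] at *
    intro x₀ hx₀
    refine ((contDiff_const_smul c).comp_contMDiffAt (h x₀ hx₀)).congr_of_eventuallyEq
      (.of_forall fun x => ?_)
    ext v
    exact trivialization_map_smul F V x₀ x c _

variable {F V}

theorem Form.contMDiffAt {p : ℕ} {U : Opens B} (η : Form E F V p U) {x₀ : B} (hx₀ : x₀ ∈ U) :
    ContMDiffAt 𝓘(ℝ, E) 𝓘(ℝ, E [⋀^Fin p]→L[ℝ] F) ∞ (coordForm F V x₀ η.1) x₀ :=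
  (isSmoothOn_iff F V η.1 U).1 η.2.1 x₀ hx₀

/-- The restriction of a form on `W` to a smaller open set `U`. -/
def Form.restrict {p : ℕ} {U W : Opens B} (h : U ≤ W) : Form E F V p W →ₗ[ℂ] Form E F V p U where
  toFun η := ⟨fun x => open Classical in if x ∈ U then η.1 x else 0, by
    refine ⟨?_, fun x hx => if_neg hx⟩
    rw [isSmoothOn_iff]
    intro x₀ hx₀
    refine (Form.contMDiffAt η (h hx₀)).congr_of_eventuallyEq ?_
    filter_upwards [U.isOpen.mem_nhds hx₀] with x hx
    have hx' : x ∈ U := hx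
    simp only [coordForm, if_pos hx']⟩
  map_add' η η' := by
    ext x v
    by_cases hx : x ∈ U <;> simp [hx]
  map_smul' c η := by
    ext x v
    by_cases hx : x ∈ U <;> simp [hx]

end

variable (E) in
/-- `Ωᵏ(U)`: the smooth complex valued `k`-forms on the open set `U`. -/
abbrev ScalarForm (k : ℕ) (U : Opens B) : Submodule ℂ (∀ x : B, FormFibre E (Bundle.Trivial B ℂ) k x) :=
  Form E ℂ (Bundle.Trivial B ℂ) k U

/-- The value at `x₀` of the exterior derivative of a scalar form, computed in the preferred chart
at `x₀` (through which `TangentSpace 𝓘(ℝ, E) x₀` is identified with `E`). -/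
def extDerivAt {k : ℕ} (α : ∀ x : B, FormFibre E (Bundle.Trivial B ℂ) k x) (x₀ : B) :
    FormFibre E (Bundle.Trivial B ℂ) (k + 1) x₀ :=
  show E [⋀^Fin (k + 1)]→L[ℝ] ℂ from
    extDeriv (fun y => coordForm ℂ (Bundle.Trivial B ℂ) x₀ α ((extChartAt 𝓘(ℝ, E) x₀).symm y))
      (extChartAt 𝓘(ℝ, E) x₀ x₀)

theorem coordForm_trivial {k : ℕ} (α : ∀ x : B, FormFibre E (Bundle.Trivial B ℂ) k x) (x₀ x : B)
    (hx : x ∈ (chartAt E x₀).source) :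
    coordForm ℂ (Bundle.Trivial B ℂ) x₀ α x = ContinuousAlternatingMap.compContinuousLinearMap
      (show E [⋀^Fin k]→L[ℝ] ℂ from α x) (tangentCoordChange 𝓘(ℝ, E) x₀ x x) := by
  unfold coordForm ContinuousAlternatingMap.inCoordinates
  rw [TangentBundle.symmL_trivializationAt_eq_core hx]
  ext v
  simp
  rfl

theorem coordForm_extDerivAt {k : ℕ} (α : ∀ x : B, FormFibre E (Bundle.Trivial B ℂ) k x) (x₀ x : B)
    (hx : x ∈ (chartAt E x₀).source)
    (hα : ContMDiffAt 𝓘(ℝ, E) 𝓘(ℝ, E [⋀^Fin k]→L[ℝ] ℂ) 1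
      (coordForm ℂ (Bundle.Trivial B ℂ) x₀ α) x) :
    coordForm ℂ (Bundle.Trivial B ℂ) x₀ (extDerivAt α) x =
      extDeriv (fun y => coordForm ℂ (Bundle.Trivial B ℂ) x₀ α ((extChartAt 𝓘(ℝ, E) x₀).symm y))
        (extChartAt 𝓘(ℝ, E) x₀ x) := by
  set rep := fun y => coordForm ℂ (Bundle.Trivial B ℂ) x₀ α ((extChartAt 𝓘(ℝ, E) x₀).symm y)
    with hrep
  set φ := extChartAt 𝓘(ℝ, E) x
  set φ₀ := extChartAt 𝓘(ℝ, E) x₀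
  set τ : E → E := φ₀ ∘ φ.symm
  have hxx : x ∈ φ.source := mem_extChartAt_source x
  have hx0 : x ∈ φ₀.source := by simpa [φ₀] using hx
  have hτx : τ (φ x) = φ₀ x := by simp [τ, φ.left_inv hxx]
  -- near `φ x`, the two coordinate expressions differ by the pull back along `τ`
  have hev : (fun y => coordForm ℂ (Bundle.Trivial B ℂ) x α (φ.symm y)) =ᶠ[nhds (φ x)]
      fun y => (rep (τ y)).compContinuousLinearMap (fderiv ℝ τ y) := by
    have h1 : φ.target ∈ nhds (φ x) := extChartAt_target_mem_nhds x
    have h2 : φ.symm ⁻¹' φ₀.source ∈ nhds (φ x) := by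
      refine (continuousAt_extChartAt_symm x).preimage_mem_nhds ?_
      rw [extChartAt_to_inv]
      exact extChartAt_source_mem_nhds' hx0
    filter_upwards [h1, h2] with y hy1 hy2
    have hz : φ.symm y ∈ φ.source := φ.map_target hy1
    have hz0 : φ.symm y ∈ φ₀.source := hy2
    have hd : fderiv ℝ τ y = tangentCoordChange 𝓘(ℝ, E) x x₀ (φ.symm y) := by
      have := hasFDerivWithinAt_tangentCoordChange (I := 𝓘(ℝ, E)) (x := x) (y := x₀) ⟨hz, hz0⟩
      rw [φ.right_inv hy1] at this
      simp only [modelWithCornersSelf_coe, Set.range_id, hasFDerivWithinAt_univ] at this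
      exact this.fderiv
    have hrt : rep (τ y) = coordForm ℂ (Bundle.Trivial B ℂ) x₀ α (φ.symm y) := by
      simp [hrep, τ, φ₀.left_inv hz0]
    rw [hrt, hd, coordForm_trivial α x _ (by simpa [φ] using hz),
      coordForm_trivial α x₀ _ (by simpa [φ₀] using hz0)]
    ext v
    exact congrArg (show E [⋀^Fin k]→L[ℝ] ℂ from α (φ.symm y)) (funext fun i =>
      (tangentCoordChange_comp (I := 𝓘(ℝ, E)) ⟨⟨hz, hz0⟩, mem_extChartAt_source _⟩).symm)
  have hrepd : DifferentiableAt ℝ rep (τ (φ x)) := by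
    rw [hτx]
    have h1 : ContMDiffAt 𝓘(ℝ, E) 𝓘(ℝ, E) 1 φ₀.symm (φ₀ x) :=
      (contMDiffOn_extChartAt_symm x₀).contMDiffAt
        ((isOpen_extChartAt_target x₀).mem_nhds (φ₀.map_source hx0))
    have h2 : ContMDiffAt 𝓘(ℝ, E) 𝓘(ℝ, E [⋀^Fin k]→L[ℝ] ℂ) 1 rep (φ₀ x) := by
      refine ContMDiffAt.comp (g := coordForm ℂ (Bundle.Trivial B ℂ) x₀ α) (φ₀ x) ?_ h1
      rwa [φ₀.left_inv hx0]
    exact h2.contDiffAt.differentiableAt one_ne_zero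
  have hτ : ContDiffAt ℝ 2 τ (φ x) := by
    have := contDiffWithinAt_ext_coord_change (I := 𝓘(ℝ, E)) (n := 2) x₀ x (y := φ x)
      (by
        rw [PartialEquiv.trans_source'', PartialEquiv.symm_symm, PartialEquiv.symm_target]
        exact Set.mem_image_of_mem _ ⟨hxx, hx0⟩)
    rw [modelWithCornersSelf_coe, Set.range_id, contDiffWithinAt_univ] at this
    exact this
  have hd : fderiv ℝ τ (φ x) = tangentCoordChange 𝓘(ℝ, E) x x₀ x := by
    have := hasFDerivWithinAt_tangentCoordChange (I := 𝓘(ℝ, E)) (x := x) (y := x₀) ⟨hxx, hx0⟩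
    simp only [modelWithCornersSelf_coe, Set.range_id, hasFDerivWithinAt_univ] at this
    exact this.fderiv
  rw [coordForm_trivial _ x₀ x hx]
  have he : extDerivAt α x =
    extDeriv (fun y => coordForm ℂ (Bundle.Trivial B ℂ) x α (φ.symm y)) (φ x) := rfl
  rw [he, hev.extDeriv_eq, extDeriv_pullback hrepd hτ (by simp), hτx, hd]
  ext v
  refine congrArg (extDeriv rep (φ₀ x)) (funext fun i => ?_)
  refine (tangentCoordChange_comp (I := 𝓘(ℝ, E)) ⟨⟨hx0, hxx⟩, hx0⟩).trans ?_
  exact tangentCoordChange_self hx0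

/-- The exterior derivative `d : Ωᵏ(U) → Ωᵏ⁺¹(U)`. -/
def ScalarForm.d {k : ℕ} {U : Opens B} (α : ScalarForm E k U) : ScalarForm E (k + 1) U :=
  ⟨fun x => open Classical in if x ∈ U then extDerivAt α.1 x else 0, by
    refine ⟨?_, fun x hx => if_neg hx⟩
    rw [isSmoothOn_iff]
    intro x₀ hx₀
    have hα := Form.contMDiffAt α hx₀
    have hrep : ContDiffAt ℝ ∞
        (fun y => coordForm ℂ (Bundle.Trivial B ℂ) x₀ α.1 ((extChartAt 𝓘(ℝ, E) x₀).symm y))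
        (extChartAt 𝓘(ℝ, E) x₀ x₀) := by
      rw [← contMDiffAt_iff_contDiffAt]
      refine ContMDiffAt.comp (g := coordForm ℂ (Bundle.Trivial B ℂ) x₀ α.1) _ ?_
        ((contMDiffOn_extChartAt_symm x₀).contMDiffAt (extChartAt_target_mem_nhds x₀))
      rwa [extChartAt_to_inv]
    have hd : ContDiffAt ℝ ∞ (extDeriv
        (fun y => coordForm ℂ (Bundle.Trivial B ℂ) x₀ α.1 ((extChartAt 𝓘(ℝ, E) x₀).symm y)))
        (extChartAt 𝓘(ℝ, E) x₀ x₀) :=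
      contDiffAt_extDeriv hrep
    refine (hd.comp_contMDiffAt contMDiffAt_extChartAt).congr_of_eventuallyEq ?_
    have h1 : ∀ᶠ x in nhds x₀, ContMDiffAt 𝓘(ℝ, E) 𝓘(ℝ, E [⋀^Fin k]→L[ℝ] ℂ) 1
        (coordForm ℂ (Bundle.Trivial B ℂ) x₀ α.1) x :=
      
      (contMDiffAt_iff_contMDiffAt_nhds (by simp)).1 (ContMDiffAt.of_le hα (by simp))
    filter_upwards [U.isOpen.mem_nhds hx₀, h1, chart_source_mem_nhds E x₀] with x hx hx1 hx2
    have hx' : x ∈ U := hx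
    rw [Function.comp_apply, ← coordForm_extDerivAt α.1 x₀ x hx2 hx1]
    simp only [coordForm, if_pos hx']⟩

section

variable {F : Type*} [NormedAddCommGroup F] [NormedSpace ℂ F]
  {V : B → Type*} [TopologicalSpace (TotalSpace F V)] [∀ x, AddCommGroup (V x)]
  [∀ x, Module ℂ (V x)] [∀ x, TopologicalSpace (V x)] [∀ x, IsTopologicalAddGroup (V x)]
  [∀ x, ContinuousSMul ℂ (V x)] [FiberBundle F V] [VectorBundle ℂ F V] [VectorBundle ℝ F V]

theorem coordForm_wedge {k p : ℕ} (α : ∀ x : B, FormFibre E (Bundle.Trivial B ℂ) k x)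
    (η : ∀ x : B, FormFibre E V p x) (x₀ x : B) :
    coordForm F V x₀ (fun x => wedge (α x) (η x)) x =
      wedge (coordForm ℂ (Bundle.Trivial B ℂ) x₀ α x) (coordForm F V x₀ η x) := by
  have h : coordForm ℂ (Bundle.Trivial B ℂ) x₀ α x =
      ContinuousAlternatingMap.compContinuousLinearMap (α x)
        ((trivializationAt E (TangentSpace 𝓘(ℝ, E)) x₀).symmL ℝ x) := by
    unfold coordForm ContinuousAlternatingMap.inCoordinates
    ext v
    simp
  rw [h]
  exact wedge_natural (α x) (η x) _ _ (trivialization_map_smul F V x₀ x)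

/-- Exterior multiplication `η ↦ α ∧ η` by a scalar form, on `V`-valued forms. -/
def Form.wedge {k p : ℕ} {U : Opens B} (α : ScalarForm E k U) :
    Form E F V p U →ₗ[ℂ] Form E F V (k + p) U where
  toFun η := ⟨fun x => SuperConn.wedge (α.1 x) (η.1 x), by
    refine ⟨?_, fun x hx => ?_⟩
    · rw [isSmoothOn_iff]
      intro x₀ hx₀
      refine ((isBoundedBilinearMap_wedge k p).contDiff.comp_contMDiffAt
        ((Form.contMDiffAt α hx₀).prodMk_space (Form.contMDiffAt η hx₀))).congr_of_eventuallyEq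
        (.of_forall fun x => ?_)
      exact coordForm_wedge α.1 η.1 x₀ x
    · change SuperConn.wedge (α.1 x) (η.1 x) = 0
      rw [η.2.2 x hx]
      simpa using wedge_smul_right (0 : ℂ) (α.1 x) (0 : FormFibre E V p x)⟩
  map_add' η η' := by
    ext1
    funext x
    exact wedge_add_right _ _ _
  map_smul' c η := by
    ext1
    funext x
    exact wedge_smul_right _ _ _

/-- The value at the point `x` of a `V`-valued form of form degree `p`, restricted to the
zero-dimensional manifold `{x}`: an element of `V x` if `p = 0`, and `0` if `p > 0`. -/
def Form.evalPoint {U : Opens B} (x : B) : (p : ℕ) → Form E F V p U →ₗ[ℂ] V x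
  | 0 =>
    { toFun := fun η => η.1 x ![]
      map_add' := fun _ _ => rfl
      map_smul' := fun _ _ => rfl }
  | _ + 1 => 0

end

end Forms

/-! ### Cohomology of graded differential modules -/

section Cohomology

variable {ι : Type*} [DecidableEq ι] {M : ι → Type*} [∀ i, AddCommGroup (M i)]
  [∀ i, Module ℂ (M i)]

/-- The part of degree `n` of `⨁ i, M i`, where `M i` is placed in degree `deg i`. -/
def degreePart (deg : ι → ℕ) (M : ι → Type*) [∀ i, AddCommGroup (M i)] [∀ i, Module ℂ (M i)]
    (n : ℕ) : Submodule ℂ (⨁ i, M i) where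
  carrier := {m | ∀ i, deg i ≠ n → m i = 0}
  add_mem' := fun {a b} ha hb i hi => by simp [ha i hi, hb i hi]
  zero_mem' := fun _ _ => rfl
  smul_mem' := fun c a ha i hi => by simp [DirectSum.smul_apply, ha i hi]

/-- The cocycles of degree `n` of an operator `D` (thought of as a differential of degree one). -/
def cocycles (deg : ι → ℕ) (D : (⨁ i, M i) →ₗ[ℂ] ⨁ i, M i) (n : ℕ) : Submodule ℂ (⨁ i, M i) :=
  LinearMap.ker D ⊓ degreePart deg M n

/-- The cohomology `Hⁿ = (ker D)ⁿ / (im D)ⁿ` in degree `n` of a differential `D` of degree one. -/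
abbrev Cohomology (deg : ι → ℕ) (D : (⨁ i, M i) →ₗ[ℂ] ⨁ i, M i) (n : ℕ) : Type _ :=
  cocycles deg D n ⧸ (LinearMap.range D).comap (cocycles deg D n).subtype

end Cohomology

/-! ### Superconnections on graded complex vector bundles -/

section Superconnection

variable (E : Type*) [NormedAddCommGroup E] [NormedSpace ℝ E]
  {B : Type*} [TopologicalSpace B] [ChartedSpace E B] [IsManifold 𝓘(ℝ, E) ∞ B]
  (F : ℕ → Type*) [∀ q, NormedAddCommGroup (F q)] [∀ q, NormedSpace ℂ (F q)]
  (V : ℕ → B → Type*) [∀ q, TopologicalSpace (TotalSpace (F q) (V q))]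
  [∀ q x, AddCommGroup (V q x)] [∀ q x, Module ℂ (V q x)] [∀ q x, TopologicalSpace (V q x)]
  [∀ q x, IsTopologicalAddGroup (V q x)] [∀ q x, ContinuousSMul ℂ (V q x)]
  [∀ q, FiberBundle (F q) (V q)] [∀ q, VectorBundle ℂ (F q) (V q)]
  [∀ q, VectorBundle ℝ (F q) (V q)]

/-- `Ω(U, V) = ⨁ Ωᵖ(U, V^q)`, for the graded vector bundle `V = ⨁ V^q`; the summand with index
`(p, q)` consists of the `V^q`-valued `p`-forms and has total degree `p + q`. -/
abbrev TotalForm (U : Opens B) : Type _ :=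
  ⨁ i : ℕ × ℕ, Form E (F i.2) (V i.2) i.1 U

/-- The total degree of the bidegree `(p, q)`. -/
def totalDegree (i : ℕ × ℕ) : ℕ := i.1 + i.2

variable {E F V}

/-- Exterior multiplication `η ↦ α ∧ η` by a scalar form, on `Ω(U, V)`. -/
def TotalForm.wedge {k : ℕ} {U : Opens B} (α : ScalarForm E k U) :
    TotalForm E F V U →ₗ[ℂ] TotalForm E F V U :=
  DirectSum.toModule ℂ (ℕ × ℕ) (TotalForm E F V U) fun i =>
    (DirectSum.lof ℂ (ℕ × ℕ) (fun i => Form E (F i.2) (V i.2) i.1 U) (k + i.1, i.2)).comp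
      (Form.wedge α)

/-- The restriction `Ω(W, V) → Ω(U, V)` for `U ≤ W`. -/
def TotalForm.restrict {U W : Opens B} (h : U ≤ W) :
    TotalForm E F V W →ₗ[ℂ] TotalForm E F V U :=
  DirectSum.lmap fun _ => Form.restrict h

/-- The restriction of `Ω(U, V)` to a point `x`, with values in the fibre `⨁ V^q x`. -/
def TotalForm.evalPoint {U : Opens B} (x : B) : TotalForm E F V U →ₗ[ℂ] ⨁ q, V q x :=
  DirectSum.toModule ℂ (ℕ × ℕ) (⨁ q, V q x) fun i =>
    (DirectSum.lof ℂ ℕ (fun q => V q x) i.2).comp (Form.evalPoint x i.1)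

variable (E F V) in
/-- A superconnection on the restriction of the graded vector bundle `V` to the open set `U`: a
linear operator on `Ω(U, V)` of total degree one satisfying the Leibniz rule
`D (α ∧ η) = dα ∧ η + (-1)^|α| α ∧ D η`. -/
structure Superconnection (U : Opens B) where
  /-- The underlying linear operator. -/
  op : TotalForm E F V U →ₗ[ℂ] TotalForm E F V U
  degree_one : ∀ (n : ℕ), ∀ η ∈ degreePart totalDegree (fun i => Form E (F i.2) (V i.2) i.1 U) n,
    op η ∈ degreePart totalDegree (fun i => Form E (F i.2) (V i.2) i.1 U) (n + 1)
  leibniz : ∀ (k : ℕ) (α : ScalarForm E k U) (η : TotalForm E F V U),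
    op (TotalForm.wedge α η) =
      TotalForm.wedge (ScalarForm.d α) η + (-1 : ℂ) ^ k • TotalForm.wedge α (op η)

/-- A superconnection is flat if `D² = 0`. -/
def Superconnection.IsFlat {U : Opens B} (D : Superconnection E F V U) : Prop :=
  D.op ∘ₗ D.op = 0

/-- `D'` is the restriction to `U` of the superconnection `D`. -/
def Superconnection.RestrictsTo {U W : Opens B} (h : U ≤ W) (D : Superconnection E F V W)
    (D' : Superconnection E F V U) : Prop :=
  ∀ η : TotalForm E F V W, D'.op (TotalForm.restrict h η) = TotalForm.restrict h (D.op η)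

/-- `A₀` is the form degree zero part of `D = ∇ - A₀ - A₁ - A₂ - ⋯`: for every section `s` of
`V^q`, the component of `D s` in `Ω⁰(B, V^(q+1))` is `-A₀ s`. -/
def Superconnection.HasDegreeZeroPart (D : Superconnection E F V (⊤ : Opens B))
    (A₀ : ∀ (q : ℕ) (x : B), V q x →ₗ[ℂ] V (q + 1) x) : Prop :=
  ∀ (q : ℕ) (s : Form E (F q) (V q) 0 (⊤ : Opens B)) (x : B),
    (D.op (DirectSum.lof ℂ (ℕ × ℕ) (fun i => Form E (F i.2) (V i.2) i.1 (⊤ : Opens B)) (0, q) s)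
      (0, q + 1)).1 x ![] = -A₀ q x (s.1 x ![])

/-- The operator `A₀(x)` of degree one on the fibre `⨁ V^q x`. -/
def fibreOp (A₀ : ∀ (q : ℕ) (x : B), V q x →ₗ[ℂ] V (q + 1) x) (x : B) :
    (⨁ q, V q x) →ₗ[ℂ] ⨁ q, V q x :=
  DirectSum.toModule ℂ ℕ (⨁ q, V q x) fun q =>
    (DirectSum.lof ℂ ℕ (fun q => V q x) (q + 1)).comp (A₀ q x)

end Superconnection

end SuperConn

end

open SuperConn

/-!
Restriction to a point `x` induces an isomorphism in cohomology as soon as every closed form on `U`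
that vanishes at `x` has a primitive that vanishes at `x`
(`exists_primitive_of_evalPoint_eq_zero`). Indeed restriction to `x` intertwines `D` with `-A₀(x)`
(`evalPoint_op`), the sign being harmless in cohomology, and every vector in the fibre at `x`
extends to a form. Given an `A₀(x)`-cocycle `v`, extend it to a form `ζ`; then `D ζ` is closed and
vanishes at `x`, and subtracting from `ζ` a primitive of `D ζ` that vanishes at `x` gives a
`D`-cocycle with value `v`. If a cocycle `ξ` has an exact value at `x`, then it differs from some
`D ζ` by a closed form vanishing at `x`, which is exact; so `ξ` is exact.

The primitive is found by transport along paths, in place of a contraction of the bundle. A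
contractible open set has a smooth family of paths from `x` to its points, the path from `x` to `x`
being run through forth and back (`exists_smooth_paths`). Pull `D` and the closed form `ξ` back to
the cylinder of end points `y` and times `t`. There the equation `D a = ξ` for a form `a` without
`dt`-component has a `dt`-component, which is a linear ordinary differential equation in `t`: the
transport equation. It has a unique solution that is zero at the initial time, and the solution is
smooth (`exists_transport`, from `exists_solution_linearODE`, and `transport_unique`). The defect
`D a - ξ` is closed and has no `dt`-component, so it solves the homogeneous equation; as it is zero
at the initial time, where the paths rest at `x` and `ξ` vanishes, it is zero everywhere
(`CylinderData.matrixOp_eq`). At the final time, where the cylinder is mapped to `U` by `y`, the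
solution is a primitive of `ξ`. By uniqueness, the solutions found in different charts agree
(`LocalTransport.pull_eq`), and the solution along the path from `x` to `x` is even in time, so that
its final value is its initial value `0` (`LocalTransport.apply_two_zero`).

Bundles are handled through global generators instead of frames: a partition of unity gives a
locally finite family of global sections with smooth coefficient functionals (`Generators`,
`nonempty_generators`). A form becomes a family of scalar forms, a section of the image of a
projection matrix `P`, and a superconnection becomes `a ↦ da P + ε(a) Θ` with a matrix `Θ` of forms
and the grading involution `ε` (`coefAt_op`). This also shows that superconnections are local
(`op_congr`), whence the existence and uniqueness of the restriction to an open set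
(`exists_unique_restrictsTo`), and that the component of form degree `0` of `D` is linear over the
functions, whence `A₀` (`op_apply_zero`).
-/

noncomputable section

namespace SuperConn

/-! ### Associativity of the exterior product -/

section WedgeAssoc

variable {T N : Type*} [NormedAddCommGroup T] [NormedSpace ℝ T] [NormedAddCommGroup N]
  [NormedSpace ℂ N]

theorem nsmul_left_cancel {m : ℕ} (hm : m ≠ 0) {x y : N} (h : m • x = m • y) : x = y := by
  rw [← Nat.cast_smul_eq_nsmul ℂ, ← Nat.cast_smul_eq_nsmul ℂ] at h
  exact smul_right_injective N (Nat.cast_ne_zero.2 hm : (m : ℂ) ≠ 0) h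

theorem map_perm_apply {k : ℕ} (α : T [⋀^Fin k]→L[ℝ] N) (v : Fin k → T) (σ : Equiv.Perm (Fin k)) :
    α (v ∘ σ) = Equiv.Perm.sign σ • α v :=
  α.toAlternatingMap.map_perm v σ

/-- The exterior product as a sum over all permutations: summing over permutations rather than
shuffles counts every term `k! p!` times. -/
theorem factorial_smul_wedge_apply {k p : ℕ} (α : T [⋀^Fin k]→L[ℝ] ℂ) (η : T [⋀^Fin p]→L[ℝ] N)
    (v : Fin (k + p) → T) :
    (k.factorial * p.factorial) • wedge α η v = ∑ σ : Equiv.Perm (Fin (k + p)),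
      Equiv.Perm.sign σ • (α (fun i => v (σ (Fin.castAdd p i))) •
        η (fun i => v (σ (Fin.natAdd k i)))) := by
  have h := MultilinearMap.domCoprod_alternization_eq α.toAlternatingMap η.toAlternatingMap
  have h2 := congrArg (fun f => TensorProduct.lift (Algebra.lsmul ℝ ℝ N).toLinearMap
    (f (fun i => v (finSumFinEquiv i)))) h
  simp only [Fintype.card_fin] at h2
  have h3 : (k.factorial * p.factorial) • wedge α η v =
      TensorProduct.lift (Algebra.lsmul ℝ ℝ N).toLinearMap
        (((k.factorial * p.factorial) • α.toAlternatingMap.domCoprod η.toAlternatingMap)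
          (fun i => v (finSumFinEquiv i))) := by
    rw [AlternatingMap.smul_apply, map_nsmul]
    rfl
  rw [h3, ← h2, MultilinearMap.alternatization_apply, map_sum,
    ← (finSumFinEquiv (m := k) (n := p)).permCongr.sum_comp]
  refine Finset.sum_congr rfl fun σ _ => ?_
  rw [Equiv.Perm.sign_permCongr, map_zsmul_unit]
  congr 1
  simp [MultilinearMap.domCoprod_apply, Equiv.permCongr_apply]

/-- The permutation of `Fin (k + p)` acting as `σ` on the first block and as `τ` on the second. -/
def blockPerm {k p : ℕ} (σ : Equiv.Perm (Fin k)) (τ : Equiv.Perm (Fin p)) :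
    Equiv.Perm (Fin (k + p)) :=
  finSumFinEquiv.permCongr (Equiv.Perm.sumCongr σ τ)

@[simp] theorem blockPerm_castAdd {k p : ℕ} (σ : Equiv.Perm (Fin k)) (τ : Equiv.Perm (Fin p))
    (i : Fin k) : blockPerm σ τ (Fin.castAdd p i) = Fin.castAdd p (σ i) := by
  simp [blockPerm, Equiv.permCongr_apply]

@[simp] theorem blockPerm_natAdd {k p : ℕ} (σ : Equiv.Perm (Fin k)) (τ : Equiv.Perm (Fin p))
    (i : Fin p) : blockPerm σ τ (Fin.natAdd k i) = Fin.natAdd k (τ i) := by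
  simp [blockPerm, Equiv.permCongr_apply]

theorem sign_blockPerm {k p : ℕ} (σ : Equiv.Perm (Fin k)) (τ : Equiv.Perm (Fin p)) :
    Equiv.Perm.sign (blockPerm σ τ) = Equiv.Perm.sign σ * Equiv.Perm.sign τ := by
  rw [blockPerm, Equiv.Perm.sign_permCongr, Equiv.Perm.sign_sumCongr]

theorem wedge_wedge_left {k p r : ℕ} (α : T [⋀^Fin k]→L[ℝ] ℂ) (β : T [⋀^Fin p]→L[ℝ] ℂ)
    (γ : T [⋀^Fin r]→L[ℝ] N) (v : Fin (k + p + r) → T) :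
    (k.factorial * p.factorial * r.factorial) • wedge (wedge α β) γ v =
      ∑ σ : Equiv.Perm (Fin (k + p + r)), Equiv.Perm.sign σ •
        (α (fun i => v (σ (Fin.castAdd r (Fin.castAdd p i)))) •
          β (fun i => v (σ (Fin.castAdd r (Fin.natAdd k i)))) •
            γ (fun i => v (σ (Fin.natAdd (k + p) i)))) := by
  have h := factorial_smul_wedge_apply (wedge α β) γ v
  refine nsmul_left_cancel (m := (k + p).factorial) (by positivity) ?_
  calc (k + p).factorial • ((k.factorial * p.factorial * r.factorial) • wedge (wedge α β) γ v)
      = (k.factorial * p.factorial) • (((k + p).factorial * r.factorial) •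
          wedge (wedge α β) γ v) := by
        rw [smul_smul, smul_smul]
        congr 1
        ring
    _ = ∑ σ : Equiv.Perm (Fin (k + p + r)), ∑ τ : Equiv.Perm (Fin (k + p)),
          Equiv.Perm.sign (σ * blockPerm τ (1 : Equiv.Perm (Fin r))) •
        (α (fun i => v ((σ * blockPerm τ (1 : Equiv.Perm (Fin r))) (Fin.castAdd r (Fin.castAdd p i)))) •
          β (fun i => v ((σ * blockPerm τ (1 : Equiv.Perm (Fin r))) (Fin.castAdd r (Fin.natAdd k i)))) •
            γ (fun i => v ((σ * blockPerm τ (1 : Equiv.Perm (Fin r))) (Fin.natAdd (k + p) i)))) := by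
        rw [h, Finset.smul_sum]
        refine Finset.sum_congr rfl fun σ _ => ?_
        rw [smul_comm, ← smul_assoc (_ * _) (wedge α β _) (γ _), factorial_smul_wedge_apply,
          Finset.sum_smul,
          Finset.smul_sum]
        refine Finset.sum_congr rfl fun τ _ => ?_
        simp only [Equiv.Perm.sign_mul, sign_blockPerm, Equiv.Perm.sign_one, mul_one,
          Equiv.Perm.mul_apply, blockPerm_castAdd, blockPerm_natAdd, Equiv.Perm.one_apply,
          mul_smul, smul_assoc]
    _ = _ := by
        rw [Finset.sum_comm]
        have : ∀ (f : Equiv.Perm (Fin (k + p + r)) → N) (τ : Equiv.Perm (Fin (k + p))),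
            ∑ σ : Equiv.Perm (Fin (k + p + r)), f (σ * blockPerm τ (1 : Equiv.Perm (Fin r))) = ∑ σ, f σ :=
          fun f τ => Equiv.sum_comp (Equiv.mulRight (blockPerm τ (1 : Equiv.Perm (Fin r)))) f
        rw [Finset.sum_congr rfl fun τ _ => this (fun σ => Equiv.Perm.sign σ •
          (α (fun i => v (σ (Fin.castAdd r (Fin.castAdd p i)))) •
          β (fun i => v (σ (Fin.castAdd r (Fin.natAdd k i)))) •
            γ (fun i => v (σ (Fin.natAdd (k + p) i))))) τ]
        simp [Fintype.card_perm]

theorem wedge_wedge_right {k p r : ℕ} (α : T [⋀^Fin k]→L[ℝ] ℂ) (β : T [⋀^Fin p]→L[ℝ] ℂ)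
    (γ : T [⋀^Fin r]→L[ℝ] N) (v : Fin (k + (p + r)) → T) :
    (k.factorial * p.factorial * r.factorial) • wedge α (wedge β γ) v =
      ∑ σ : Equiv.Perm (Fin (k + (p + r))), Equiv.Perm.sign σ •
        (α (fun i => v (σ (Fin.castAdd (p + r) i))) •
          β (fun i => v (σ (Fin.natAdd k (Fin.castAdd r i)))) •
            γ (fun i => v (σ (Fin.natAdd k (Fin.natAdd p i))))) := by
  have h := factorial_smul_wedge_apply α (wedge β γ) v
  refine nsmul_left_cancel (m := (p + r).factorial) (by positivity) ?_
  calc (p + r).factorial • ((k.factorial * p.factorial * r.factorial) • wedge α (wedge β γ) v)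
      = (p.factorial * r.factorial) • ((k.factorial * (p + r).factorial) •
          wedge α (wedge β γ) v) := by
        rw [smul_smul, smul_smul]
        congr 1
        ring
    _ = ∑ σ : Equiv.Perm (Fin (k + (p + r))), ∑ τ : Equiv.Perm (Fin (p + r)),
          Equiv.Perm.sign (σ * blockPerm (1 : Equiv.Perm (Fin k)) τ) •
        (α (fun i => v ((σ * blockPerm (1 : Equiv.Perm (Fin k)) τ) (Fin.castAdd (p + r) i))) •
          β (fun i => v ((σ * blockPerm (1 : Equiv.Perm (Fin k)) τ) (Fin.natAdd k (Fin.castAdd r i)))) •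
            γ (fun i => v ((σ * blockPerm (1 : Equiv.Perm (Fin k)) τ) (Fin.natAdd k (Fin.natAdd p i))))) := by
        rw [h, Finset.smul_sum]
        refine Finset.sum_congr rfl fun σ _ => ?_
        rw [smul_comm, smul_comm _ (α _), factorial_smul_wedge_apply, Finset.smul_sum,
          Finset.smul_sum]
        refine Finset.sum_congr rfl fun τ _ => ?_
        simp only [Equiv.Perm.sign_mul, sign_blockPerm, Equiv.Perm.sign_one, one_mul,
          Equiv.Perm.mul_apply, blockPerm_castAdd, blockPerm_natAdd, Equiv.Perm.one_apply,
          mul_smul, Units.smul_def, smul_comm (α _)]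
    _ = _ := by
        rw [Finset.sum_comm]
        have : ∀ (f : Equiv.Perm (Fin (k + (p + r))) → N) (τ : Equiv.Perm (Fin (p + r))),
            ∑ σ : Equiv.Perm (Fin (k + (p + r))), f (σ * blockPerm 1 τ) = ∑ σ, f σ :=
          fun f τ => Equiv.sum_comp (Equiv.mulRight (blockPerm 1 τ)) f
        rw [Finset.sum_congr rfl fun τ _ => this (fun σ => Equiv.Perm.sign σ •
          (α (fun i => v (σ (Fin.castAdd (p + r) i))) •
          β (fun i => v (σ (Fin.natAdd k (Fin.castAdd r i)))) •
            γ (fun i => v (σ (Fin.natAdd k (Fin.natAdd p i)))))) τ]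
        simp [Fintype.card_perm]

theorem wedge_assoc {k p r : ℕ} (α : T [⋀^Fin k]→L[ℝ] ℂ) (β : T [⋀^Fin p]→L[ℝ] ℂ)
    (γ : T [⋀^Fin r]→L[ℝ] N) (v : Fin (k + (p + r)) → T) :
    wedge (wedge α β) γ (fun i => v (Fin.cast (Nat.add_assoc k p r) i)) =
      wedge α (wedge β γ) v := by
  refine nsmul_left_cancel (m := (k.factorial * p.factorial * r.factorial)) (by positivity) ?_
  rw [wedge_wedge_left, wedge_wedge_right,
    ← (finCongr (Nat.add_assoc k p r)).permCongr.sum_comp]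
  refine Finset.sum_congr rfl fun σ _ => ?_
  rw [Equiv.Perm.sign_permCongr]
  have h1 : ∀ i, (finCongr (Nat.add_assoc k p r)).symm (Fin.castAdd (p + r) i) =
      Fin.castAdd r (Fin.castAdd p i) := fun i => rfl
  have h2 : ∀ i, (finCongr (Nat.add_assoc k p r)).symm (Fin.natAdd k (Fin.castAdd r i)) =
      Fin.castAdd r (Fin.natAdd k i) := fun i => rfl
  have h3 : ∀ i, (finCongr (Nat.add_assoc k p r)).symm (Fin.natAdd k (Fin.natAdd p i)) =
      Fin.natAdd (k + p) i := fun i => Fin.ext (by simp [Nat.add_assoc])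
  simp only [Equiv.permCongr_apply, h1, h2, h3]
  rfl

theorem wedge_zero_left_apply {p : ℕ} (α : T [⋀^Fin 0]→L[ℝ] ℂ) (η : T [⋀^Fin p]→L[ℝ] N)
    (v : Fin (0 + p) → T) :
    wedge α η v = α ![] • η (fun i => v (Fin.natAdd 0 i)) := by
  have h := factorial_smul_wedge_apply α η v
  refine nsmul_left_cancel (m := (Nat.factorial 0 * p.factorial)) (by positivity) ?_
  rw [h, ← (finCongr (Nat.zero_add p).symm).permCongr.sum_comp]
  have : ∀ σ : Equiv.Perm (Fin p),
      Equiv.Perm.sign ((finCongr (Nat.zero_add p).symm).permCongr σ) •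
        (α (fun i => v ((finCongr (Nat.zero_add p).symm).permCongr σ (Fin.castAdd p i))) •
          η (fun i => v ((finCongr (Nat.zero_add p).symm).permCongr σ (Fin.natAdd 0 i)))) =
      α ![] • η (fun i => v (Fin.natAdd 0 i)) := by
    intro σ
    rw [Equiv.Perm.sign_permCongr]
    have h1 : (fun i => v ((finCongr (Nat.zero_add p).symm).permCongr σ (Fin.natAdd 0 i))) =
        (fun i => v (Fin.natAdd 0 i)) ∘ σ := by
      funext i
      simp [Equiv.permCongr_apply]
    rw [h1, map_perm_apply]
    rw [smul_comm (α _), smul_smul, Int.units_mul_self, one_smul]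
    congr 2
    exact Subsingleton.elim _ _
  rw [Finset.sum_congr rfl fun σ _ => this σ]
  simp [Fintype.card_perm]

theorem wedge_zero_right_apply {p : ℕ} (α : T [⋀^Fin p]→L[ℝ] ℂ) (η : T [⋀^Fin 0]→L[ℝ] N)
    (v : Fin p → T) :
    wedge α η v = α v • η ![] := by
  have h := factorial_smul_wedge_apply α η v
  refine nsmul_left_cancel (m := (p.factorial * Nat.factorial 0)) (by positivity) ?_
  rw [h]
  have : ∀ σ : Equiv.Perm (Fin p),
      Equiv.Perm.sign σ • (α (fun i => v (σ (Fin.castAdd 0 i))) •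
        η (fun i => v (σ (Fin.natAdd p i)))) = α v • η ![] := by
    intro σ
    have h1 : (fun i => v (σ (Fin.castAdd 0 i))) = v ∘ σ := rfl
    rw [h1, map_perm_apply, smul_assoc, smul_smul, Int.units_mul_self, one_smul]
    congr 2
    exact Subsingleton.elim _ _
  refine (Finset.sum_congr rfl fun σ _ => this σ).trans ?_
  simp [Fintype.card_perm]

theorem ofSubsingleton_apply' (ε : T →L[ℝ] ℂ) (v : Fin 1 → T) :
    ContinuousAlternatingMap.ofSubsingleton ℝ T ℂ (0 : Fin 1) ε v = ε (v 0) := rfl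

/-- Exterior multiplication by a one-form on the left is the alternating sum which also computes
the exterior derivative. -/
theorem wedge_one_left_apply {k : ℕ} (ε : T →L[ℝ] ℂ) (α : T [⋀^Fin k]→L[ℝ] N)
    (v : Fin (k + 1) → T) :
    wedge (ContinuousAlternatingMap.ofSubsingleton ℝ T ℂ (0 : Fin 1) ε) α
        (fun i => v (Fin.cast (Nat.add_comm 1 k) i)) =
      ∑ i : Fin (k + 1), (-1 : ℤ) ^ (i : ℕ) • (ε (v i) • α (i.removeNth v)) := by
  have h := factorial_smul_wedge_apply (ContinuousAlternatingMap.ofSubsingleton ℝ T ℂ (0 : Fin 1) ε)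
    α (fun i => v (Fin.cast (Nat.add_comm 1 k) i))
  refine nsmul_left_cancel (m := (Nat.factorial 1 * k.factorial)) (by positivity) ?_
  rw [h, ← (finCongr (Nat.add_comm k 1)).permCongr.sum_comp]
  -- a permutation of `Fin (k + 1)` is the cycle moving `0` to `i`, after a permutation fixing `0`
  let Φ : Fin (k + 1) × Equiv.Perm (Fin k) → Equiv.Perm (Fin (k + 1)) := fun x =>
    x.1.cycleRange.symm * Equiv.Perm.decomposeFin.symm (0, x.2)
  have hΦ0 : ∀ x, Φ x 0 = x.1 := by
    intro x
    simp [Φ, Equiv.Perm.mul_apply, Fin.cycleRange_symm_zero]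
  have hΦs : ∀ x j, Φ x (Fin.succ j) = x.1.succAbove (x.2 j) := by
    intro x j
    simp [Φ, Equiv.Perm.mul_apply, Fin.cycleRange_symm_succ]
  have hΦ : Function.Bijective Φ := by
    rw [Fintype.bijective_iff_injective_and_card]
    refine ⟨fun x y hxy => ?_, ?_⟩
    · have h1 : x.1 = y.1 := by rw [← hΦ0 x, ← hΦ0 y, hxy]
      refine Prod.ext h1 (Equiv.ext fun j => ?_)
      have := hΦs x j
      rw [hxy, hΦs, h1] at this
      exact (Fin.succAbove_right_injective this).symm
    · simp [Fintype.card_perm, Nat.factorial_succ]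
  have hsign : ∀ x, Equiv.Perm.sign (Φ x) = (-1) ^ (x.1 : ℕ) * Equiv.Perm.sign x.2 := by
    intro x
    simp only [Φ, Equiv.Perm.sign_mul, Equiv.Perm.sign_symm, Fin.sign_cycleRange,
      Equiv.Perm.decomposeFin.symm_sign]
    simp
  rw [← hΦ.sum_comp, Fintype.sum_prod_type, Finset.smul_sum]
  refine Finset.sum_congr rfl fun i _ => ?_
  have : ∀ τ : Equiv.Perm (Fin k),
      Equiv.Perm.sign ((finCongr (Nat.add_comm k 1)).permCongr (Φ (i, τ))) •
        ((ContinuousAlternatingMap.ofSubsingleton ℝ T ℂ (0 : Fin 1) ε)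
          (fun j => v (Fin.cast (Nat.add_comm 1 k)
            ((finCongr (Nat.add_comm k 1)).permCongr (Φ (i, τ)) (Fin.castAdd k j)))) •
          α (fun j => v (Fin.cast (Nat.add_comm 1 k)
            ((finCongr (Nat.add_comm k 1)).permCongr (Φ (i, τ)) (Fin.natAdd 1 j))))) =
      (-1 : ℤ) ^ (i : ℕ) • (ε (v i) • α (i.removeNth v)) := by
    intro τ
    have h1 : (fun j => v (Fin.cast (Nat.add_comm 1 k)
        ((finCongr (Nat.add_comm k 1)).permCongr (Φ (i, τ)) (Fin.natAdd 1 j)))) =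
        i.removeNth v ∘ τ := by
      funext j
      have : (finCongr (Nat.add_comm k 1)).symm (Fin.natAdd 1 j) = Fin.succ j := by
        ext; simp
      simp only [Equiv.permCongr_apply, this, hΦs]
      rfl
    have h2 : (fun j : Fin 1 => v (Fin.cast (Nat.add_comm 1 k)
        ((finCongr (Nat.add_comm k 1)).permCongr (Φ (i, τ)) (Fin.castAdd k j)))) =
        fun _ => v i := by
      funext j
      have : (finCongr (Nat.add_comm k 1)).symm (Fin.castAdd k j) = 0 := by
        ext; simp
      simp only [Equiv.permCongr_apply, this, hΦ0]
      rfl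
    rw [h1, h2, map_perm_apply, Equiv.Perm.sign_permCongr, hsign, ofSubsingleton_apply', mul_smul,
      smul_comm (ε (v i)), smul_smul (Equiv.Perm.sign τ), Int.units_mul_self, one_smul]
    simp [Units.smul_def]
  rw [Finset.sum_congr rfl fun τ _ => this τ]
  simp [Fintype.card_perm]

/-- One-forms commute with `k`-forms up to the sign `(-1)^k`. -/
theorem wedge_one_right_apply {k : ℕ} (ε : T →L[ℝ] ℂ) (α : T [⋀^Fin k]→L[ℝ] ℂ)
    (v : Fin (k + 1) → T) :
    wedge (ContinuousAlternatingMap.ofSubsingleton ℝ T ℂ (0 : Fin 1) ε) α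
        (fun i => v (Fin.cast (Nat.add_comm 1 k) i)) =
      (-1 : ℤ) ^ k • wedge α (ContinuousAlternatingMap.ofSubsingleton ℝ T ℂ (0 : Fin 1) ε) v := by
  refine nsmul_left_cancel (m := (Nat.factorial 1 * k.factorial)) (by positivity) ?_
  rw [factorial_smul_wedge_apply, smul_comm, mul_comm (Nat.factorial 1), factorial_smul_wedge_apply,
    ← ((finCongr (Nat.add_comm k 1)).permCongr).sum_comp,
    ← Equiv.sum_comp (Equiv.mulRight (finRotate (k + 1))) (fun σ => Equiv.Perm.sign σ •
      ((α fun i => v (σ (Fin.castAdd 1 i))) •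
        (ContinuousAlternatingMap.ofSubsingleton ℝ T ℂ (0 : Fin 1) ε) fun i =>
          v (σ (Fin.natAdd k i)))), Finset.smul_sum]
  refine Finset.sum_congr rfl fun σ _ => ?_
  have h1 : (fun i => v ((Equiv.mulRight (finRotate (k + 1)) σ) (Fin.castAdd 1 i))) =
      fun i => v (σ i.succ) := by
    funext i
    have : Fin.castAdd 1 i = i.castSucc := rfl
    simp [this, finRotate_apply]
  have h2 : (fun i => v ((Equiv.mulRight (finRotate (k + 1)) σ) (Fin.natAdd k i))) =
      fun i : Fin 1 => v (σ 0) := by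
    funext i
    have : Fin.natAdd k i = Fin.last k := by ext; simp
    simp [this]
  have h3 : (fun j => v (Fin.cast (Nat.add_comm 1 k)
        ((finCongr (Nat.add_comm k 1)).permCongr σ (Fin.natAdd 1 j)))) =
        fun j => v (σ j.succ) := by
    funext j
    have : (finCongr (Nat.add_comm k 1)).symm (Fin.natAdd 1 j) = Fin.succ j := by
      ext; simp
    simp only [Equiv.permCongr_apply, this]
    rfl
  have h4 : (fun j : Fin 1 => v (Fin.cast (Nat.add_comm 1 k)
        ((finCongr (Nat.add_comm k 1)).permCongr σ (Fin.castAdd k j)))) =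
        fun _ => v (σ 0) := by
    funext j
    have : (finCongr (Nat.add_comm k 1)).symm (Fin.castAdd k j) = 0 := by
      ext; simp
    simp only [Equiv.permCongr_apply, this]
    rfl
  have h5 : Equiv.Perm.sign (Equiv.mulRight (finRotate (k + 1)) σ) =
      Equiv.Perm.sign σ * (-1) ^ k := by
    simp [Equiv.Perm.sign_mul, sign_finRotate]
  rw [h5]
  erw [h1, h2, h3, h4]
  rw [Equiv.Perm.sign_permCongr, smul_eq_mul, smul_eq_mul, mul_comm (α _), mul_comm, mul_smul]
  simp only [Units.smul_def, Units.val_pow_eq_pow_val, Units.val_neg, Units.val_one, smul_smul]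
  rcases neg_one_pow_eq_or ℤ k with h | h <;> simp [h]

end WedgeAssoc

/-! ### The algebra of inhomogeneous forms -/

section ExtAlg

variable {T T' N : Type*} [NormedAddCommGroup T] [NormedSpace ℝ T] [NormedAddCommGroup T']
  [NormedSpace ℝ T'] [NormedAddCommGroup N] [NormedSpace ℂ N]

/-- Transport of forms along an equality `m = p` of degrees, extended by `0` to `m ≠ p`. -/
def castForm (m p : ℕ) : (T [⋀^Fin m]→L[ℝ] N) →L[ℝ] (T [⋀^Fin p]→L[ℝ] N) :=
  if h : m = p then h ▸ ContinuousLinearMap.id ℝ _ else 0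

@[simp] theorem castForm_self (p : ℕ) (α : T [⋀^Fin p]→L[ℝ] N) : castForm p p α = α := by
  simp [castForm]

theorem castForm_of_ne {m p : ℕ} (h : m ≠ p) (α : T [⋀^Fin m]→L[ℝ] N) : castForm m p α = 0 := by
  simp [castForm, h]

theorem castForm_apply {m p : ℕ} (h : m = p) (α : T [⋀^Fin m]→L[ℝ] N) (v : Fin p → T) :
    castForm m p α v = α fun i => v (Fin.cast h i) := by
  subst h
  simp

variable (T) in
/-- The algebra of inhomogeneous complex valued alternating forms on `T`. It is the product, rather
than the direct sum, over all degrees, which makes no difference in finite dimension. -/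
abbrev ExtAlg : Type _ := ∀ p : ℕ, T [⋀^Fin p]→L[ℝ] ℂ

namespace ExtAlg

@[ext] theorem ext {a b : ExtAlg T} (h : ∀ p, a p = b p) : a = b := funext h

theorem sum_apply {ι : Type*} (s : Finset ι) (f : ι → ExtAlg T) (p : ℕ) :
    (∑ i ∈ s, f i) p = ∑ i ∈ s, f i p :=
  Finset.sum_apply p s f

/-- A homogeneous form, as an inhomogeneous one. -/
def of (p : ℕ) (α : T [⋀^Fin p]→L[ℝ] ℂ) : ExtAlg T :=
  fun m => castForm p m α

@[simp] theorem of_apply_self (p : ℕ) (α : T [⋀^Fin p]→L[ℝ] ℂ) : of p α p = α := castForm_self p α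

theorem of_apply_of_ne {p m : ℕ} (h : p ≠ m) (α : T [⋀^Fin p]→L[ℝ] ℂ) : of p α m = 0 :=
  castForm_of_ne h α

/-- The exterior product. -/
instance : Mul (ExtAlg T) where
  mul a b := fun p => ∑ x ∈ Finset.HasAntidiagonal.antidiagonal p, castForm (x.1 + x.2) p (wedge (a x.1) (b x.2))

theorem mul_apply (a b : ExtAlg T) (p : ℕ) : (a * b) p =
    ∑ x ∈ Finset.HasAntidiagonal.antidiagonal p, castForm (x.1 + x.2) p (wedge (a x.1) (b x.2)) := rfl

theorem wedge_zero' {k p : ℕ} (α : T [⋀^Fin k]→L[ℝ] ℂ) :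
    wedge α (0 : T [⋀^Fin p]→L[ℝ] N) = 0 := by
  simpa using wedge_smul_right (0 : ℂ) α (0 : T [⋀^Fin p]→L[ℝ] N)

theorem zero_wedge' {k p : ℕ} (η : T [⋀^Fin p]→L[ℝ] N) :
    wedge (0 : T [⋀^Fin k]→L[ℝ] ℂ) η = 0 := by
  ext v
  simp [wedge_apply]

/-- The exterior product as a bilinear map. -/
def wedgeHom (k p : ℕ) : (T [⋀^Fin k]→L[ℝ] ℂ) →+ (T [⋀^Fin p]→L[ℝ] N) →+
    (T [⋀^Fin (k + p)]→L[ℝ] N) :=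
  AddMonoidHom.mk' (fun α => AddMonoidHom.mk' (fun η => wedge α η) (wedge_add_right α))
    fun α β => by ext1 η; exact wedge_add_left α β η

theorem sum_wedge {ι : Type*} {k p : ℕ} (s : Finset ι) (f : ι → T [⋀^Fin k]→L[ℝ] ℂ)
    (η : T [⋀^Fin p]→L[ℝ] N) : wedge (∑ i ∈ s, f i) η = ∑ i ∈ s, wedge (f i) η := by
  have h := congrArg (fun φ => φ η) (map_sum (wedgeHom (N := N) k p) f s)
  rw [AddMonoidHom.finsetSum_apply] at h
  exact h

theorem wedge_sum {ι : Type*} {k p : ℕ} (s : Finset ι) (α : T [⋀^Fin k]→L[ℝ] ℂ)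
    (f : ι → T [⋀^Fin p]→L[ℝ] N) : wedge α (∑ i ∈ s, f i) = ∑ i ∈ s, wedge α (f i) :=
  map_sum (wedgeHom k p α) f s

theorem castForm_wedge_assoc {k l m p : ℕ} (α : T [⋀^Fin k]→L[ℝ] ℂ) (β : T [⋀^Fin l]→L[ℝ] ℂ)
    (γ : T [⋀^Fin m]→L[ℝ] ℂ) :
    castForm (k + l + m) p (wedge (wedge α β) γ) = castForm (k + (l + m)) p (wedge α (wedge β γ)) := by
  by_cases h : k + (l + m) = p
  · subst h
    ext v
    rw [castForm_apply (by omega), castForm_self]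
    exact wedge_assoc α β γ v
  · rw [castForm_of_ne h, castForm_of_ne (by omega)]

theorem mul_assoc' (a b c : ExtAlg T) : a * b * c = a * (b * c) := by
  ext1 p
  have h1 : (a * b * c) p = ∑ x ∈ Finset.HasAntidiagonal.antidiagonal p, ∑ y ∈ Finset.HasAntidiagonal.antidiagonal x.1,
      castForm (y.1 + y.2 + x.2) p (wedge (wedge (a y.1) (b y.2)) (c x.2)) := by
    rw [mul_apply]
    refine Finset.sum_congr rfl fun x _ => ?_
    rw [mul_apply, sum_wedge, map_sum]
    refine Finset.sum_congr rfl fun y hy => ?_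
    obtain ⟨i, j⟩ := x
    obtain rfl := Finset.HasAntidiagonal.mem_antidiagonal.1 hy
    simp
  have h2 : (a * (b * c)) p = ∑ x ∈ Finset.HasAntidiagonal.antidiagonal p, ∑ y ∈ Finset.HasAntidiagonal.antidiagonal x.2,
      castForm (x.1 + (y.1 + y.2)) p (wedge (a x.1) (wedge (b y.1) (c y.2))) := by
    rw [mul_apply]
    refine Finset.sum_congr rfl fun x _ => ?_
    rw [mul_apply, wedge_sum, map_sum]
    refine Finset.sum_congr rfl fun y hy => ?_
    obtain ⟨i, j⟩ := x
    obtain rfl := Finset.HasAntidiagonal.mem_antidiagonal.1 hy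
    simp
  rw [h1, h2, Finset.sum_sigma', Finset.sum_sigma']
  refine Finset.sum_nbij' (fun x => ⟨(x.2.1, x.2.2 + x.1.2), (x.2.2, x.1.2)⟩)
    (fun x => ⟨(x.1.1 + x.2.1, x.2.2), (x.1.1, x.2.1)⟩) ?_ ?_ ?_ ?_ ?_
  · rintro ⟨⟨i, j⟩, ⟨k, l⟩⟩ h
    simp at h ⊢
    omega
  · rintro ⟨⟨i, j⟩, ⟨k, l⟩⟩ h
    simp at h ⊢
    omega
  · rintro ⟨⟨i, j⟩, ⟨k, l⟩⟩ h
    simp only [Finset.mem_sigma, Finset.HasAntidiagonal.mem_antidiagonal] at h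
    obtain ⟨rfl, rfl⟩ := h
    rfl
  · rintro ⟨⟨i, j⟩, ⟨k, l⟩⟩ h
    simp only [Finset.mem_sigma, Finset.HasAntidiagonal.mem_antidiagonal] at h
    obtain ⟨rfl, rfl⟩ := h
    rfl
  · rintro ⟨⟨i, j⟩, ⟨k, l⟩⟩ _
    exact castForm_wedge_assoc _ _ _

/-- The constants in degree `0`. -/
def const (c : ℂ) : ExtAlg T := of 0 (ContinuousAlternatingMap.constOfIsEmpty ℝ T (Fin 0) c)

instance : One (ExtAlg T) := ⟨const 1⟩

theorem one_apply_of_ne {p : ℕ} (h : 0 ≠ p) : (1 : ExtAlg T) p = 0 := of_apply_of_ne h _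

theorem one_apply_zero : (1 : ExtAlg T) 0 = ContinuousAlternatingMap.constOfIsEmpty ℝ T (Fin 0) 1 :=
  of_apply_self _ _

theorem wedge_zero_left {k : ℕ} (α : T [⋀^Fin 0]→L[ℝ] ℂ) (η : T [⋀^Fin k]→L[ℝ] N) :
    castForm (0 + k) k (wedge α η) = α ![] • η := by
  ext v
  rw [castForm_apply (by omega), wedge_zero_left_apply]
  simp only [ContinuousAlternatingMap.smul_apply]
  congr 2
  funext i
  congr 1
  ext
  simp

theorem wedge_zero_right {k : ℕ} (α : T [⋀^Fin k]→L[ℝ] ℂ) (f : T [⋀^Fin 0]→L[ℝ] ℂ) :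
    wedge α f = f ![] • α := by
  ext v
  rw [wedge_zero_right_apply]
  simp [mul_comm]

/-- Multiplication by an element concentrated in degree `0`. -/
theorem mul_apply_of_left {a : ExtAlg T} (ha : ∀ p, p ≠ 0 → a p = 0) (b : ExtAlg T) (p : ℕ) :
    (a * b) p = a 0 ![] • b p := by
  rw [mul_apply, Finset.sum_eq_single (0, p)]
  · exact wedge_zero_left _ _
  · rintro ⟨i, j⟩ h hne
    simp only [Finset.HasAntidiagonal.mem_antidiagonal] at h
    have : i ≠ 0 := by
      rintro rfl
      apply hne
      simp_all
    simp [ha i this, zero_wedge']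
  · simp

theorem mul_apply_of_right (b : ExtAlg T) {a : ExtAlg T} (ha : ∀ p, p ≠ 0 → a p = 0) (p : ℕ) :
    (b * a) p = a 0 ![] • b p := by
  rw [mul_apply, Finset.sum_eq_single (p, 0)]
  · have := wedge_zero_right (b p) (a 0)
    simpa using this
  · rintro ⟨i, j⟩ h hne
    simp only [Finset.HasAntidiagonal.mem_antidiagonal] at h
    have : j ≠ 0 := by
      rintro rfl
      apply hne
      simp_all
    simp [ha j this, wedge_zero']
  · simp

instance : Ring (ExtAlg T) where
  __ := (inferInstance : AddCommGroup (ExtAlg T))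
  left_distrib a b c := by
    ext1 p
    simp [mul_apply, wedge_add_right, Finset.sum_add_distrib]
  right_distrib a b c := by
    ext1 p
    simp [mul_apply, wedge_add_left, Finset.sum_add_distrib]
  zero_mul a := by ext1 p; simp [mul_apply, zero_wedge']
  mul_zero a := by ext1 p; simp [mul_apply, wedge_zero']
  mul_assoc := mul_assoc'
  one_mul a := by
    ext1 p
    rw [mul_apply_of_left (fun p h => one_apply_of_ne h.symm), one_apply_zero]
    simp
  mul_one a := by
    ext1 p
    rw [mul_apply_of_right _ (fun p h => one_apply_of_ne h.symm), one_apply_zero]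
    simp

theorem of_mul_of {k m : ℕ} (α : T [⋀^Fin k]→L[ℝ] ℂ) (β : T [⋀^Fin m]→L[ℝ] ℂ) :
    of k α * of m β = of (k + m) (wedge α β) := by
  ext1 p
  rw [mul_apply]
  by_cases h : k + m = p
  · subst h
    rw [Finset.sum_eq_single (k, m)]
    · simp
    · rintro ⟨i, j⟩ h hne
      simp only [Finset.HasAntidiagonal.mem_antidiagonal] at h
      have : k ≠ i := by
        rintro rfl
        apply hne
        simp_all
      simp [of_apply_of_ne this, zero_wedge']
    · simp
  · rw [of_apply_of_ne h]
    refine Finset.sum_eq_zero ?_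
    rintro ⟨i, j⟩ hij
    simp only [Finset.HasAntidiagonal.mem_antidiagonal] at hij
    by_cases hk : k = i
    · have : m ≠ j := by omega
      simp [of_apply_of_ne this, wedge_zero']
    · simp [of_apply_of_ne hk, zero_wedge']

/-- The grading involution, which is `(-1)^p` in degree `p`. -/
def eps : ExtAlg T →+* ExtAlg T where
  toFun a := fun p => (-1 : ℂ) ^ p • a p
  map_zero' := by ext1 p; simp
  map_add' a b := by ext1 p; simp
  map_one' := by
    ext1 p
    by_cases h : 0 = p
    · subst h; simp
    · rw [one_apply_of_ne h]
      exact smul_zero (M := ℂ) (A := T [⋀^Fin p]→L[ℝ] ℂ) _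
  map_mul' a b := by
    ext1 p
    simp only [mul_apply, Finset.smul_sum]
    refine Finset.sum_congr rfl ?_
    rintro ⟨i, j⟩ h
    obtain rfl := Finset.HasAntidiagonal.mem_antidiagonal.1 h
    simp [wedge_smul_left, wedge_smul_right, smul_smul, pow_add, mul_comm]

theorem eps_apply (a : ExtAlg T) (p : ℕ) : eps a p = (-1 : ℂ) ^ p • a p := rfl

@[simp] theorem eps_eps (a : ExtAlg T) : eps (eps a) = a := by
  ext1 p
  rw [eps_apply, eps_apply, smul_smul, ← mul_pow]
  simp

theorem eps_eq_self {a : ExtAlg T} (ha : ∀ p, p ≠ 0 → a p = 0) : eps a = a := by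
  ext1 p
  by_cases h : p = 0
  · subst h; simp [eps_apply]
  · rw [eps_apply, ha p h]
    exact smul_zero (M := ℂ) (A := T [⋀^Fin p]→L[ℝ] ℂ) _

/-- The pull back of inhomogeneous forms along a linear map. -/
def pull (f : T' →L[ℝ] T) : ExtAlg T →+* ExtAlg T' where
  toFun a := fun p => (a p).compContinuousLinearMap f
  map_zero' := by ext1 p; rfl
  map_add' a b := by ext1 p; rfl
  map_one' := by
    ext1 p
    by_cases h : 0 = p
    · subst h; simp only [one_apply_zero]; rfl
    · simp only [one_apply_of_ne h]; rfl
  map_mul' a b := by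
    ext1 p
    simp only [mul_apply]
    have h1 : ∀ (s : Finset (ℕ × ℕ)) (g : ℕ × ℕ → T [⋀^Fin p]→L[ℝ] ℂ),
        (∑ x ∈ s, g x).compContinuousLinearMap f = ∑ x ∈ s, (g x).compContinuousLinearMap f := by
      intro s g
      ext v
      simp
    rw [h1]
    refine Finset.sum_congr rfl ?_
    rintro ⟨i, j⟩ h
    obtain rfl := Finset.HasAntidiagonal.mem_antidiagonal.1 h
    rw [castForm_self, castForm_self]
    exact wedge_natural (a i) (b j) f (ContinuousLinearMap.id ℝ ℂ) (by simp)

theorem pull_apply (f : T' →L[ℝ] T) (a : ExtAlg T) (p : ℕ) :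
    pull f a p = (a p).compContinuousLinearMap f := rfl

theorem pull_eps (f : T' →L[ℝ] T) (a : ExtAlg T) : pull f (eps a) = eps (pull f a) := rfl

theorem pull_pull {T'' : Type*} [NormedAddCommGroup T''] [NormedSpace ℝ T''] (f : T' →L[ℝ] T)
    (g : T'' →L[ℝ] T') (a : ExtAlg T) : pull g (pull f a) = pull (f.comp g) a := rfl

@[simp] theorem pull_id (a : ExtAlg T) : pull (ContinuousLinearMap.id ℝ T) a = a := rfl

end ExtAlg

end ExtAlg

/-! ### The Leibniz rule for the exterior derivative -/

section Leibniz

variable {T : Type*} [NormedAddCommGroup T] [NormedSpace ℝ T]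

theorem IsBoundedBilinearMap.hasFDerivAt_comp {X G H K : Type*} [NormedAddCommGroup X]
    [NormedSpace ℝ X] [NormedAddCommGroup G] [NormedSpace ℝ G] [NormedAddCommGroup H]
    [NormedSpace ℝ H] [NormedAddCommGroup K] [NormedSpace ℝ K] {f : G × H → K}
    (hf : IsBoundedBilinearMap ℝ f) {a : X → G} {b : X → H} {a' : X →L[ℝ] G} {b' : X →L[ℝ] H}
    {x : X} (ha : HasFDerivAt a a' x) (hb : HasFDerivAt b b' x) :
    HasFDerivAt (fun x => f (a x, b x)) ((hf.deriv (a x, b x)).comp (a'.prod b')) x :=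
  (hf.hasFDerivAt (a x, b x)).comp x (ha.prodMk hb)

open ContinuousAlternatingMap in
set_option synthInstance.maxHeartbeats 200000 in
theorem alternatizeUncurryFin_sum {ι : Type*} (s : Finset ι) {p : ℕ}
    (f : ι → T →L[ℝ] T [⋀^Fin p]→L[ℝ] ℂ) :
    alternatizeUncurryFin (∑ i ∈ s, f i) = ∑ i ∈ s, alternatizeUncurryFin (f i) :=
  _root_.map_sum (alternatizeUncurryFinCLM ℝ T ℂ (n := p)) f s

open ContinuousAlternatingMap in
theorem alternatizeUncurryFin_zero {p : ℕ} :
    alternatizeUncurryFin (0 : T →L[ℝ] T [⋀^Fin p]→L[ℝ] ℂ) = 0 := by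
  simpa using alternatizeUncurryFin_sum (∅ : Finset ℕ) (fun _ => (0 : T →L[ℝ] T [⋀^Fin p]→L[ℝ] ℂ))

open ContinuousAlternatingMap in
theorem of_alternatizeUncurryFin_smulRight {k : ℕ} (ε : T →L[ℝ] ℝ) (α : T [⋀^Fin k]→L[ℝ] ℂ) :
    ExtAlg.of (k + 1) (alternatizeUncurryFin (ε.smulRight α)) =
      ExtAlg.of 1 (ofSubsingleton ℝ T ℂ (0 : Fin 1) (Complex.ofRealCLM.comp ε)) * ExtAlg.of k α := by
  rw [ExtAlg.of_mul_of]
  ext1 p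
  by_cases h : k + 1 = p
  · subst h
    rw [ExtAlg.of_apply_self]
    ext v
    rw [ExtAlg.of, castForm_apply (Nat.add_comm 1 k), wedge_one_left_apply,
      alternatizeUncurryFin_apply]
    refine Finset.sum_congr rfl fun i _ => ?_
    simp
  · rw [ExtAlg.of_apply_of_ne h, ExtAlg.of_apply_of_ne (by omega)]

open ContinuousAlternatingMap in
theorem of_one_mul_of {k : ℕ} (ε : T →L[ℝ] ℂ) (α : T [⋀^Fin k]→L[ℝ] ℂ) :
    ExtAlg.of 1 (ofSubsingleton ℝ T ℂ (0 : Fin 1) ε) * ExtAlg.of k α =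
      (-1) ^ k * (ExtAlg.of k α * ExtAlg.of 1 (ofSubsingleton ℝ T ℂ (0 : Fin 1) ε)) := by
  have h0 : ∀ a : ExtAlg T, (-1) ^ k * a = (-1 : ℤ) ^ k • a := by
    intro a
    simp [zsmul_eq_mul]
  rw [ExtAlg.of_mul_of, ExtAlg.of_mul_of, h0]
  ext1 p
  rw [Pi.smul_apply]
  by_cases h : k + 1 = p
  · subst h
    rw [ExtAlg.of_apply_self]
    ext v
    rw [ExtAlg.of, castForm_apply (Nat.add_comm 1 k), wedge_one_right_apply]
    rfl
  · rw [ExtAlg.of_apply_of_ne h, ExtAlg.of_apply_of_ne (by omega)]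
    exact (smul_zero (M := ℤ) (A := T [⋀^Fin p]→L[ℝ] ℂ) _).symm

variable [FiniteDimensional ℝ T]

/-- In finite dimension every linear map is a sum of rank one maps. -/
theorem exists_sum_smulRight {G : Type*} [NormedAddCommGroup G] [NormedSpace ℝ G] (A : T →L[ℝ] G) :
    ∃ (n : ℕ) (ε : Fin n → T →L[ℝ] ℝ) (g : Fin n → G), A = ∑ i, (ε i).smulRight (g i) := by
  let b := Module.finBasis ℝ T
  refine ⟨_, fun i => (b.coord i).toContinuousLinearMap, fun i => A (b i), ?_⟩
  ext v
  conv_lhs => rw [← b.sum_repr v, map_sum]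
  simp

open ContinuousAlternatingMap in
theorem of_alternatizeUncurryFin_wedge {k m : ℕ} (A : T →L[ℝ] T [⋀^Fin k]→L[ℝ] ℂ)
    (β : T [⋀^Fin m]→L[ℝ] ℂ) (C : T →L[ℝ] T [⋀^Fin (k + m)]→L[ℝ] ℂ)
    (hC : ∀ v, C v = wedge (A v) β) :
    ExtAlg.of (k + m + 1) (alternatizeUncurryFin C) =
      ExtAlg.of (k + 1) (alternatizeUncurryFin A) * ExtAlg.of m β := by
  obtain ⟨n, ε, g, rfl⟩ := exists_sum_smulRight A
  have hC' : C = ∑ i, (ε i).smulRight (wedge (g i) β) := by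
    ext1 v
    rw [hC]
    simp only [_root_.sum_apply, ContinuousLinearMap.smulRight_apply,
      ExtAlg.sum_wedge]
    refine Finset.sum_congr rfl fun i _ => ?_
    exact wedge_smul_left ((ε i v : ℝ) : ℂ) (g i) β
  have hsum : ∀ (j : ℕ) (f : Fin n → T →L[ℝ] T [⋀^Fin j]→L[ℝ] ℂ),
      ExtAlg.of (j + 1) (alternatizeUncurryFin (∑ i, f i)) =
        ∑ i, ExtAlg.of (j + 1) (alternatizeUncurryFin (f i)) := by
    intro j f
    rw [alternatizeUncurryFin_sum]
    ext1 p
    rw [ExtAlg.sum_apply]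
    exact _root_.map_sum (castForm (j + 1) p) _ _
  rw [hC', hsum, hsum, Finset.sum_mul]
  refine Finset.sum_congr rfl fun i _ => ?_
  rw [of_alternatizeUncurryFin_smulRight, of_alternatizeUncurryFin_smulRight, mul_assoc,
    ExtAlg.of_mul_of (g i)]

open ContinuousAlternatingMap in
theorem of_alternatizeUncurryFin_wedge' {k m : ℕ} (α : T [⋀^Fin k]→L[ℝ] ℂ)
    (A : T →L[ℝ] T [⋀^Fin m]→L[ℝ] ℂ) (C : T →L[ℝ] T [⋀^Fin (k + m)]→L[ℝ] ℂ)
    (hC : ∀ v, C v = wedge α (A v)) :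
    ExtAlg.of (k + m + 1) (alternatizeUncurryFin C) =
      (-1) ^ k * (ExtAlg.of k α * ExtAlg.of (m + 1) (alternatizeUncurryFin A)) := by
  obtain ⟨n, ε, g, rfl⟩ := exists_sum_smulRight A
  have hC' : C = ∑ i, (ε i).smulRight (wedge α (g i)) := by
    ext1 v
    rw [hC]
    simp only [_root_.sum_apply, ContinuousLinearMap.smulRight_apply,
      ExtAlg.wedge_sum]
    refine Finset.sum_congr rfl fun i _ => ?_
    exact wedge_smul_right ((ε i v : ℝ) : ℂ) α (g i)
  have hsum : ∀ (j : ℕ) (f : Fin n → T →L[ℝ] T [⋀^Fin j]→L[ℝ] ℂ),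
      ExtAlg.of (j + 1) (alternatizeUncurryFin (∑ i, f i)) =
        ∑ i, ExtAlg.of (j + 1) (alternatizeUncurryFin (f i)) := by
    intro j f
    rw [alternatizeUncurryFin_sum]
    ext1 p
    rw [ExtAlg.sum_apply]
    exact _root_.map_sum (castForm (j + 1) p) _ _
  rw [hC', hsum, hsum, Finset.mul_sum, Finset.mul_sum]
  refine Finset.sum_congr rfl fun i _ => ?_
  rw [of_alternatizeUncurryFin_smulRight, of_alternatizeUncurryFin_smulRight,
    ← ExtAlg.of_mul_of α, ← mul_assoc, of_one_mul_of]
  simp only [mul_assoc]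

/-- The exterior derivative of a scalar product of forms. -/
theorem of_extDeriv_wedge {k m : ℕ} {a : T → T [⋀^Fin k]→L[ℝ] ℂ} {b : T → T [⋀^Fin m]→L[ℝ] ℂ}
    {w : T} (ha : DifferentiableAt ℝ a w) (hb : DifferentiableAt ℝ b w) :
    ExtAlg.of (k + m + 1) (extDeriv (fun w => wedge (a w) (b w)) w) =
      ExtAlg.of (k + 1) (extDeriv a w) * ExtAlg.of m (b w) +
        (-1) ^ k * (ExtAlg.of k (a w) * ExtAlg.of (m + 1) (extDeriv b w)) := by
  have hB := isBoundedBilinearMap_wedge (T := T) (N := ℂ) k m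
  have h1 := IsBoundedBilinearMap.hasFDerivAt_comp hB ha.hasFDerivAt hb.hasFDerivAt
  let C₁ : T →L[ℝ] T [⋀^Fin (k + m)]→L[ℝ] ℂ :=
    (hB.deriv (a w, b w)).comp ((fderiv ℝ a w).prod 0)
  let C₂ : T →L[ℝ] T [⋀^Fin (k + m)]→L[ℝ] ℂ :=
    (hB.deriv (a w, b w)).comp ((0 : T →L[ℝ] _).prod (fderiv ℝ b w))
  have hC₁ : ∀ v, C₁ v = wedge (fderiv ℝ a w v) (b w) := by
    intro v
    simp [C₁, ExtAlg.wedge_zero']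
  have hC₂ : ∀ v, C₂ v = wedge (a w) (fderiv ℝ b w v) := by
    intro v
    simp [C₂, ExtAlg.zero_wedge']
  have hsum : fderiv ℝ (fun w => wedge (a w) (b w)) w = C₁ + C₂ := by
    refine h1.fderiv.trans ?_
    ext1 v
    rw [_root_.add_apply, hC₁, hC₂]
    exact add_comm _ _
  rw [extDeriv, hsum, ContinuousAlternatingMap.alternatizeUncurryFin_add, extDeriv, extDeriv,
    ← of_alternatizeUncurryFin_wedge _ _ C₁ hC₁, ← of_alternatizeUncurryFin_wedge' _ _ C₂ hC₂]
  ext1 p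
  exact map_add (castForm (k + m + 1) p) _ _

namespace ExtAlg

omit [FiniteDimensional ℝ T] in
/-- A family of inhomogeneous forms that is differentiable in every degree. -/
def Diff (a : T → ExtAlg T) (w : T) : Prop := ∀ p, DifferentiableAt ℝ (fun w => a w p) w

/-- The exterior derivative of inhomogeneous forms. -/
def extD (a : T → ExtAlg T) (w : T) : ExtAlg T
  | 0 => 0
  | p + 1 => extDeriv (fun w => a w p) w

omit [FiniteDimensional ℝ T] in
theorem extD_eps (a : T → ExtAlg T) (w : T) : extD (fun w => eps (a w)) w = -eps (extD a w) := by
  ext1 p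
  rw [Pi.neg_apply, eps_apply]
  cases p with
  | zero => simp [extD]
  | succ p =>
    have : extDeriv (fun w => ((-1 : ℂ) ^ p) • a w p) w = (-1 : ℂ) ^ p • extDeriv (fun w => a w p) w := by
      rcases neg_one_pow_eq_or ℂ p with h | h
      · simp [h]
      · have := extDeriv_fun_smul (x := w) (-1 : ℝ) (fun w => a w p)
        have e : (fun w => (-1 : ℂ) • a w p) = fun w => (-1 : ℝ) • a w p := by
          funext w
          ext v
          simp
        rw [h, e]
        refine this.trans ?_
        ext v
        simp
    change extDeriv (fun w => ((-1 : ℂ) ^ p) • a w p) w = -((-1 : ℂ) ^ (p + 1) • extDeriv (fun w => a w p) w)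
    rw [this, pow_succ]
    simp

omit [FiniteDimensional ℝ T] in
theorem neg_one_pow_mul (k : ℕ) (a : ExtAlg T) : (-1) ^ k * a = (-1 : ℂ) ^ k • a := by
  rcases Nat.even_or_odd k with h | h <;> simp [h.neg_one_pow]

omit [FiniteDimensional ℝ T] in
theorem extDeriv_castForm {m p : ℕ} (h : m = p) (a : T → T [⋀^Fin m]→L[ℝ] ℂ) (w : T) :
    extDeriv (fun w => castForm m p (a w)) w = castForm (m + 1) (p + 1) (extDeriv a w) := by
  subst h
  simp

omit [FiniteDimensional ℝ T] in
theorem extDeriv_sum {ι : Type*} (s : Finset ι) {p : ℕ} {f : ι → T → T [⋀^Fin p]→L[ℝ] ℂ} {w : T}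
    (h : ∀ i ∈ s, DifferentiableAt ℝ (f i) w) :
    extDeriv (fun w => ∑ i ∈ s, f i w) w = ∑ i ∈ s, extDeriv (f i) w := by
  rw [extDeriv, fderiv_fun_sum h, alternatizeUncurryFin_sum]
  rfl

omit [FiniteDimensional ℝ T] in
theorem Diff.mul_summand {a b : T → ExtAlg T} {w : T} (ha : Diff a w) (hb : Diff b w) (k m p : ℕ) :
    DifferentiableAt ℝ (fun w => castForm (k + m) p (wedge (a w k) (b w m))) w := by
  have h := IsBoundedBilinearMap.hasFDerivAt_comp (isBoundedBilinearMap_wedge (T := T) (N := ℂ) k m)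
    (ha k).hasFDerivAt (hb m).hasFDerivAt
  exact ((castForm (T := T) (N := ℂ) (k + m) p).hasFDerivAt.comp w h).differentiableAt

/-- The Leibniz rule for the exterior derivative. -/
theorem extD_mul {a b : T → ExtAlg T} {w : T} (ha : Diff a w) (hb : Diff b w) :
    extD (fun w => a w * b w) w = extD a w * b w + eps (a w) * extD b w := by
  ext1 p
  cases p with
  | zero =>
    rw [Pi.add_apply, mul_apply, mul_apply]
    simp [extD, wedge_zero', zero_wedge']
  | succ p =>
    change extDeriv (fun w => (a w * b w) p) w = _
    simp only [mul_apply]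
    rw [extDeriv_sum _ fun x _ => ha.mul_summand hb x.1 x.2 p, Pi.add_apply, mul_apply, mul_apply,
      Finset.Nat.sum_antidiagonal_succ, Finset.Nat.sum_antidiagonal_succ']
    simp only [extD, wedge_zero', zero_wedge', map_zero, zero_add,
      ← Finset.sum_add_distrib]
    refine Finset.sum_congr rfl ?_
    rintro ⟨k, m⟩ h
    have hkm : k + m = p := Finset.HasAntidiagonal.mem_antidiagonal.1 h
    have := congrFun (of_extDeriv_wedge (ha k) (hb m)) (p + 1)
    rw [neg_one_pow_mul, of_mul_of, of_mul_of] at this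
    simp only [extDeriv_castForm hkm, eps_apply, wedge_smul_left]
    refine this.trans ?_
    simp only [Pi.add_apply, Pi.smul_apply, of]
    congr 1
    rcases neg_one_pow_eq_or ℂ k with h | h
    · simp [h]
    · rw [h]
      ext v
      have h1 : k + (m + 1) = p + 1 := by omega
      rw [castForm_apply h1, ContinuousAlternatingMap.smul_apply,
        ContinuousAlternatingMap.smul_apply, castForm_apply h1]

omit [FiniteDimensional ℝ T] in
theorem extD_extD {a : T → ExtAlg T} {w : T}
    (ha : ∀ p, ContDiffAt ℝ ∞ (fun w => a w p) w) : extD (extD a) w = 0 := by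
  ext1 p
  match p with
  | 0 => rfl
  | 1 =>
    change extDeriv (fun _ => (0 : T [⋀^Fin 0]→L[ℝ] ℂ)) w = 0
    rw [extDeriv, fderiv_fun_const]
    exact alternatizeUncurryFin_zero
  | p + 2 =>
    have h : minSmoothness ℝ 2 ≤ ∞ := by
      simp only [minSmoothness_of_isRCLikeNormedField]
      exact WithTop.coe_le_coe.2 le_top
    exact extDeriv_extDeriv_apply (r := ∞) (ha p) h

end ExtAlg

end Leibniz

/-! ### Linear differential equations with smooth parameters -/

section ODE

universe u v

/-- The Banach space of continuous paths in `G` parametrised by `[0, 1]`. -/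
abbrev PathSpace (G : Type*) [NormedAddCommGroup G] : Type _ :=
  BoundedContinuousFunction unitInterval G

/-- A continuous function on `[0, 1]`, as an element of `PathSpace`. -/
def mkPath {G : Type*} [NormedAddCommGroup G] (f : unitInterval → G) (hf : Continuous f) :
    PathSpace G :=
  BoundedContinuousFunction.mkOfCompact ⟨f, hf⟩

@[simp] theorem mkPath_apply {G : Type*} [NormedAddCommGroup G] (f : unitInterval → G)
    (hf : Continuous f) (s : unitInterval) : mkPath f hf s = f s := rfl

/-- Pointwise application `(A, f) ↦ (s ↦ A s (f s))` on spaces of continuous paths. -/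
def applyL (G H : Type*) [NormedAddCommGroup G] [NormedSpace ℝ G] [NormedAddCommGroup H]
    [NormedSpace ℝ H] :
    PathSpace (G →L[ℝ] H) →L[ℝ] PathSpace G →L[ℝ] PathSpace H :=
  LinearMap.mkContinuous₂
    (LinearMap.mk₂ ℝ (fun (A : PathSpace (G →L[ℝ] H)) (f : PathSpace G) =>
      mkPath (fun s => A s (f s)) (by fun_prop))
      (fun A B f => by ext s; simp) (fun c A f => by ext s; simp)
      (fun A f g => by ext s; simp) (fun c A f => by ext s; simp)) 1 fun A f => by
    rw [one_mul, BoundedContinuousFunction.norm_le (by positivity)]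
    exact fun s => ((A s).le_opNorm _).trans
      (mul_le_mul (A.norm_coe_le_norm s) (f.norm_coe_le_norm s) (norm_nonneg _) (norm_nonneg _))

@[simp] theorem applyL_apply {G H : Type*} [NormedAddCommGroup G] [NormedSpace ℝ G]
    [NormedAddCommGroup H] [NormedSpace ℝ H] (A : PathSpace (G →L[ℝ] H))
    (f : PathSpace G) (s : unitInterval) : applyL G H A f s = A s (f s) := rfl

/-- Constant paths. -/
def constPath (G : Type*) [NormedAddCommGroup G] [NormedSpace ℝ G] :
    G →L[ℝ] PathSpace G :=
  LinearMap.mkContinuous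
    { toFun := fun g => BoundedContinuousFunction.const _ g
      map_add' := fun _ _ => rfl
      map_smul' := fun _ _ => rfl } 1 fun g => by
    rw [one_mul, BoundedContinuousFunction.norm_le (by positivity)]
    exact fun s => le_rfl

@[simp] theorem constPath_apply {G : Type*} [NormedAddCommGroup G] [NormedSpace ℝ G] (g : G)
    (s : unitInterval) : constPath G g s = g := rfl

theorem continuousOn_curry {Y G : Type*} [TopologicalSpace Y] [NormedAddCommGroup G]
    {f : Y × ℝ → G} {Q : Set Y} (hf : ContinuousOn f (Q ×ˢ Set.univ)) {P : Y → PathSpace G}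
    (hP : ∀ p ∈ Q, ∀ s, P p s = f (p, s)) : ContinuousOn P Q := by
  rw [continuousOn_iff_continuous_domRestrict]
  have hc : Continuous fun x : Q × unitInterval => f ((x.1 : Y), (x.2 : ℝ)) :=
    hf.comp_continuous (by fun_prop) fun x => Set.mk_mem_prod x.1.2 (Set.mem_univ _)
  let g : C(Q × unitInterval, G) := ⟨_, hc⟩
  have h : Q.domRestrict P = fun x => ContinuousMap.isometryEquivBoundedOfCompact _ _ (g.curry x) := by
    funext x
    ext s
    exact hP x x.2 s
  rw [h]
  exact (ContinuousMap.isometryEquivBoundedOfCompact unitInterval G).continuous.comp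
    g.curry.continuous

/-- A smooth function of `(p, s)`, seen as a function of `p` with values in a space of paths, is
smooth. -/
theorem contDiffOn_curry {Y : Type u} [NormedAddCommGroup Y] [NormedSpace ℝ Y] {Q : Set Y}
    (hQ : IsOpen Q) (n : ℕ) : ∀ {G : Type (max u v)} [NormedAddCommGroup G] [NormedSpace ℝ G]
    {f : Y × ℝ → G} (_ : ContDiffOn ℝ ∞ f (Q ×ˢ Set.univ)) {P : Y → PathSpace G}
    (_ : ∀ p ∈ Q, ∀ s, P p s = f (p, s)), ContDiffOn ℝ n P Q := by
  induction n with
  | zero =>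
    intro G _ _ f hf P hP
    exact contDiffOn_zero.2 (continuousOn_curry hf.continuousOn hP)
  | succ n ih =>
    intro G _ _ f hf P hP
    have hQ' : IsOpen (Q ×ˢ (Set.univ : Set ℝ)) := hQ.prod isOpen_univ
    let f₁ : Y × ℝ → Y →L[ℝ] G := fun q => (fderiv ℝ f q).comp (ContinuousLinearMap.inl ℝ Y ℝ)
    have hf₁ : ContDiffOn ℝ ∞ f₁ (Q ×ˢ Set.univ) :=
      (hf.fderiv_of_isOpen hQ' (m := ∞) (by simp)).clm_comp contDiffOn_const
    have hcont : ∀ p ∈ Q, Continuous fun s : unitInterval => f₁ (p, s) := fun p hp =>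
      hf₁.continuousOn.comp_continuous (by fun_prop) fun x => ⟨hp, trivial⟩
    classical
    let P₁ : Y → PathSpace (Y →L[ℝ] G) := fun p =>
      if hp : p ∈ Q then mkPath (fun s => f₁ (p, s)) (hcont p hp) else 0
    have hP₁ : ∀ p ∈ Q, ∀ s, P₁ p s = f₁ (p, s) := by
      intro p hp s
      simp [P₁, hp]
    let Λ : PathSpace (Y →L[ℝ] G) →L[ℝ] Y →L[ℝ] PathSpace G :=
      ((ContinuousLinearMap.compL ℝ Y (PathSpace Y) (PathSpace G)).flip
        (constPath Y)).comp (applyL Y G)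
    have hder : ∀ p ∈ Q, HasFDerivAt P (Λ (P₁ p)) p := by
      intro p hp
      rw [hasFDerivAt_iff_isLittleO, Asymptotics.isLittleO_iff]
      intro ε hε
      have h1 : ∀ᶠ p' in nhds p, dist (P₁ p') (P₁ p) < ε :=
        ((continuousOn_curry hf₁.continuousOn hP₁).continuousAt (hQ.mem_nhds hp)).eventually
          (Metric.ball_mem_nhds _ hε)
      obtain ⟨r, hr, hball⟩ := Metric.eventually_nhds_iff_ball.1 (h1.and (hQ.mem_nhds hp))
      filter_upwards [Metric.ball_mem_nhds p hr] with p' hp'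
      rw [BoundedContinuousFunction.norm_le (by positivity)]
      intro s
      have h2 : ∀ z ∈ Metric.ball p r, HasFDerivWithinAt (fun z => f (z, (s : ℝ))) (f₁ (z, s))
          (Metric.ball p r) z := by
        intro z hz
        have h3 : HasFDerivAt f (fderiv ℝ f (z, (s : ℝ))) (z, (s : ℝ)) :=
          ((hf.contDiffAt (hQ'.mem_nhds (Set.mk_mem_prod (hball z hz).2 (Set.mem_univ _)))).differentiableAt
            (by simp)).hasFDerivAt
        exact (h3.comp z (hasFDerivAt_prodMk_left z (s : ℝ))).hasFDerivWithinAt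
      have h4 := (convex_ball p r).norm_image_sub_le_of_norm_hasFDerivWithin_le'
        (φ := f₁ (p, s)) (C := ε) h2 (fun z hz => by
          have h5 := (BoundedContinuousFunction.dist_coe_le_dist s).trans (hball z hz).1.le
          rwa [hP₁ z (hball z hz).2, hP₁ p hp, dist_eq_norm] at h5)
        (Metric.mem_ball_self hr) hp'
      simpa [Λ, hP₁ p hp, hP p hp, hP p' (hball p' hp').2] using h4
    rw [show ((n + 1 : ℕ) : WithTop ℕ∞) = (n : WithTop ℕ∞) + 1 by norm_cast,
      contDiffOn_succ_iff_hasFDerivWithinAt_of_uniqueDiffOn hQ.uniqueDiffOn]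
    refine ⟨by simp, fun p => Λ (P₁ p), ?_, fun p hp => (hder p hp).hasFDerivWithinAt⟩
    exact Λ.contDiff.comp_contDiffOn (ih hf₁ hP₁)

variable {G : Type*} [NormedAddCommGroup G] [NormedSpace ℝ G] [CompleteSpace G]

/-- Integration of paths, `(J f)(s) = ∫₀ˢ f`. -/
def integralL (G : Type*) [NormedAddCommGroup G] [NormedSpace ℝ G] [CompleteSpace G] :
    PathSpace G →L[ℝ] PathSpace G :=
  LinearMap.mkContinuous
    { toFun := fun f => mkPath (fun s => ∫ r in (0 : ℝ)..s, f (Set.projIcc 0 1 zero_le_one r)) (by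
        have h : Continuous fun r => f (Set.projIcc 0 1 zero_le_one r) := by fun_prop
        exact (intervalIntegral.continuous_primitive (fun a b => h.intervalIntegrable a b) 0).comp
          continuous_subtype_val)
      map_add' := fun f g => by
        ext s
        have h : ∀ f : PathSpace G,
            Continuous fun r => f (Set.projIcc 0 1 zero_le_one r) := fun f => by fun_prop
        exact intervalIntegral.integral_add ((h f).intervalIntegrable _ _)
          ((h g).intervalIntegrable _ _)
      map_smul' := fun c f => by
        ext s
        exact intervalIntegral.integral_smul _ _ } 1 fun f => by
    rw [one_mul, BoundedContinuousFunction.norm_le (by positivity)]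
    intro s
    refine (intervalIntegral.norm_integral_le_of_norm_le_const
      (fun r _ => f.norm_coe_le_norm _)).trans ?_
    rw [sub_zero, abs_of_nonneg s.2.1]
    exact mul_le_of_le_one_right (norm_nonneg _) s.2.2

/-- The Volterra operator `f ↦ ∫ A f`. -/
def volterra (A : PathSpace (G →L[ℝ] G)) : PathSpace G →L[ℝ] PathSpace G :=
  (integralL G).comp (applyL G G A)

theorem norm_volterra_pow_apply_le (A : PathSpace (G →L[ℝ] G)) (n : ℕ)
    (f : PathSpace G) (s : unitInterval) :
    ‖(volterra A ^ n) f s‖ ≤ (‖A‖ * s) ^ n / n.factorial * ‖f‖ := by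
  induction n generalizing s with
  | zero => simpa using f.norm_coe_le_norm s
  | succ n ih =>
    rw [pow_succ', mul_apply_eq_comp]
    change ‖∫ r in (0 : ℝ)..s, A (Set.projIcc 0 1 zero_le_one r)
      ((volterra A ^ n) f (Set.projIcc 0 1 zero_le_one r))‖ ≤ _
    have h1 : ∀ r ∈ Set.Ioc (0 : ℝ) s, ‖A (Set.projIcc 0 1 zero_le_one r)
        ((volterra A ^ n) f (Set.projIcc 0 1 zero_le_one r))‖ ≤
        ‖A‖ * ((‖A‖ * r) ^ n / n.factorial * ‖f‖) := by
      intro r hr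
      have hr' : r ∈ Set.Icc (0 : ℝ) 1 := ⟨hr.1.le, hr.2.trans s.2.2⟩
      rw [Set.projIcc_of_mem _ hr']
      exact (ContinuousLinearMap.le_opNorm _ _).trans
        (mul_le_mul (A.norm_coe_le_norm _) (ih ⟨r, hr'⟩) (norm_nonneg _) (norm_nonneg _))
    refine (intervalIntegral.norm_integral_le_of_norm_le s.2.1
      (Filter.Eventually.of_forall h1) (Continuous.intervalIntegrable (by fun_prop) _ _)).trans ?_
    have h2 : ∀ r : ℝ, ‖A‖ * ((‖A‖ * r) ^ n / n.factorial * ‖f‖) =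
        ‖A‖ ^ (n + 1) / n.factorial * ‖f‖ * r ^ n := by
      intro r
      rw [mul_pow, pow_succ]
      ring
    simp only [h2]
    rw [intervalIntegral.integral_const_mul, integral_pow, Nat.factorial_succ, mul_pow]
    refine le_of_eq ?_
    have : (n.factorial : ℝ) ≠ 0 := by positivity
    have : (n + 1 : ℝ) ≠ 0 := by positivity
    push_cast
    field_simp
    simp

theorem isUnit_one_sub_volterra (A : PathSpace (G →L[ℝ] G)) : IsUnit (1 - volterra A) := by
  have hs : Summable fun n : ℕ => volterra A ^ n := by
    refine Summable.of_norm_bounded (Real.summable_pow_div_factorial ‖A‖) fun n => ?_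
    refine ContinuousLinearMap.opNorm_le_bound _ (by positivity) fun f => ?_
    rw [BoundedContinuousFunction.norm_le (by positivity)]
    intro s
    refine (norm_volterra_pow_apply_le A n f s).trans ?_
    have h0 : 0 ≤ ‖A‖ * s := mul_nonneg (norm_nonneg A) s.2.1
    have h1 : ‖A‖ * s ≤ ‖A‖ := mul_le_of_le_one_right (norm_nonneg A) s.2.2
    gcongr
  exact ⟨⟨1 - volterra A, ∑' n, volterra A ^ n, hs.one_sub_mul_tsum_pow, hs.tsum_pow_mul_one_sub⟩,
    rfl⟩

/-- The solution operator of the integral equation `f = h + ∫ A f`. -/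
def volterraSolve (A : PathSpace (G →L[ℝ] G)) (h : PathSpace G) : PathSpace G :=
  Ring.inverse (1 - volterra A) h

theorem eq_volterraSolve_iff (A : PathSpace (G →L[ℝ] G)) (f h : PathSpace G) :
    f = volterraSolve A h ↔ f = h + volterra A f := by
  have h1 := isUnit_one_sub_volterra A
  have h2 : f = h + volterra A f ↔ (1 - volterra A) f = h := by
    rw [_root_.sub_apply, one_apply_eq_self, sub_eq_iff_eq_add]
  rw [h2]
  constructor
  · rintro rfl
    rw [volterraSolve, ← mul_apply_eq_comp, Ring.mul_inverse_cancel _ h1]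
    rfl
  · rintro rfl
    rw [volterraSolve, ← mul_apply_eq_comp, Ring.inverse_mul_cancel _ h1]
    rfl

theorem contDiffAt_volterraSolve {Y : Type*} [NormedAddCommGroup Y] [NormedSpace ℝ Y]
    {A : Y → PathSpace (G →L[ℝ] G)} {h : Y → PathSpace G} {p : Y} {n : WithTop ℕ∞}
    (hA : ContDiffAt ℝ n A p) (hh : ContDiffAt ℝ n h p) :
    ContDiffAt ℝ n (fun p => volterraSolve (A p) (h p)) p := by
  obtain ⟨u, hu⟩ := isUnit_one_sub_volterra (A p)
  have h1 : ContDiffAt ℝ n (fun p => 1 - volterra (A p)) p :=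
    contDiffAt_const.sub (contDiffAt_const.clm_comp
      ((applyL G G).contDiff.contDiffAt.comp p hA))
  have h2 : ContDiffAt ℝ n (Ring.inverse : (PathSpace G →L[ℝ] PathSpace G) → _)
      (1 - volterra (A p)) := hu ▸ contDiffAt_ringInverse ℝ u
  exact (h2.comp p h1).clm_apply hh

theorem eq_volterraSolve_iff_integral (A : PathSpace (G →L[ℝ] G)) (f b : PathSpace G) (g : G) :
    f = volterraSolve A (constPath G g + integralL G b) ↔
      ∀ s : unitInterval, f s = g + ∫ r in (0 : ℝ)..s, (b (Set.projIcc 0 1 zero_le_one r) +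
        A (Set.projIcc 0 1 zero_le_one r) (f (Set.projIcc 0 1 zero_le_one r))) := by
  have hb : Continuous fun r => b (Set.projIcc 0 1 zero_le_one r) := by fun_prop
  have hA : Continuous fun r =>
    A (Set.projIcc 0 1 zero_le_one r) (f (Set.projIcc 0 1 zero_le_one r)) := by fun_prop
  rw [eq_volterraSolve_iff, DFunLike.ext_iff]
  refine forall_congr' fun s => ?_
  rw [intervalIntegral.integral_add (hb.intervalIntegrable _ _) (hA.intervalIntegrable _ _),
    ← add_assoc]
  rfl

theorem exists_curry {Y : Type u} [NormedAddCommGroup Y] [NormedSpace ℝ Y] {Q : Set Y}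
    (hQ : IsOpen Q) {G : Type (max u v)} [NormedAddCommGroup G] [NormedSpace ℝ G]
    {f : Y × ℝ → G} (hf : ContDiffOn ℝ ∞ f (Q ×ˢ Set.univ)) :
    ∃ P : Y → PathSpace G, ContDiffOn ℝ ∞ P Q ∧ ∀ p ∈ Q, ∀ s, P p s = f (p, s) := by
  classical
  have hcont : ∀ p ∈ Q, Continuous fun s : unitInterval => f (p, s) := fun p hp =>
    hf.continuousOn.comp_continuous (by fun_prop) fun x => ⟨hp, trivial⟩
  have h : ∀ p ∈ Q, ∀ s, (fun p => if hp : p ∈ Q then mkPath (fun s => f (p, s)) (hcont p hp)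
      else 0) p s = f (p, s) := by
    intro p hp s
    simp [hp]
  exact ⟨_, contDiffOn_infty.2 fun n => contDiffOn_curry.{u, v} hQ n hf h, h⟩

/-- A linear differential equation whose coefficients and initial value depend smoothly on a
parameter has a solution on the whole line that depends smoothly on time and the parameter.

The solution at time `t` is the value at time `1` of the solution of the equation obtained by
rescaling time; this turns `t` into one of the parameters, so that only the smooth dependence of a
path on parameters is needed. -/
theorem exists_solution_linearODE {X : Type u} [NormedAddCommGroup X] [NormedSpace ℝ X] {O : Set X}
    (hO : IsOpen O) {G : Type (max u v)} [NormedAddCommGroup G] [NormedSpace ℝ G] [CompleteSpace G]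
    {A : X × ℝ → G →L[ℝ] G} (hA : ContDiffOn ℝ ∞ A (O ×ˢ Set.univ)) {b : X × ℝ → G}
    (hb : ContDiffOn ℝ ∞ b (O ×ˢ Set.univ)) {g : X → G} (hg : ContDiffOn ℝ ∞ g O) (t₀ : ℝ) :
    ∃ a : X × ℝ → G, ContDiffOn ℝ ∞ a (O ×ˢ Set.univ) ∧ ∀ x ∈ O, a (x, t₀) = g x ∧
      ∀ t, HasDerivAt (fun t => a (x, t)) (A (x, t) (a (x, t)) + b (x, t)) t := by
  have hQ : IsOpen (O ×ˢ (Set.univ : Set ℝ)) := hO.prod isOpen_univ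
  set Q := O ×ˢ (Set.univ : Set ℝ) with hQdef
  let θ : (X × ℝ) × ℝ → X × ℝ := fun q => (q.1.1, t₀ + (q.1.2 - t₀) * q.2)
  have hθ : ContDiff ℝ ∞ θ := by fun_prop
  have hθQ : Set.MapsTo θ (Q ×ˢ Set.univ) Q := fun q hq => ⟨hq.1.1, trivial⟩
  have hscale : ContDiff ℝ ∞ fun q : (X × ℝ) × ℝ => q.1.2 - t₀ := by fun_prop
  obtain ⟨PA, hPA, hPA'⟩ := exists_curry.{u, v} hQ
    (hscale.contDiffOn.smul (hA.comp hθ.contDiffOn hθQ))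
  obtain ⟨Pb, hPb, hPb'⟩ := exists_curry.{u, v} hQ
    (hscale.contDiffOn.smul (hb.comp hθ.contDiffOn hθQ))
  let u : X × ℝ → PathSpace G := fun p =>
    volterraSolve (PA p) (constPath G (g p.1) + integralL G (Pb p))
  have hg' : ContDiffOn ℝ ∞ (fun p : X × ℝ => g p.1) Q :=
    hg.comp contDiffOn_fst fun p hp => hp.1
  have hu : ContDiffOn ℝ ∞ u Q := by
    intro p hp
    have h1 := (constPath G).contDiff.comp_contDiffAt p (hg'.contDiffAt (hQ.mem_nhds hp))
    have h2 := (integralL G).contDiff.comp_contDiffAt p (hPb.contDiffAt (hQ.mem_nhds hp))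
    exact (contDiffAt_volterraSolve (hPA.contDiffAt (hQ.mem_nhds hp))
      (h1.add h2)).contDiffWithinAt
  have hsol : ∀ p ∈ Q, ∀ v : PathSpace G, v = u p ↔ ∀ s : unitInterval, v s = g p.1 +
      ∫ r in (0 : ℝ)..s, (p.2 - t₀) • (b (p.1, t₀ + (p.2 - t₀) * r) +
        A (p.1, t₀ + (p.2 - t₀) * r) (v (Set.projIcc 0 1 zero_le_one r))) := by
    intro p hp v
    refine (eq_volterraSolve_iff_integral _ _ _ _).trans (forall_congr' fun s => ?_)
    refine Eq.congr_right (congrArg (g p.1 + ·) (intervalIntegral.integral_congr fun r hr => ?_))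
    rw [Set.uIcc_of_le s.2.1] at hr
    have hr' : r ∈ Set.Icc (0 : ℝ) 1 := ⟨hr.1, hr.2.trans s.2.2⟩
    simp only [Set.projIcc_of_mem _ hr', hPA' p hp, hPb' p hp, smul_add]
    rfl
  have hrescale : ∀ x ∈ O, ∀ t, ∀ s : unitInterval,
      u (x, t₀ + (t - t₀) * s) 1 = u (x, t) s := by
    intro x hx t s
    have h1 : mkPath (fun r => u (x, t) (s * r)) (by fun_prop) = u (x, t₀ + (t - t₀) * s) := by
      rw [hsol _ ⟨hx, trivial⟩]
      intro r
      rw [mkPath_apply, (hsol (x, t) ⟨hx, trivial⟩ _).1 rfl]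
      have h2 := intervalIntegral.smul_integral_comp_mul_left (a := 0) (b := r)
        (fun r => (t - t₀) • (b (x, t₀ + (t - t₀) * r) +
          A (x, t₀ + (t - t₀) * r) (u (x, t) (Set.projIcc 0 1 zero_le_one r)))) (s : ℝ)
      rw [mul_zero] at h2
      rw [Set.Icc.coe_mul, ← h2, ← intervalIntegral.integral_smul]
      refine congrArg (g x + ·) (intervalIntegral.integral_congr fun ρ hρ => ?_)
      rw [Set.uIcc_of_le r.2.1] at hρ
      have hρ' : ρ ∈ Set.Icc (0 : ℝ) 1 := ⟨hρ.1, hρ.2.trans r.2.2⟩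
      have hρs : (s : ℝ) * ρ ∈ Set.Icc (0 : ℝ) 1 :=
        ⟨mul_nonneg s.2.1 hρ'.1, mul_le_one₀ s.2.2 hρ'.1 hρ'.2⟩
      have h3 : Set.projIcc (0 : ℝ) 1 zero_le_one (s * ρ) = s * ⟨ρ, hρ'⟩ :=
        Set.projIcc_of_mem _ hρs
      simp only [Set.projIcc_of_mem _ hρ', h3, mkPath_apply, smul_smul, add_sub_cancel_left]
      rw [mul_assoc, mul_comm (s : ℝ)]
    rw [← h1]
    simp
  have ha : ContDiffOn ℝ ∞ (fun p => u p 1) Q :=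
    (BoundedContinuousFunction.evalCLM (β := G) ℝ
      (1 : unitInterval)).contDiff.comp_contDiffOn hu
  refine ⟨fun p => u p 1, ha, fun x hx => ?_⟩
  let f : ℝ → G := fun t => b (x, t) + A (x, t) (u (x, t) 1)
  have hline : ∀ t : ℝ, (x, t) ∈ Q := fun t => ⟨hx, trivial⟩
  have hf : Continuous f :=
    (hb.continuousOn.comp_continuous (by fun_prop) hline).add
      ((hA.continuousOn.comp_continuous (by fun_prop) hline).clm_apply
        (ha.continuousOn.comp_continuous (by fun_prop) hline))
  have hint : ∀ t, u (x, t) 1 = g x + ∫ r in t₀..t, f r := by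
    intro t
    rw [(hsol (x, t) ⟨hx, trivial⟩ _).1 rfl]
    have h2 := intervalIntegral.smul_integral_comp_add_mul (a := 0) (b := 1) f (t - t₀) t₀
    rw [mul_zero, add_zero, mul_one, add_sub_cancel] at h2
    rw [← h2, ← intervalIntegral.integral_smul]
    refine congrArg (g x + ·) (intervalIntegral.integral_congr fun r hr => ?_)
    have hr' : r ∈ Set.Icc (0 : ℝ) 1 := by
      simpa [Set.uIcc_of_le (zero_le_one' ℝ)] using hr
    simp only [f, Set.projIcc_of_mem _ hr']
    rw [← hrescale x hx t ⟨r, hr'⟩]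
  refine ⟨by simp [hint], fun t => ?_⟩
  simp only [hint]
  have h3 := (hf.integral_hasStrictDerivAt t₀ t).hasDerivAt.const_add (g x)
  rwa [show f t = A (x, t) (g x + ∫ r in t₀..t, f r) + b (x, t) by
    rw [← hint, add_comm]] at h3

omit [CompleteSpace G] in
/-- Solutions of linear differential equations are determined by one value. -/
theorem linearODE_unique {L : ℝ → G →L[ℝ] G} (hL : Continuous L) {b f g : ℝ → G}
    (hf : ∀ t, HasDerivAt f (L t (f t) + b t) t) (hg : ∀ t, HasDerivAt g (L t (g t) + b t) t)
    {t₀ : ℝ} (h : f t₀ = g t₀) : f = g := by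
  ext t
  set R := max |t| |t₀| + 1
  obtain ⟨K, hK⟩ := (isCompact_Icc (a := -R) (b := R)).exists_bound_of_continuousOn hL.continuousOn
  have hmem : ∀ r : ℝ, |r| < R → r ∈ Set.Ioo (-R) R := fun r hr => abs_lt.1 hr
  refine ODE_solution_unique_of_mem_Ioo (K := K.toNNReal) (v := fun t x => L t x + b t)
    (s := fun _ => Set.univ) (t₀ := t₀) (fun r hr => ?_)
    (hmem t₀ ((le_max_right _ _).trans_lt (lt_add_one _))) (fun r _ => ⟨hf r, trivial⟩)
    (fun r _ => ⟨hg r, trivial⟩) h (hmem t ((le_max_left _ _).trans_lt (lt_add_one _)))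
  refine LipschitzWith.lipschitzOnWith (LipschitzWith.of_dist_le_mul fun x y => ?_)
  rw [dist_add_right, dist_eq_norm, dist_eq_norm, ← map_sub]
  refine (L r).le_of_opNorm_le ((hK r (Set.Ioo_subset_Icc_self hr)).trans ?_) _
  exact Real.le_coe_toNNReal K

end ODE

/-! ### Smooth approximation of maps between manifolds -/

section Smoothing

open Filter Set Topology

variable {E' : Type*} [NormedAddCommGroup E'] [NormedSpace ℝ E'] [FiniteDimensional ℝ E']
  {H : Type*} [TopologicalSpace H] {I : ModelWithCorners ℝ E' H}
  {M : Type*} [TopologicalSpace M] [ChartedSpace H M] [IsManifold I ∞ M] [T2Space M]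
  [SigmaCompactSpace M]
  {E : Type*} [NormedAddCommGroup E] [NormedSpace ℝ E]
  {N : Type*} [TopologicalSpace N] [ChartedSpace E N] [IsManifold 𝓘(ℝ, E) ∞ N]

theorem eventually_thickening_subset {X Y : Type*} [TopologicalSpace X] [PseudoMetricSpace Y]
    {F : X → Y} {L : Set X} (hL : IsCompact L) (hF : ContinuousOn F L) {U : Set Y} (hU : IsOpen U)
    (hLU : MapsTo F L U) :
    ∀ᶠ δ in 𝓝[>] (0 : ℝ), ∀ x ∈ L, ∀ z, dist z (F x) < δ → z ∈ U := by
  obtain ⟨δ, hδ, h⟩ := (hL.image_of_continuousOn hF).exists_thickening_subset_open hU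
    hLU.image_subset
  filter_upwards [Ioo_mem_nhdsGT hδ] with δ' hδ' x hx z hz
  exact h (Metric.mem_thickening_iff.2 ⟨F x, mem_image_of_mem F hx, hz.trans hδ'.2⟩)

omit [IsManifold 𝓘(ℝ, E) ∞ N] in
/-- Smoothing a continuous map inside one chart `φ` of the target: where the bump functions `b`
and `θ` are `1` the map becomes smooth, where one of them vanishes it does not change, and finitely
many conditions `g (L j) ⊆ C j` are preserved. -/
theorem exists_smoothing_in_chart {g : M → N} (hg : Continuous g) {φ : OpenPartialHomeomorph N E}
    (hφ : φ ∈ IsManifold.maximalAtlas 𝓘(ℝ, E) ∞ N) {b θ : M → ℝ}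
    (hb : ContMDiff I 𝓘(ℝ, ℝ) ∞ b) (hb1 : ∀ y, b y ∈ Icc (0 : ℝ) 1)
    (hθ : ContMDiff I 𝓘(ℝ, ℝ) ∞ θ) (hθ1 : ∀ y, θ y ∈ Icc (0 : ℝ) 1)
    (hK : IsCompact (tsupport b)) (hKφ : MapsTo g (tsupport b) φ.source)
    {ι : Type*} {J : Set ι} (hJ : J.Finite) {L : ι → Set M} {C : ι → Set N}
    (hL : ∀ j, IsClosed (L j)) (hC : ∀ j, IsOpen (C j)) (hLC : ∀ j ∈ J, MapsTo g (L j) (C j)) :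
    ∃ g' : M → N, Continuous g' ∧ (∀ j ∈ J, MapsTo g' (L j) (C j)) ∧
      (∀ y, b y = 0 → g' y = g y) ∧ (∀ y, θ y = 0 → g' y = g y) ∧
      (∀ y, ContMDiffAt I 𝓘(ℝ, E) ∞ g y → ContMDiffAt I 𝓘(ℝ, E) ∞ g' y) ∧
      ∀ y, b =ᶠ[𝓝 y] 1 → θ =ᶠ[𝓝 y] 1 → ContMDiffAt I 𝓘(ℝ, E) ∞ g' y := by
  classical
  set K := tsupport b
  have hb0 : ∀ y ∉ K, b y = 0 := fun y hy => image_eq_zero_of_notMem_tsupport hy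
  have hopen : IsOpen (g ⁻¹' φ.source) := φ.open_source.preimage hg
  let F : M → E := fun y => φ (g y)
  have hFc : ∀ y, g y ∈ φ.source → ContinuousAt F y := fun y hy =>
    (φ.continuousAt hy).comp hg.continuousAt
  have hFK : ContinuousOn F K := fun y hy => (hFc y (hKφ hy)).continuousWithinAt
  let F' : M → E := fun y => b y • F y
  have hF'0 : ∀ y, b y = 0 → F' y = 0 := fun y hy => by simp [F', hy]
  have hF' : Continuous F' := by
    rw [continuous_iff_continuousAt]
    intro y
    by_cases hy : y ∈ K
    · exact hb.continuous.continuousAt.smul (hFc y (hKφ hy))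
    · refine (continuousAt_const (y := (0 : E))).congr ?_
      filter_upwards [(isClosed_tsupport b).isOpen_compl.mem_nhds hy] with z hz
      exact (hF'0 z (hb0 z hz)).symm
  -- how far the values may be moved inside the chart without violating one of the conditions
  have hδ : ∀ᶠ δ in 𝓝[>] (0 : ℝ), 0 < δ ∧ (∀ x ∈ K, ∀ z, dist z (F x) < δ → z ∈ φ.target) ∧
      ∀ j ∈ J, ∀ x ∈ K ∩ L j, ∀ z, dist z (F x) < δ → z ∈ φ.target ∩ φ.symm ⁻¹' C j := by
    refine (eventually_mem_nhdsWithin).and ((eventually_thickening_subset hK hFK φ.open_target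
      fun y hy => φ.map_source (hKφ hy)).and ((hJ.eventually_all).2 fun j hj => ?_))
    refine eventually_thickening_subset (hK.inter_right (hL j)) (hFK.mono inter_subset_left)
      (φ.symm.isOpen_inter_preimage (hC j)) fun y hy => ⟨φ.map_source (hKφ hy.1), ?_⟩
    simpa [F, φ.left_inv (hKφ hy.1)] using hLC j hj hy.2
  obtain ⟨δ, hδ0, hδ1, hδ2⟩ := hδ.exists
  obtain ⟨G, hG, -⟩ := hF'.exists_contMDiff_approx I (⊤ : ℕ∞) (ε := fun _ => δ) continuous_const
    fun _ => hδ0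
  let h : M → E := fun y => F y + (θ y * b y) • (G y - F' y)
  have hh0 : ∀ y, θ y * b y = 0 → h y = F y := fun y hy => by simp [h, hy]
  have hhδ : ∀ y, dist (h y) (F y) < δ := by
    intro y
    rw [dist_eq_norm, show h y - F y = (θ y * b y) • (G y - F' y) from add_sub_cancel_left _ _,
      norm_smul, ← dist_eq_norm, Real.norm_eq_abs,
      abs_of_nonneg (mul_nonneg (hθ1 y).1 (hb1 y).1)]
    exact (mul_le_of_le_one_left dist_nonneg
      (mul_le_one₀ (hθ1 y).2 (hb1 y).1 (hb1 y).2)).trans_lt (hG y)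
  let g' : M → N := fun y => if g y ∈ φ.source then φ.symm (h y) else g y
  have hg'0 : ∀ y, θ y * b y = 0 → g' y = g y := by
    intro y hy
    by_cases hys : g y ∈ φ.source
    · simp only [g', if_pos hys, hh0 y hy]
      exact φ.left_inv hys
    · simp only [g', if_neg hys]
  have hoff : ∀ y ∉ K, g' =ᶠ[𝓝 y] g := by
    intro y hy
    filter_upwards [(isClosed_tsupport b).isOpen_compl.mem_nhds hy] with z hz
    exact hg'0 z (by rw [hb0 z hz, mul_zero])
  have hon : ∀ y ∈ K, g' =ᶠ[𝓝 y] fun z => φ.symm (h z) := by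
    intro y hy
    filter_upwards [hopen.mem_nhds (hKφ hy)] with z hz
    have hz' : g z ∈ φ.source := hz
    simp only [g', if_pos hz']
  have htarget : ∀ y ∈ K, h y ∈ φ.target := fun y hy => hδ1 y hy _ (hhδ y)
  have hsymm : ∀ y ∈ K, ContMDiffAt 𝓘(ℝ, E) 𝓘(ℝ, E) ∞ φ.symm (h y) := fun y hy =>
    (contMDiffOn_symm_of_mem_maximalAtlas hφ).contMDiffAt
      (φ.open_target.mem_nhds (htarget y hy))
  have hGy : ∀ y, ContMDiffAt I 𝓘(ℝ, E) ∞ G y := fun y => G.contMDiff y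
  refine ⟨g', ?_, ?_, fun y hy => hg'0 y (by rw [hy, mul_zero]),
    fun y hy => hg'0 y (by rw [hy, zero_mul]), ?_, ?_⟩
  · rw [continuous_iff_continuousAt]
    intro y
    by_cases hy : y ∈ K
    · refine ContinuousAt.congr ?_ (hon y hy).symm
      refine (hsymm y hy).continuousAt.comp ((hFc y (hKφ hy)).add ?_)
      exact (hθ.continuous.mul hb.continuous).continuousAt.smul
        ((hGy y).continuousAt.sub hF'.continuousAt)
    · exact hg.continuousAt.congr (hoff y hy).symm
  · intro j hj y hy
    by_cases hyK : y ∈ K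
    · rw [(hon y hyK).self_of_nhds]
      exact (hδ2 j hj y ⟨hyK, hy⟩ _ (hhδ y)).2
    · rw [(hoff y hyK).self_of_nhds]
      exact hLC j hj hy
  · intro y hgy
    by_cases hy : y ∈ K
    · refine ContMDiffAt.congr_of_eventuallyEq ?_ (hon y hy)
      have hF : ContMDiffAt I 𝓘(ℝ, E) ∞ F y :=
        ((contMDiffOn_of_mem_maximalAtlas hφ).contMDiffAt
          (φ.open_source.mem_nhds (hKφ hy))).comp y hgy
      exact (hsymm y hy).comp y
        (hF.add (((hθ y).mul (hb y)).smul ((hGy y).sub ((hb y).smul hF))))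
    · exact hgy.congr_of_eventuallyEq (hoff y hy)
  · intro y hby hθy
    have hy : y ∈ K := subset_tsupport b (by simp [hby.self_of_nhds])
    refine ContMDiffAt.congr_of_eventuallyEq ?_ (hon y hy)
    refine (hsymm y hy).comp y ((hGy y).congr_of_eventuallyEq ?_)
    filter_upwards [hby, hθy] with z hz hz'
    simp [h, F', hz, hz']

/-- A continuous map between manifolds that is smooth near a closed set `A` agrees on `A` with a
smooth map. The map is made smooth in the charts of a countable locally finite family, one after
the other; locally only finitely many steps change it. -/
theorem exists_contMDiff_eqOn {f : M → N} (hf : Continuous f) {A O : Set M} (hA : IsClosed A)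
    (hO : IsOpen O) (hAO : A ⊆ O) (hfO : ∀ y ∈ O, ContMDiffAt I 𝓘(ℝ, E) ∞ f y) :
    ∃ g : M → N, ContMDiff I 𝓘(ℝ, E) ∞ g ∧ EqOn g f A := by
  have : LocallyCompactSpace H := I.locallyCompactSpace
  have : LocallyCompactSpace M := ChartedSpace.locallyCompactSpace H M
  obtain ⟨θ, hθA, hθO, hθ1⟩ := exists_contMDiffMap_zero_one_nhds_of_isClosed I (n := ⊤) hA
    hO.isClosed_compl (disjoint_compl_right_iff_subset.2 hAO)
  obtain ⟨ι, B, hB⟩ := SmoothBumpCovering.exists_isSubordinate I (isClosed_univ (X := M))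
    (U := fun x => f ⁻¹' (chartAt E (f x)).source)
    (fun x _ => hf.continuousAt.preimage_mem_nhds (chart_source_mem_nhds E (f x)))
  let K : ι → Set M := fun i => tsupport (B i)
  let C : ι → Set N := fun i => (chartAt E (f (B.c i))).source
  have hfin : LocallyFinite K := B.locallyFinite.closure
  have hKc : ∀ i, IsCompact (K i) := fun i => (B i).hasCompactSupport
  have hcount : Countable ι := by
    refine countable_univ_iff.1 (hfin.countable_univ fun i => ?_)
    exact ⟨B.c i, subset_tsupport _ (B i).c_mem_support⟩
  obtain ⟨_⟩ := nonempty_encodable ι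
  let W : ℕ → Set M := fun n => {y | ∃ i, Encodable.encode i < n ∧ B i =ᶠ[𝓝 y] 1}
  let P : ℕ → (M → N) → Prop := fun n g => Continuous g ∧ (∀ j, MapsTo g (K j) (C j)) ∧
    EqOn g f A ∧ ∀ y, y ∈ O ∨ y ∈ W n → ContMDiffAt I 𝓘(ℝ, E) ∞ g y
  have hstep : ∀ (n : ℕ) (g : {g // P n g}), ∃ g' : {g // P (n + 1) g},
      ∀ y, (∀ i, Encodable.encode i = n → y ∉ K i) → g'.1 y = g.1 y := by
    rintro n ⟨g, hg, hgK, hgA, hgs⟩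
    by_cases hn : ∃ i : ι, Encodable.encode i = n
    · obtain ⟨i, hi⟩ := hn
      obtain ⟨g', hg', hgJ, hg0, hgθ, hgs', hgs1⟩ := exists_smoothing_in_chart (I := I) hg
        (IsManifold.chart_mem_maximalAtlas (I := 𝓘(ℝ, E)) (n := ∞) (f (B.c i)))
        (b := B i) (θ := θ) (B i).contMDiff (fun y => ⟨(B i).nonneg, (B i).le_one⟩) θ.contMDiff hθ1
        (hKc i) (hgK i) (hfin.finite_nonempty_inter_compact (hKc i)) (L := K) (C := C)
        (fun j => isClosed_tsupport _) (fun j => (chartAt E _).open_source) (fun j _ => hgK j)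
      refine ⟨⟨g', hg', fun j => ?_, fun y hy => ?_, fun y hy => ?_⟩, fun y hy => ?_⟩
      · by_cases hj : (K j ∩ K i).Nonempty
        · exact hgJ j hj
        · intro y hy
          rw [hg0 y (image_eq_zero_of_notMem_tsupport fun hyi => hj ⟨y, hy, hyi⟩)]
          exact hgK j hy
      · rw [hgθ y (hθA.self_of_nhdsSet y hy), hgA hy]
      · by_cases hyO : y ∈ O
        · exact hgs' y (hgs y (.inl hyO))
        · obtain ⟨j, hj, hjy⟩ := hy.resolve_left hyO
          rcases Nat.lt_succ_iff_lt_or_eq.1 hj with hj | hj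
          · exact hgs' y (hgs y (.inr ⟨j, hj, hjy⟩))
          · obtain rfl : j = i := Encodable.encode_injective (hj.trans hi.symm)
            exact hgs1 y hjy (hθO.filter_mono (nhds_le_nhdsSet hyO))
      · exact hg0 y (image_eq_zero_of_notMem_tsupport (hy i hi))
    · refine ⟨⟨g, hg, hgK, hgA, fun y hy => hgs y (hy.imp_right ?_)⟩, fun y _ => rfl⟩
      rintro ⟨j, hj, hjy⟩
      exact ⟨j, (Nat.lt_succ_iff.1 hj).lt_of_ne fun h => hn ⟨j, h⟩, hjy⟩
  choose next hnext using hstep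
  let G : ∀ n, {g // P n g} := fun n => Nat.rec (motive := fun n => {g // P n g})
    ⟨f, hf, hB, fun _ _ => rfl, fun y hy => hfO y (hy.resolve_right fun ⟨_, h, _⟩ => absurd h (Nat.not_lt_zero _))⟩
    next n
  have hG : ∀ n y, (∀ i, Encodable.encode i = n → y ∉ K i) → (G (n + 1)).1 y = (G n).1 y :=
    fun n => hnext n (G n)
  have hstable : ∀ y, ∃ n₀, ∀ᶠ z in 𝓝 y, ∀ n ≥ n₀, (G n).1 z = (G n₀).1 z := by
    intro y
    obtain ⟨V, hV, hVfin⟩ := hfin y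
    obtain ⟨n₀, hn₀⟩ := (hVfin.image Encodable.encode).bddAbove
    refine ⟨n₀ + 1, ?_⟩
    filter_upwards [hV] with z hz n hn
    induction n, hn using Nat.le_induction with
    | base => rfl
    | succ n hn ih =>
      rw [hG n z fun i hi hzi => ?_, ih]
      have := hn₀ (mem_image_of_mem Encodable.encode (show i ∈ {i | (K i ∩ V).Nonempty} from
        ⟨z, hzi, hz⟩))
      omega
  choose n₀ hn₀ using hstable
  have hlim : ∀ y, ∀ n ≥ n₀ y, (fun z => (G (n₀ z)).1 z) =ᶠ[𝓝 y] (G n).1 := by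
    intro y n hn
    filter_upwards [hn₀ y] with z hz
    rw [hz n hn, ← hz (max (n₀ y) (n₀ z)) (le_max_left _ _)]
    exact ((hn₀ z).self_of_nhds _ (le_max_right _ _)).symm
  refine ⟨fun z => (G (n₀ z)).1 z, fun y => ?_, fun y hy => (G (n₀ y)).2.2.2.1 hy⟩
  obtain ⟨i, hi⟩ := B.eventuallyEq_one' y trivial
  set n := max (n₀ y) (Encodable.encode i + 1)
  refine ((G n).2.2.2.2 y (.inr ⟨i, ?_, hi⟩)).congr_of_eventuallyEq (hlim y n (le_max_left _ _))
  exact (Nat.lt_succ_self _).trans_le (le_max_right _ _)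

end Smoothing

/-! ### A smooth contraction -/

section Contraction

open Filter Set Topology

variable {E : Type*} [NormedAddCommGroup E] [NormedSpace ℝ E] [FiniteDimensional ℝ E]
  {B : Type*} [TopologicalSpace B] [T2Space B] [SecondCountableTopology B]
  [ChartedSpace E B] [IsManifold 𝓘(ℝ, E) ∞ B]

/-- A contractible manifold has a smooth contraction that is stationary near both ends. -/
theorem exists_smooth_contraction (U : Opens B) [ContractibleSpace U] :
    ∃ (y₁ : U) (H : U × ℝ → U), ContMDiff (𝓘(ℝ, E).prod 𝓘(ℝ, ℝ)) 𝓘(ℝ, E) ∞ H ∧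
      (∀ y t, t ≤ 1 / 3 → H (y, t) = y₁) ∧ ∀ y t, 2 / 3 ≤ t → H (y, t) = y := by
  have : LocallyCompactSpace B := Manifold.locallyCompact_of_finiteDimensional 𝓘(ℝ, E)
  have : LocallyCompactSpace U := U.isOpen.locallyCompactSpace
  obtain ⟨y₁, ⟨h⟩⟩ := id_nullhomotopic U
  have hc : Continuous fun p : U × ℝ => h (projIcc (0 : ℝ) 1 zero_le_one (3 - 5 * p.2), p.1) := by
    fun_prop
  have hlow : ∀ p : U × ℝ, p.2 ≤ 2 / 5 →
      h (projIcc (0 : ℝ) 1 zero_le_one (3 - 5 * p.2), p.1) = y₁ := by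
    intro p hp
    rw [projIcc_of_right_le _ (by linarith)]
    exact h.apply_one p.1
  have hhigh : ∀ p : U × ℝ, 3 / 5 ≤ p.2 →
      h (projIcc (0 : ℝ) 1 zero_le_one (3 - 5 * p.2), p.1) = p.1 := by
    intro p hp
    rw [projIcc_of_le_left _ (by linarith)]
    exact h.apply_zero p.1
  obtain ⟨H, hH, hHeq⟩ := exists_contMDiff_eqOn (I := 𝓘(ℝ, E).prod 𝓘(ℝ, ℝ)) (E := E) hc
    (A := {p : U × ℝ | p.2 ≤ 1 / 3} ∪ {p | 2 / 3 ≤ p.2})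
    (O := {p : U × ℝ | p.2 < 2 / 5} ∪ {p | 3 / 5 < p.2})
    ((isClosed_le continuous_snd continuous_const).union
      (isClosed_le continuous_const continuous_snd))
    ((isOpen_lt continuous_snd continuous_const).union
      (isOpen_lt continuous_const continuous_snd))
    (union_subset_union (fun p (hp : p.2 ≤ 1 / 3) => show p.2 < 2 / 5 by linarith)
      fun p (hp : 2 / 3 ≤ p.2) => show 3 / 5 < p.2 by linarith) (by
    rintro p (hp | hp)
    · refine (contMDiffAt_const (c := y₁)).congr_of_eventuallyEq ?_
      filter_upwards [(isOpen_lt continuous_snd continuous_const).mem_nhds hp] with q hq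
      exact hlow q (le_of_lt hq)
    · refine contMDiffAt_fst.congr_of_eventuallyEq ?_
      filter_upwards [(isOpen_lt continuous_const continuous_snd).mem_nhds hp] with q hq
      exact hhigh q (le_of_lt hq))
  refine ⟨y₁, H, hH, fun y t ht => ?_, fun y t ht => ?_⟩
  · rw [hHeq (.inl ht)]
    exact hlow _ (by simp only; linarith)
  · rw [hHeq (.inr ht)]
    exact hhigh _ (by simp only; linarith)

/-- For a point `x` of a contractible open set `U` there is a smooth family of paths `G (y, ·)` in
`U` leading from `x` to `y`, stationary near both ends, such that the path from `x` to itself runs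
back along the way it came. -/
theorem exists_smooth_paths (U : Opens B) [ContractibleSpace U] {x : B} (hx : x ∈ U) :
    ∃ G : B × ℝ → B, (∀ y ∈ U, ∀ t, G (y, t) ∈ U) ∧
      (∀ y ∈ U, ∀ t, ContMDiffAt (𝓘(ℝ, E).prod 𝓘(ℝ, ℝ)) 𝓘(ℝ, E) ∞ G (y, t)) ∧
      (∀ y ∈ U, ∀ t ≤ -1, G (y, t) = x) ∧ (∀ y ∈ U, ∀ t, 1 ≤ t → G (y, t) = y) ∧
      ∀ t, G (x, -t) = G (x, t) := by
  classical
  obtain ⟨y₁, H, hH, hH0, hH1⟩ := exists_smooth_contraction (E := E) U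
  let x' : U := ⟨x, hx⟩
  -- first from `x` to the centre `y₁` of the contraction, then from `y₁` to the end point; the two
  -- parts fit together smoothly because `H` is stationary at small times
  let K : U × ℝ → U := fun p => if p.2 ≤ 0 then H (x', -p.2) else H p
  have hK : ContMDiff (𝓘(ℝ, E).prod 𝓘(ℝ, ℝ)) 𝓘(ℝ, E) ∞ K := by
    intro p
    by_cases hp : p.2 < 1 / 3
    · have h1 : ContMDiffAt (𝓘(ℝ, E).prod 𝓘(ℝ, ℝ)) 𝓘(ℝ, E) ∞ (fun p : U × ℝ => H (x', -p.2)) p :=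
        hH.comp (contMDiff_const.prodMk (contDiff_neg.contMDiff.comp contMDiff_snd)) p
      refine h1.congr_of_eventuallyEq ?_
      filter_upwards [(isOpen_lt continuous_snd continuous_const).mem_nhds hp] with q hq
      have hq' : q.2 < 1 / 3 := hq
      by_cases hq0 : q.2 ≤ 0
      · simp only [K, if_pos hq0]
      · simp only [K, if_neg hq0]
        exact (hH0 q.1 q.2 hq'.le).trans (hH0 x' (-q.2) (by linarith)).symm
    · refine (hH p).congr_of_eventuallyEq ?_
      have hp' : 0 < p.2 := by linarith [not_lt.1 hp]
      filter_upwards [(isOpen_lt continuous_const continuous_snd).mem_nhds hp'] with q hq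
      exact if_neg (not_le.2 hq)
  let r : B → U := fun y => if hy : y ∈ U then ⟨y, hy⟩ else x'
  have hr : ∀ y (hy : y ∈ U), r y = ⟨y, hy⟩ := fun y hy => dif_pos hy
  have hrs : ∀ y ∈ U, ContMDiffAt 𝓘(ℝ, E) 𝓘(ℝ, E) ∞ r y := by
    intro y hy
    refine (contMDiffAt_subtype_iff (x := ⟨y, hy⟩)).1 (contMDiffAt_id.congr_of_eventuallyEq ?_)
    exact .of_forall fun z => hr z z.2
  refine ⟨fun p => K (r p.1, p.2), fun y _ t => (K (r y, t)).2, fun y hy t => ?_,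
    fun y hy t ht => ?_, fun y hy t ht => ?_, fun t => ?_⟩
  · refine ContMDiffAt.comp (g := fun z : U => (z : B)) (y, t) contMDiff_subtype_val.contMDiffAt ?_
    exact hK.contMDiffAt.comp (y, t)
      (((hrs y hy).comp (y, t) contMDiffAt_fst).prodMk contMDiffAt_snd)
  · simp only [K]
    rw [if_pos (by linarith), hH1 _ _ (by linarith)]
  · simp only [K]
    rw [if_neg (by linarith), hH1 _ _ (by linarith), hr y hy]
  · simp only [hr x hx]
    have key : ∀ t, K (x', t) = H (x', |t|) := by
      intro t
      by_cases ht : t ≤ 0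
      · simp only [K, if_pos ht, abs_of_nonpos ht]
      · simp only [K, if_neg ht, abs_of_pos (not_le.1 ht)]
    change (K (x', -t) : B) = K (x', t)
    rw [key, key, abs_neg]

end Contraction

/-! ### Generating sections of a vector bundle -/

section Generators

attribute [local instance] continuousSMul_real

open Filter Set Topology

set_option linter.unusedSectionVars false

universe uB

variable (E : Type*) [NormedAddCommGroup E] [NormedSpace ℝ E]
  {B : Type uB} [TopologicalSpace B] [ChartedSpace E B] [IsManifold 𝓘(ℝ, E) ∞ B]
  (F : Type*) [NormedAddCommGroup F] [NormedSpace ℂ F]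
  (V : B → Type*) [TopologicalSpace (TotalSpace F V)] [∀ x, AddCommGroup (V x)]
  [∀ x, Module ℂ (V x)] [∀ x, TopologicalSpace (V x)] [∀ x, IsTopologicalAddGroup (V x)]
  [∀ x, ContinuousSMul ℂ (V x)] [FiberBundle F V] [VectorBundle ℂ F V] [VectorBundle ℝ F V]

/-- A locally finite generating system of a complex vector bundle: global sections `s j` together
with smooth coefficient functionals `σ j` such that `v = ∑ j, σ j v • s j` for all `v`. The sets
`S j` are a locally finite family of closed sets off which the functionals vanish. The functionals
are `ℂ`-linear, but recorded as continuous `ℝ`-linear maps, since the forms are alternating over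
the reals. -/
structure Generators where
  /-- The index type. -/
  idx : Type uB
  /-- The generating sections. -/
  s : idx → Form E F V 0 (⊤ : Opens B)
  /-- The coefficient functionals. -/
  σ : idx → ∀ x : B, V x →L[ℝ] ℂ
  /-- Closed sets off which the functionals vanish. -/
  S : idx → Set B
  σ_smul : ∀ j x (c : ℂ) v, σ j x (c • v) = c • σ j x v
  isClosed : ∀ j, IsClosed (S j)
  locallyFinite : LocallyFinite S
  σ_eq_zero : ∀ j, ∀ x ∉ S j, σ j x = 0
  sum_eq : ∀ x (J : Finset idx), (∀ j, x ∈ S j → j ∈ J) → ∀ v : V x,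
    ∑ j ∈ J, σ j x v • (s j).1 x ![] = v
  smooth : ∀ j {p : ℕ} {U : Opens B} (η : Form E F V p U),
    IsSmoothOn ℂ (Bundle.Trivial B ℂ)
      (fun x => (show FormFibre E (Bundle.Trivial B ℂ) p x from
        (σ j x).compContinuousAlternatingMap (η.1 x))) U

variable {E F V}

theorem coordChangeL_continuousLinearMapAt (e e' : Trivialization F (π F V)) [e.IsLinear ℝ]
    [e'.IsLinear ℝ] {x : B} (hx : x ∈ e.baseSet) (hx' : x ∈ e'.baseSet) (v : V x) :
    e.coordChangeL ℝ e' x (e.continuousLinearMapAt ℝ x v) = e'.continuousLinearMapAt ℝ x v := by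
  rw [Trivialization.coordChangeL_apply e e' ⟨hx, hx'⟩, ← e.symmL_apply (R := ℝ) hx,
    e.symmL_continuousLinearMapAt hx, Trivialization.continuousLinearMapAt_apply,
    Trivialization.coe_linearMapAt_of_mem _ hx']

theorem coordForm_apply {p : ℕ} (x₀ : B) (η : ∀ x : B, FormFibre E V p x) (x : B)
    (v : Fin p → E) : coordForm F V x₀ η x v =
      (trivializationAt F V x₀).continuousLinearMapAt ℝ x
        (η x fun i => (trivializationAt E (TangentSpace 𝓘(ℝ, E)) x₀).symmL ℝ x (v i)) := rfl

theorem coordForm_trivial_apply {p : ℕ} (x₀ : B)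
    (η : ∀ x : B, FormFibre E (Bundle.Trivial B ℂ) p x) (x : B)
    (v : Fin p → E) : coordForm ℂ (Bundle.Trivial B ℂ) x₀ η x v =
      η x fun i => (trivializationAt E (TangentSpace 𝓘(ℝ, E)) x₀).symmL ℝ x (v i) := by
  rw [coordForm_apply]
  simp

set_option synthInstance.maxHeartbeats 200000 in
theorem contMDiffAt_compContinuousAlternatingMap {p : ℕ} {L : B → F →L[ℝ] ℂ}
    {η : B → E [⋀^Fin p]→L[ℝ] F} {x : B}
    (hL : ContMDiffAt 𝓘(ℝ, E) 𝓘(ℝ, F →L[ℝ] ℂ) ∞ L x)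
    (hη : ContMDiffAt 𝓘(ℝ, E) 𝓘(ℝ, E [⋀^Fin p]→L[ℝ] F) ∞ η x) :
    ContMDiffAt 𝓘(ℝ, E) 𝓘(ℝ, E [⋀^Fin p]→L[ℝ] ℂ) ∞
      (fun x => (L x).compContinuousAlternatingMap (η x)) x :=
  ((ContinuousLinearMap.compContinuousAlternatingMapCLM (𝕜 := ℝ) (ι := Fin p)
    (E := E) (F := F) (G := ℂ)).contDiff.contMDiff.contMDiffAt.comp x hL).clm_apply hη

variable [FiniteDimensional ℝ E] [T2Space B] [SecondCountableTopology B] [FiniteDimensional ℂ F]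
  [ContMDiffVectorBundle ∞ F V 𝓘(ℝ, E)]

variable (E F V) in
/-- A smooth bundle of finite rank over a second countable manifold has a locally finite generating
system: local frames are cut off to global sections, and the dual frames are multiplied by a
partition of unity. -/
theorem nonempty_generators : Nonempty (Generators E F V) := by
  classical
  have : LocallyCompactSpace B := Manifold.locallyCompact_of_finiteDimensional 𝓘(ℝ, E)
  let e : B → Trivialization F (π F V) := fun c => trivializationAt F V c
  obtain ⟨ρ, hρ⟩ := SmoothPartitionOfUnity.exists_isSubordinate 𝓘(ℝ, E) (isClosed_univ (X := B))
    (fun c => (e c).baseSet) (fun c => (e c).open_baseSet)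
    (fun x _ => mem_iUnion.2 ⟨x, mem_baseSet_trivializationAt F V x⟩)
  have hχ : ∀ c, ∃ χ : C^∞⟮𝓘(ℝ, E), B; 𝓘(ℝ), ℝ⟯, (∀ x ∈ tsupport (ρ c), χ x = 1) ∧
      ∀ x ∉ (e c).baseSet, χ =ᶠ[𝓝 x] 0 := by
    intro c
    obtain ⟨u, hu, hcu, hue⟩ := normal_exists_closure_subset (isClosed_tsupport (ρ c))
      (e c).open_baseSet (hρ c)
    obtain ⟨χ, h1, h0, -⟩ := exists_contMDiffMap_one_nhds_of_subset_interior 𝓘(ℝ, E) (n := ⊤)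
      (isClosed_tsupport (ρ c)) (hcu.trans (hu.subset_interior_iff.2 subset_closure))
    refine ⟨χ, fun x hx => h1.self_of_nhdsSet x hx, fun x hx => ?_⟩
    filter_upwards [isClosed_closure.isOpen_compl.mem_nhds fun h => hx (hue h)] with y hy
    exact h0 y hy
  choose χ hχ1 hχ0 using hχ
  let b := Module.finBasis ℂ F
  let coord : Fin (Module.finrank ℂ F) → F →L[ℝ] ℂ := fun i =>
    (LinearMap.toContinuousLinearMap (b.coord i)).restrictScalars ℝ
  let σ : B × Fin (Module.finrank ℂ F) → ∀ x : B, V x →L[ℝ] ℂ := fun j x =>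
    ρ j.1 x • (coord j.2).comp ((e j.1).continuousLinearMapAt ℝ x)
  have hρ0 : ∀ c x, x ∉ tsupport (ρ c) → ρ c x = 0 := fun c x hx =>
    image_eq_zero_of_notMem_tsupport hx
  let s₀ : B × Fin (Module.finrank ℂ F) → ∀ x : B, FormFibre E V 0 x := fun j x =>
    ContinuousAlternatingMap.constOfIsEmpty ℝ (TangentSpace 𝓘(ℝ, E) x) (Fin 0)
      (χ j.1 x • (e j.1).symmL ℝ x (b j.2))
  have hs₀ : ∀ j, IsSmoothOn F V (s₀ j) ((⊤ : Opens B) : Set B) := by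
    intro j
    rw [isSmoothOn_iff]
    intro x₀ _
    by_cases hx₀ : x₀ ∈ (e j.1).baseSet
    · have h1 : ContMDiffAt 𝓘(ℝ, E) 𝓘(ℝ, F) ∞ (fun x => χ j.1 x •
          (e j.1).coordChangeL ℝ (e x₀) x (b j.2)) x₀ :=
        (χ j.1).contMDiff.contMDiffAt.smul
          ((contMDiffAt_coordChangeL (IB := 𝓘(ℝ, E)) (e := e j.1) (e' := e x₀) hx₀
            (mem_baseSet_trivializationAt F V x₀)).clm_apply contMDiffAt_const)
      refine ((ContinuousAlternatingMap.constOfIsEmptyLIE ℝ E F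
        (Fin 0)).contDiff.contMDiff.contMDiffAt.comp x₀ h1).congr_of_eventuallyEq ?_
      filter_upwards [(e j.1).open_baseSet.mem_nhds hx₀, (e x₀).open_baseSet.mem_nhds
        (mem_baseSet_trivializationAt F V x₀)] with x hx hx'
      ext v
      rw [coordForm_apply]
      simp only [s₀, ContinuousAlternatingMap.constOfIsEmpty_apply, map_smul]
      rw [← coordChangeL_continuousLinearMapAt (e j.1) (e x₀) hx hx',
        (e j.1).continuousLinearMapAt_symmL hx]
      rfl
    · refine (contMDiffAt_const (c := 0)).congr_of_eventuallyEq ?_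
      filter_upwards [hχ0 j.1 x₀ hx₀] with x hx
      ext v
      rw [coordForm_apply]
      simp [s₀, hx]
  refine ⟨⟨B × Fin (Module.finrank ℂ F), fun j => ⟨s₀ j, hs₀ j, fun x hx => (hx trivial).elim⟩, σ,
    fun j => tsupport (ρ j.1), ?_, fun j => isClosed_tsupport _, ?_, ?_, ?_, ?_⟩⟩
  · intro j x c v
    simp only [σ, _root_.smul_apply, ContinuousLinearMap.comp_apply, e,
      trivialization_map_smul F V]
    simp [coord, mul_left_comm]
  · intro x
    obtain ⟨t, ht, hfin⟩ := ρ.locallyFinite.closure x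
    exact ⟨t, ht, (hfin.prod finite_univ).subset fun j hj => ⟨hj, mem_univ _⟩⟩
  · intro j x hx
    ext v
    simp [σ, hρ0 _ _ hx]
  · intro x J hJ v
    have h1 : ∀ j : B × Fin (Module.finrank ℂ F), ρ j.1 x = 0 → σ j x v • s₀ j x ![] = 0 := by
      intro j hj
      simp [σ, hj]
    have h2 : ∑ j ∈ J, σ j x v • s₀ j x ![] =
        ∑ j ∈ ρ.finsupport x ×ˢ Finset.univ, σ j x v • s₀ j x ![] := by
      refine Finset.sum_congr_of_eq_on_inter (fun j _ hj => h1 j ?_) (fun j _ hj => h1 j ?_)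
        fun _ _ _ => rfl
      · simpa [ρ.mem_finsupport] using hj
      · exact hρ0 _ _ fun h => hj (hJ j h)
    have h3 : ∀ c ∈ ρ.finsupport x, ∑ i, σ (c, i) x v • s₀ (c, i) x ![] = ρ c x • v := by
      intro c hc
      have hc' : x ∈ tsupport (ρ c) := subset_tsupport _ (by simpa [ρ.mem_finsupport] using hc)
      have h4 : ∀ i, σ (c, i) x v • s₀ (c, i) x ![] = (e c).symmL ℝ x
          (ρ c x • (b.coord i ((e c).continuousLinearMapAt ℝ x v) • b i)) := by
        intro i
        have h5 : ∀ (z : ℂ) (f : F), (e c).symmL ℝ x (z • f) = z • (e c).symmL ℝ x f := by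
          intro z f
          have h6 := congrArg ((e c).symmL ℝ x) (trivialization_map_smul F V c x z
            ((e c).symmL ℝ x f))
          rwa [(e c).symmL_continuousLinearMapAt (hρ c hc'),
            (e c).continuousLinearMapAt_symmL (hρ c hc'), eq_comm] at h6
        simp only [s₀, σ, ContinuousAlternatingMap.constOfIsEmpty_apply, hχ1 c x hc', one_smul,
          map_smul, h5]
        simp only [coord, ContinuousLinearMap.comp_apply, Complex.real_smul,
          _root_.smul_apply, mul_smul, Complex.coe_smul]
        rfl
      simp only [h4]
      rw [← map_sum, ← Finset.smul_sum]
      have h7 := b.sum_repr ((e c).continuousLinearMapAt ℝ x v)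
      simp only [Module.Basis.coord_apply, h7, map_smul]
      rw [(e c).symmL_continuousLinearMapAt (hρ c hc')]
    change ∑ j ∈ J, σ j x v • s₀ j x ![] = v
    rw [h2, Finset.sum_product, Finset.sum_congr rfl h3, ← Finset.sum_smul,
      ρ.sum_finsupport x (mem_univ x), one_smul]
  · intro j p U η
    rw [isSmoothOn_iff]
    intro x₀ hx₀
    by_cases hx : x₀ ∈ tsupport (ρ j.1)
    · have h1 : ContMDiffAt 𝓘(ℝ, E) 𝓘(ℝ, F →L[ℝ] ℂ) ∞ (fun x => ρ j.1 x •
          (coord j.2).comp ((e x₀).coordChangeL ℝ (e j.1) x : F →L[ℝ] F)) x₀ :=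
        (ρ j.1).contMDiff.contMDiffAt.smul (contMDiffAt_const.clm_comp
          (contMDiffAt_coordChangeL (IB := 𝓘(ℝ, E)) (e := e x₀) (e' := e j.1)
            (mem_baseSet_trivializationAt F V x₀) (hρ j.1 hx)))
      refine (contMDiffAt_compContinuousAlternatingMap h1
        (Form.contMDiffAt η hx₀)).congr_of_eventuallyEq ?_
      filter_upwards [(e j.1).open_baseSet.mem_nhds (hρ j.1 hx), (e x₀).open_baseSet.mem_nhds
        (mem_baseSet_trivializationAt F V x₀)] with x hx hx'
      ext v
      rw [coordForm_trivial_apply]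
      change σ j x (η.1 x _) = ρ j.1 x • coord j.2 ((e x₀).coordChangeL ℝ (e j.1) x
        (coordForm F V x₀ η.1 x v))
      rw [coordForm_apply, coordChangeL_continuousLinearMapAt (e x₀) (e j.1) hx' hx]
      rfl
    · refine (contMDiffAt_const (c := 0)).congr_of_eventuallyEq ?_
      filter_upwards [(isClosed_tsupport (ρ j.1)).isOpen_compl.mem_nhds hx] with x hx
      ext v
      rw [coordForm_trivial_apply]
      change σ j x (η.1 x _) = 0
      simp [σ, hρ0 _ _ hx]

end Generators

/-! ### Coefficients of vector bundle valued forms -/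

section Coefficients

attribute [local instance] continuousSMul_real

open Filter Set Topology

set_option linter.unusedSectionVars false

universe uB

variable {E : Type*} [NormedAddCommGroup E] [NormedSpace ℝ E] [FiniteDimensional ℝ E]
  {B : Type uB} [TopologicalSpace B] [T2Space B] [SecondCountableTopology B]
  [ChartedSpace E B] [IsManifold 𝓘(ℝ, E) ∞ B]
  {F : ℕ → Type*} [∀ q, NormedAddCommGroup (F q)] [∀ q, NormedSpace ℂ (F q)]
  {V : ℕ → B → Type*} [∀ q, TopologicalSpace (TotalSpace (F q) (V q))]
  [∀ q x, AddCommGroup (V q x)] [∀ q x, Module ℂ (V q x)] [∀ q x, TopologicalSpace (V q x)]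
  [∀ q x, IsTopologicalAddGroup (V q x)] [∀ q x, ContinuousSMul ℂ (V q x)]
  [∀ q, FiberBundle (F q) (V q)] [∀ q, VectorBundle ℂ (F q) (V q)]
  [∀ q, VectorBundle ℝ (F q) (V q)]
  {U : Opens B}

theorem alternating_eq_zero_of_finrank_lt {T : Type*} [NormedAddCommGroup T] [NormedSpace ℝ T]
    [FiniteDimensional ℝ T] {p : ℕ} (h : Module.finrank ℝ T < p) (α : T [⋀^Fin p]→L[ℝ] ℂ) :
    α = 0 := by
  ext v
  refine α.toAlternatingMap.map_linearDependent v fun hv => ?_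
  simpa using hv.fintype_card_le_finrank.trans_lt h

/-- The value at a point of an inhomogeneous scalar form. -/
def formVal (α : ∀ p, ScalarForm E p U) (z : B) : ExtAlg E :=
  fun p => show E [⋀^Fin p]→L[ℝ] ℂ from (α p).1 z

/-- The exterior derivative of an inhomogeneous scalar form. -/
def formD (α : ∀ p, ScalarForm E p U) : ∀ p, ScalarForm E p U
  | 0 => 0
  | p + 1 => ScalarForm.d (α p)

theorem formVal_eq_sum (α : ∀ p, ScalarForm E p U) (z : B) :
    formVal α z = ∑ p ∈ Finset.range (Module.finrank ℝ E + 1), ExtAlg.of p (formVal α z p) := by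
  ext1 p
  rw [ExtAlg.sum_apply]
  by_cases hp : p ∈ Finset.range (Module.finrank ℝ E + 1)
  · rw [Finset.sum_eq_single_of_mem p hp fun q _ hq => ExtAlg.of_apply_of_ne hq _,
      ExtAlg.of_apply_self]
  · rw [alternating_eq_zero_of_finrank_lt (by simpa using hp) (formVal α z p), eq_comm]
    exact Finset.sum_eq_zero fun q hq =>
      ExtAlg.of_apply_of_ne (fun h : q = p => hp (h ▸ hq)) _

theorem formVal_formD_eq_sum (α : ∀ p, ScalarForm E p U) (z : B) :
    formVal (formD α) z = ∑ p ∈ Finset.range (Module.finrank ℝ E + 1),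
      ExtAlg.of (p + 1) (formVal (formD α) z (p + 1)) := by
  conv_lhs => rw [formVal_eq_sum]
  rw [Finset.sum_range_succ', Finset.sum_range_succ]
  congr 1
  rw [alternating_eq_zero_of_finrank_lt (Nat.lt_succ_self _)
    (formVal (formD α) z (Module.finrank ℝ E + 1))]
  ext1 p
  have h1 : formVal (formD α) z 0 = 0 := rfl
  rw [h1]
  exact (map_zero (castForm 0 p)).trans (map_zero (castForm _ p)).symm

/-- Exterior multiplication by an inhomogeneous scalar form. -/
def wedgeInh (α : ∀ p, ScalarForm E p U) (ξ : TotalForm E F V U) : TotalForm E F V U :=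
  ∑ p ∈ Finset.range (Module.finrank ℝ E + 1), TotalForm.wedge (α p) ξ

variable (g : ∀ q, Generators E (F q) (V q))

/-- The index set of the generators of all the bundles `V q`. -/
abbrev GenIdx : Type _ := Σ q, (g q).idx

variable {g}

/-- The value at `z` of the coefficient of a homogeneous form with respect to a generator. -/
def coefHom {q : ℕ} (i : (g q).idx) (z : B) (p : ℕ) :
    Form E (F q) (V q) p U →ₗ[ℂ] E [⋀^Fin p]→L[ℝ] ℂ where
  toFun ξ := ((g q).σ i z).compContinuousAlternatingMap (ξ.1 z)
  map_add' η η' := by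
    ext v
    exact map_add ((g q).σ i z) _ _
  map_smul' c η := by
    ext v
    exact (g q).σ_smul i z c _

theorem coefHom_apply {q : ℕ} (i : (g q).idx) (z : B) {p : ℕ} (ξ : Form E (F q) (V q) p U)
    (v : Fin p → E) : coefHom i z p ξ v = (g q).σ i z (ξ.1 z v) := rfl

/-- The value at `z` of the coefficient of a form with respect to the generator `j`. -/
def coefAt (j : GenIdx g) (z : B) : TotalForm E F V U →ₗ[ℂ] ExtAlg E where
  toFun η := fun p => coefHom j.2 z p (η (p, j.1))
  map_add' η η' := by
    ext1 p
    exact map_add (coefHom j.2 z p) _ _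
  map_smul' c η := by
    ext1 p
    exact map_smul (coefHom j.2 z p) _ _

theorem coefAt_apply (j : GenIdx g) (z : B) (η : TotalForm E F V U) (p : ℕ) :
    coefAt j z η p = coefHom j.2 z p (η (p, j.1)) := rfl

/-- The coefficient of a form with respect to the generator `j`, an inhomogeneous scalar form. -/
def coef (j : GenIdx g) (η : TotalForm E F V U) (p : ℕ) : ScalarForm E p U :=
  ⟨fun x => (show FormFibre E (Bundle.Trivial B ℂ) p x from
    ((g j.1).σ j.2 x).compContinuousAlternatingMap ((η (p, j.1)).1 x)),
    (g j.1).smooth j.2 _, fun x hx => by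
      have h := (η (p, j.1)).2.2 x hx
      ext v
      exact (congrArg (fun ζ : FormFibre E (V j.1) p x => (g j.1).σ j.2 x (ζ v)) h).trans
        (map_zero ((g j.1).σ j.2 x))⟩

theorem formVal_coef (j : GenIdx g) (η : TotalForm E F V U) (z : B) :
    formVal (coef j η) z = coefAt j z η := rfl

theorem coefAt_eq_zero_of_notMem (j : GenIdx g) {z : B} (hz : z ∉ (g j.1).S j.2)
    (η : TotalForm E F V U) : coefAt j z η = 0 := by
  ext p v
  rw [coefAt_apply, coefHom_apply, (g j.1).σ_eq_zero _ _ hz]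
  rfl

theorem coefAt_lof_self {p q : ℕ} (i : (g q).idx) (z : B) (ξ : Form E (F q) (V q) p U) :
    coefAt (g := g) ⟨q, i⟩ z (DirectSum.lof ℂ (ℕ × ℕ) (fun i => Form E (F i.2) (V i.2) i.1 U)
      (p, q) ξ) = ExtAlg.of p (coefHom i z p ξ) := by
  ext1 r
  rw [coefAt_apply]
  by_cases h : p = r
  · subst h
    rw [DirectSum.lof_apply, ExtAlg.of_apply_self]
  · rw [ExtAlg.of_apply_of_ne h, DirectSum.lof_eq_of,
      DirectSum.of_eq_of_ne _ _ _ (by simpa using Ne.symm h), map_zero]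

theorem coefAt_lof_of_ne {p q : ℕ} {j : GenIdx g} (h : q ≠ j.1) (z : B)
    (ξ : Form E (F q) (V q) p U) :
    coefAt j z (DirectSum.lof ℂ (ℕ × ℕ) (fun i => Form E (F i.2) (V i.2) i.1 U)
      (p, q) ξ) = 0 := by
  ext1 r
  rw [coefAt_apply, DirectSum.lof_eq_of, DirectSum.of_eq_of_ne _ _ _ (by simp [Ne.symm h]),
    map_zero]
  rfl

theorem coefAt_wedge (j : GenIdx g) (z : B) {k : ℕ} (α : ScalarForm E k U)
    (η : TotalForm E F V U) : coefAt j z (TotalForm.wedge α η) =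
      ExtAlg.of k (show E [⋀^Fin k]→L[ℝ] ℂ from α.1 z) * coefAt j z η := by
  obtain ⟨q₀, i₀⟩ := j
  induction η using DirectSum.induction_on with
  | zero => simp
  | add η η' h h' => rw [map_add, map_add, map_add, mul_add, h, h']
  | of i ξ =>
    obtain ⟨p, q⟩ := i
    rw [← DirectSum.lof_eq_of ℂ, TotalForm.wedge, DirectSum.toModule_lof, LinearMap.comp_apply]
    by_cases h : q = q₀
    · subst h
      rw [coefAt_lof_self, coefAt_lof_self, ExtAlg.of_mul_of]
      congr 1
      exact wedge_natural _ _ (ContinuousLinearMap.id ℝ E) _ ((g q).σ_smul i₀ z)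
    · rw [coefAt_lof_of_ne h, coefAt_lof_of_ne h, mul_zero]

theorem coefAt_wedgeInh (j : GenIdx g) (z : B) (α : ∀ p, ScalarForm E p U)
    (ξ : TotalForm E F V U) : coefAt j z (wedgeInh α ξ) = formVal α z * coefAt j z ξ := by
  rw [wedgeInh, map_sum, formVal_eq_sum, Finset.sum_mul]
  exact Finset.sum_congr rfl fun p _ => coefAt_wedge j z (α p) ξ

/-- Only finitely many generators of bounded degree matter near a given point. -/
theorem finite_setOf_mem (z : B) (N : ℕ) : {j : GenIdx g | j.1 ≤ N ∧ z ∈ (g j.1).S j.2}.Finite := by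
  have h : ∀ q, {i : (g q).idx | z ∈ (g q).S i}.Finite := fun q =>
    (g q).locallyFinite.point_finite z
  refine ((Set.finite_Iic N).biUnion fun q _ => (h q).image (Sigma.mk q)).subset ?_
  rintro ⟨q, i⟩ ⟨hq, hi⟩
  exact mem_biUnion hq (mem_image_of_mem _ hi)

/-- A form is determined by its coefficients. -/
theorem eq_at_of_coefAt_apply {U' : Opens B} {z : B} {η : TotalForm E F V U}
    {η' : TotalForm E F V U'} {p q : ℕ} (h : ∀ i : (g q).idx,
      coefAt (⟨q, i⟩ : GenIdx g) z η p = coefAt (⟨q, i⟩ : GenIdx g) z η' p) :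
    (η (p, q)).1 z = (η' (p, q)).1 z := by
  have hf := (g q).locallyFinite.point_finite z
  have hJ : ∀ i, z ∈ (g q).S i → i ∈ hf.toFinset := fun i hi => by simpa using hi
  ext v
  rw [← (g q).sum_eq z _ hJ ((η (p, q)).1 z v), ← (g q).sum_eq z _ hJ ((η' (p, q)).1 z v)]
  refine Finset.sum_congr rfl fun i _ => ?_
  have h2 : (g q).σ i z ((η (p, q)).1 z v) = (g q).σ i z ((η' (p, q)).1 z v) :=
    DFunLike.congr_fun (h i) v
  rw [h2]

theorem eq_at_of_coefAt {U' : Opens B} {z : B} {η : TotalForm E F V U} {η' : TotalForm E F V U'}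
    (h : ∀ j : GenIdx g, coefAt j z η = coefAt j z η') (i : ℕ × ℕ) :
    (η i).1 z = (η' i).1 z :=
  eq_at_of_coefAt_apply fun _ => congrFun (h _) _

theorem coefAt_congr {U' : Opens B} {z : B} {η : TotalForm E F V U} {η' : TotalForm E F V U'}
    (h : ∀ i, (η i).1 z = (η' i).1 z) (j : GenIdx g) : coefAt j z η = coefAt j z η' := by
  ext1 p
  ext v
  rw [coefAt_apply, coefAt_apply, coefHom_apply, coefHom_apply, h]

theorem totalForm_ext {η η' : TotalForm E F V U} (h : ∀ z ∈ U, ∀ i, (η i).1 z = (η' i).1 z) :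
    η = η' := by
  refine DirectSum.ext_component ℂ fun i => Subtype.ext (funext fun z => ?_)
  by_cases hz : z ∈ U
  · exact h z hz i
  · exact ((η i).2.2 z hz).trans ((η' i).2.2 z hz).symm

theorem totalForm_ext_coefAt {η η' : TotalForm E F V U}
    (h : ∀ z ∈ U, ∀ j : GenIdx g, coefAt j z η = coefAt j z η') : η = η' :=
  totalForm_ext fun z hz => eq_at_of_coefAt (h z hz)

end Coefficients

/-! ### Locality of superconnections -/

section Locality

attribute [local instance] continuousSMul_real

open Filter Set Topology

set_option linter.unusedSectionVars false

universe uB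

variable {E : Type*} [NormedAddCommGroup E] [NormedSpace ℝ E] [FiniteDimensional ℝ E]
  {B : Type uB} [TopologicalSpace B] [T2Space B] [SecondCountableTopology B]
  [ChartedSpace E B] [IsManifold 𝓘(ℝ, E) ∞ B]
  {F : ℕ → Type*} [∀ q, NormedAddCommGroup (F q)] [∀ q, NormedSpace ℂ (F q)]
  {V : ℕ → B → Type*} [∀ q, TopologicalSpace (TotalSpace (F q) (V q))]
  [∀ q x, AddCommGroup (V q x)] [∀ q x, Module ℂ (V q x)] [∀ q x, TopologicalSpace (V q x)]
  [∀ q x, IsTopologicalAddGroup (V q x)] [∀ q x, ContinuousSMul ℂ (V q x)]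
  [∀ q, FiberBundle (F q) (V q)] [∀ q, VectorBundle ℂ (F q) (V q)]
  [∀ q, VectorBundle ℝ (F q) (V q)]
  {U : Opens B}

/-- A smooth function as a `0`-form on `U`. -/
def funForm (U : Opens B) (f : B → ℝ) (hf : ContMDiff 𝓘(ℝ, E) 𝓘(ℝ, ℝ) ∞ f) : ScalarForm E 0 U :=
  ⟨fun x => open Classical in if x ∈ U then (show FormFibre E (Bundle.Trivial B ℂ) 0 x from
      ContinuousAlternatingMap.constOfIsEmpty ℝ E (Fin 0) (f x : ℂ)) else 0, by
    refine ⟨?_, fun x hx => if_neg hx⟩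
    rw [isSmoothOn_iff]
    intro x₀ hx₀
    have h1 : ContMDiffAt 𝓘(ℝ, E) 𝓘(ℝ, ℂ) ∞ (fun x => (f x : ℂ)) x₀ :=
      Complex.ofRealCLM.contDiff.contMDiff.contMDiffAt.comp x₀ hf.contMDiffAt
    refine ((ContinuousAlternatingMap.constOfIsEmptyLIE ℝ E ℂ
      (Fin 0)).contDiff.contMDiff.contMDiffAt.comp x₀ h1).congr_of_eventuallyEq ?_
    filter_upwards [U.isOpen.mem_nhds hx₀] with x hx
    have hx' : x ∈ U := hx
    ext v
    rw [coordForm_trivial_apply]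
    have h2 : (open Classical in if x ∈ U then (show FormFibre E (Bundle.Trivial B ℂ) 0 x from
      ContinuousAlternatingMap.constOfIsEmpty ℝ E (Fin 0) (f x : ℂ)) else 0) =
      ContinuousAlternatingMap.constOfIsEmpty ℝ E (Fin 0) (f x : ℂ) := if_pos hx'
    exact congrArg (fun ζ : E [⋀^Fin 0]→L[ℝ] ℂ => ζ _) h2⟩

theorem funForm_apply {f : B → ℝ} (hf : ContMDiff 𝓘(ℝ, E) 𝓘(ℝ, ℝ) ∞ f) {x : B} (hx : x ∈ U) :
    (show E [⋀^Fin 0]→L[ℝ] ℂ from (funForm U f hf).1 x) =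
      ContinuousAlternatingMap.constOfIsEmpty ℝ E (Fin 0) (f x : ℂ) :=
  if_pos hx

theorem exists_bump {z : B} {W : Set B} (hW : W ∈ 𝓝 z) :
    ∃ f : B → ℝ, ContMDiff 𝓘(ℝ, E) 𝓘(ℝ, ℝ) ∞ f ∧ f =ᶠ[𝓝 z] 1 ∧ tsupport f ⊆ W := by
  obtain ⟨f, -, hf⟩ := (SmoothBumpFunction.nhds_basis_tsupport (I := 𝓘(ℝ, E)) z).mem_iff.1 hW
  exact ⟨f, f.contMDiff, f.eventuallyEq_one, hf⟩

theorem coefAt_wedge_funForm {g : ∀ q, Generators E (F q) (V q)} (j : GenIdx g) {z : B}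
    (hz : z ∈ U) {f : B → ℝ} (hf : ContMDiff 𝓘(ℝ, E) 𝓘(ℝ, ℝ) ∞ f) (η : TotalForm E F V U) :
    coefAt j z (TotalForm.wedge (funForm U f hf) η) = (f z : ℂ) • coefAt j z η := by
  rw [coefAt_wedge, funForm_apply hf hz]
  ext1 p
  rw [ExtAlg.mul_apply_of_left (fun p hp => ExtAlg.of_apply_of_ne hp.symm _), ExtAlg.of_apply_self]
  simp

/-- A superconnection does not increase supports. -/
theorem op_eq_zero_of_eventually (g : ∀ q, Generators E (F q) (V q)) (D : Superconnection E F V U)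
    {z : B} (hz : z ∈ U) {η : TotalForm E F V U} (h : ∀ᶠ x in 𝓝 z, ∀ i, (η i).1 x = 0)
    (i : ℕ × ℕ) : (D.op η i).1 z = 0 := by
  obtain ⟨f, hf, hf1, hfs⟩ := exists_bump (E := E) h
  have h0 : ∀ {x : B}, (∀ i, (η i).1 x = 0) → ∀ j : GenIdx g, coefAt j x η = 0 := by
    intro x hx j
    rw [coefAt_congr (η' := (0 : TotalForm E F V U)) hx j, map_zero]
  have h1 : TotalForm.wedge (funForm U f hf) η = 0 := by
    refine totalForm_ext_coefAt (g := g) fun x hx j => ?_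
    rw [coefAt_wedge_funForm j hx hf, map_zero]
    by_cases hxf : x ∈ tsupport f
    · rw [h0 (hfs hxf), smul_zero]
    · rw [image_eq_zero_of_notMem_tsupport hxf, Complex.ofReal_zero, zero_smul]
  have h2 := D.leibniz 0 (funForm U f hf) η
  rw [h1, map_zero, pow_zero, one_smul] at h2
  refine eq_at_of_coefAt (g := g) (η' := (0 : TotalForm E F V U)) (fun j => ?_) i
  have h3 := congrArg (coefAt j z) h2
  rw [map_add, coefAt_wedge, h0 h.self_of_nhds, mul_zero, zero_add, coefAt_wedge_funForm j hz hf,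
    hf1.self_of_nhds, map_zero] at h3
  simpa using h3.symm

/-- Superconnections are local. -/
theorem op_congr (g : ∀ q, Generators E (F q) (V q)) (D : Superconnection E F V U)
    {z : B} (hz : z ∈ U) {η η' : TotalForm E F V U}
    (h : ∀ᶠ x in 𝓝 z, ∀ i, (η i).1 x = (η' i).1 x) (i : ℕ × ℕ) :
    (D.op η i).1 z = (D.op η' i).1 z := by
  have h1 := op_eq_zero_of_eventually g D hz (η := η - η') (h.mono fun x hx i =>
    sub_eq_zero.2 (hx i)) i
  rw [map_sub] at h1
  exact sub_eq_zero.1 h1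

variable {g : ∀ q, Generators E (F q) (V q)}

/-- The Leibniz rule for an inhomogeneous scalar form. -/
theorem coefAt_op_wedgeInh (D : Superconnection E F V U) (j : GenIdx g) (z : B)
    (α : ∀ p, ScalarForm E p U) (ξ : TotalForm E F V U) :
    coefAt j z (D.op (wedgeInh α ξ)) = formVal (formD α) z * coefAt j z ξ +
      ExtAlg.eps (formVal α z) * coefAt j z (D.op ξ) := by
  have h0 : ExtAlg.eps (formVal α z) = ∑ p ∈ Finset.range (Module.finrank ℝ E + 1),
      ExtAlg.eps (ExtAlg.of p (formVal α z p)) := by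
    conv_lhs => rw [formVal_eq_sum α z]
    rw [map_sum]
  rw [wedgeInh, map_sum, map_sum, formVal_formD_eq_sum, h0, Finset.sum_mul,
    Finset.sum_mul, ← Finset.sum_add_distrib]
  refine Finset.sum_congr rfl fun p _ => ?_
  rw [D.leibniz, map_add, coefAt_wedge, map_smul, coefAt_wedge]
  congr 1
  have h1 : ExtAlg.eps (ExtAlg.of p (formVal α z p)) =
      (-1 : ℂ) ^ p • ExtAlg.of p (formVal α z p) := by
    ext1 r
    rw [ExtAlg.eps_apply, Pi.smul_apply]
    by_cases h : p = r
    · rw [h]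
    · rw [ExtAlg.of_apply_of_ne h]
      ext v
      simp
  rw [h1, ← ExtAlg.neg_one_pow_mul, ← ExtAlg.neg_one_pow_mul, mul_assoc]
  rfl

/-- The generating section with index `j` as a form on `U`. -/
def genForm (U : Opens B) (j : GenIdx g) : TotalForm E F V U :=
  DirectSum.lof ℂ (ℕ × ℕ) (fun i => Form E (F i.2) (V i.2) i.1 U) (0, j.1)
    (Form.restrict le_top ((g j.1).s j.2))

theorem genForm_mem_degreePart (j : GenIdx g) : genForm U j ∈
    degreePart totalDegree (fun i => Form E (F i.2) (V i.2) i.1 U) j.1 := by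
  intro i hi
  rw [genForm, DirectSum.lof_eq_of, DirectSum.of_eq_of_ne]
  rintro rfl
  exact hi (zero_add j.1)

theorem coefAt_genForm_of_ne {i j : GenIdx g} (h : i.1 ≠ j.1) (z : B) :
    coefAt j z (genForm U i) = 0 :=
  coefAt_lof_of_ne h z _

theorem coefAt_genForm_self {q : ℕ} (i j : (g q).idx) {z : B} (hz : z ∈ U) :
    coefAt (g := g) ⟨q, j⟩ z (genForm U (⟨q, i⟩ : GenIdx g)) =
      ExtAlg.const ((g q).σ j z (((g q).s i).1 z ![])) := by
  refine (coefAt_lof_self j z _).trans (congrArg (ExtAlg.of 0) ?_)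
  ext v
  rw [coefHom_apply]
  have h1 : (Form.restrict (le_top : U ≤ ⊤) ((g q).s i)).1 z = ((g q).s i).1 z := if_pos hz
  rw [h1, Subsingleton.elim v ![]]
  rfl

theorem coefAt_genForm_apply_of_ne (i j : GenIdx g) {z : B} (hz : z ∈ U) {p : ℕ} (hp : p ≠ 0) :
    coefAt j z (genForm U i) p = 0 := by
  by_cases h : i.1 = j.1
  · obtain ⟨q, i⟩ := i
    obtain ⟨q', j⟩ := j
    obtain rfl : q = q' := h
    rw [coefAt_genForm_self i j hz]
    exact ExtAlg.of_apply_of_ne hp.symm _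
  · rw [coefAt_genForm_of_ne h]
    rfl

/-- The finite set `J` of generators contains all those of degree at most `N` that are relevant
at `z`. -/
def CompleteAt (J : Finset (GenIdx g)) (N : ℕ) (z : B) : Prop :=
  ∀ j : GenIdx g, j.1 ≤ N → z ∈ (g j.1).S j.2 → j ∈ J

theorem CompleteAt.eventually {J : Finset (GenIdx g)} {N : ℕ} {z : B} (h : CompleteAt J N z) :
    ∀ᶠ x in 𝓝 z, CompleteAt J N x := by
  have h1 : ∀ᶠ x in 𝓝 z, ∀ q ∈ Set.Iic N, {i | x ∈ (g q).S i} ⊆ {i | z ∈ (g q).S i} := by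
    rw [(Set.finite_Iic N).eventually_all]
    exact fun q _ => (g q).locallyFinite.eventually_subset (g q).isClosed z
  filter_upwards [h1] with x hx j hj hxj
  exact h j hj (hx j.1 hj hxj)

/-- The coefficients of a form are reproduced by the projection matrix whose entries are the
coefficients of the generators. -/
theorem sum_coefAt_mul {J : Finset (GenIdx g)} {N : ℕ} {z : B} (hz : z ∈ U)
    (hJ : CompleteAt J N z) {η : TotalForm E F V U} (hη : ∀ i : ℕ × ℕ, N < i.2 → η i = 0)
    (j : GenIdx g) :
    ∑ i ∈ J, coefAt i z η * coefAt j z (genForm U i) = coefAt j z η := by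
  classical
  obtain ⟨q, j⟩ := j
  rw [← Finset.sum_preimage (Sigma.mk q) J sigma_mk_injective.injOn _ fun i _ hi => by
    rw [coefAt_genForm_of_ne fun h : i.1 = q => hi ⟨h ▸ i.2, by cases i; cases h; rfl⟩, mul_zero]]
  ext p v
  rw [ExtAlg.sum_apply, coefAt_apply, coefHom_apply, ContinuousAlternatingMap.sum_apply]
  have h1 : ∀ i : (g q).idx, (coefAt (⟨q, i⟩ : GenIdx g) z η *
      coefAt (⟨q, j⟩ : GenIdx g) z (genForm U (⟨q, i⟩ : GenIdx g))) p v =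
      (g q).σ j z ((g q).σ i z ((η (p, q)).1 z v) • ((g q).s i).1 z ![]) := by
    intro i
    rw [coefAt_genForm_self i j hz,
      ExtAlg.mul_apply_of_right (coefAt (⟨q, i⟩ : GenIdx g) z η) (a := ExtAlg.const _)
        (fun p hp => ExtAlg.of_apply_of_ne hp.symm _), (g q).σ_smul]
    simp [ExtAlg.const, coefAt_apply, coefHom_apply, mul_comm]
  simp only [h1]
  rw [← map_sum]
  by_cases hq : q ≤ N
  · rw [(g q).sum_eq z _ fun i hi => by simpa using hJ ⟨q, i⟩ hq hi]
  · rw [hη (p, q) (not_le.1 hq)]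
    change _ = (g q).σ j z (0 : V q z)
    refine congrArg _ (Finset.sum_eq_zero fun i _ => ?_)
    refine (congrArg (· • _) (map_zero ((g q).σ i z))).trans (zero_smul ℂ _)

theorem eventually_eq_sum_wedgeInh {J : Finset (GenIdx g)} {N : ℕ} {z : B} (hz : z ∈ U)
    (hJ : CompleteAt J N z) {η : TotalForm E F V U} (hη : ∀ i : ℕ × ℕ, N < i.2 → η i = 0) :
    ∀ᶠ x in 𝓝 z, ∀ i, (η i).1 x = ((∑ k ∈ J, wedgeInh (coef k η) (genForm U k)) i).1 x := by
  filter_upwards [hJ.eventually, U.isOpen.mem_nhds hz] with x hx hxU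
  refine eq_at_of_coefAt (g := g) fun j => ?_
  rw [map_sum, ← sum_coefAt_mul hxU hx hη]
  exact Finset.sum_congr rfl fun k _ => by rw [coefAt_wedgeInh, formVal_coef]

theorem coefAt_op_of_eventuallyEq (D : Superconnection E F V U) {z : B} (hz : z ∈ U)
    {J : Finset (GenIdx g)} {α : GenIdx g → ∀ p, ScalarForm E p U} {η : TotalForm E F V U}
    (h : ∀ᶠ x in 𝓝 z, ∀ i, (η i).1 x = ((∑ k ∈ J, wedgeInh (α k) (genForm U k)) i).1 x)
    (j : GenIdx g) :
    coefAt j z (D.op η) = ∑ k ∈ J, (formVal (formD (α k)) z * coefAt j z (genForm U k) +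
      ExtAlg.eps (formVal (α k) z) * coefAt j z (D.op (genForm U k))) := by
  rw [coefAt_congr (op_congr g D hz h) j, map_sum, map_sum]
  exact Finset.sum_congr rfl fun k _ => coefAt_op_wedgeInh D j z (α k) _

/-- The superconnection in terms of the coefficients with respect to the generators. -/
theorem coefAt_op (D : Superconnection E F V U) {J : Finset (GenIdx g)} {N : ℕ} {z : B}
    (hz : z ∈ U) (hJ : CompleteAt J N z) {η : TotalForm E F V U}
    (hη : ∀ i : ℕ × ℕ, N < i.2 → η i = 0) (j : GenIdx g) :
    coefAt j z (D.op η) = ∑ k ∈ J, (formVal (formD (coef k η)) z * coefAt j z (genForm U k) +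
      ExtAlg.eps (coefAt k z η) * coefAt j z (D.op (genForm U k))) :=
  coefAt_op_of_eventuallyEq D hz (eventually_eq_sum_wedgeInh hz hJ hη) j

theorem op_genForm_apply (D : Superconnection E F V U) (j : GenIdx g) {i : ℕ × ℕ}
    (hi : i.1 + i.2 ≠ j.1 + 1) : D.op (genForm U j) i = 0 :=
  D.degree_one j.1 _ (genForm_mem_degreePart j) i hi

end Locality

/-! ### Restriction of superconnections to open sets -/

section Restriction

attribute [local instance] continuousSMul_real

open Filter Set Topology

set_option linter.unusedSectionVars false

universe uB

variable {E : Type*} [NormedAddCommGroup E] [NormedSpace ℝ E] [FiniteDimensional ℝ E]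
  {B : Type uB} [TopologicalSpace B] [T2Space B] [SecondCountableTopology B]
  [ChartedSpace E B] [IsManifold 𝓘(ℝ, E) ∞ B]
  {F : ℕ → Type*} [∀ q, NormedAddCommGroup (F q)] [∀ q, NormedSpace ℂ (F q)]
  {V : ℕ → B → Type*} [∀ q, TopologicalSpace (TotalSpace (F q) (V q))]
  [∀ q x, AddCommGroup (V q x)] [∀ q x, Module ℂ (V q x)] [∀ q x, TopologicalSpace (V q x)]
  [∀ q x, IsTopologicalAddGroup (V q x)] [∀ q x, ContinuousSMul ℂ (V q x)]
  [∀ q, FiberBundle (F q) (V q)] [∀ q, VectorBundle ℂ (F q) (V q)]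
  [∀ q, VectorBundle ℝ (F q) (V q)]
  {U : Opens B}

/-- Locally given `V`-valued forms that fit together define a form on `U`. -/
theorem exists_totalForm (s : Finset (ℕ × ℕ)) (val : ∀ (i : ℕ × ℕ) (x : B),
      FormFibre E (V i.2) i.1 x) (h0 : ∀ i ∉ s, ∀ z ∈ U, val i z = 0)
    (h : ∀ z ∈ U, ∃ W : Opens B, z ∈ W ∧ ∃ ξ : TotalForm E F V W,
      ∀ᶠ x in 𝓝 z, ∀ i, val i x = (ξ i).1 x) :
    ∃ η : TotalForm E F V U, ∀ z ∈ U, ∀ i, (η i).1 z = val i z := by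
  classical
  have h1 : ∀ i, IsSmoothOn (F i.2) (V i.2) (fun x => if x ∈ U then val i x else 0) U := by
    intro i
    rw [isSmoothOn_iff]
    intro x₀ hx₀
    obtain ⟨W, hW, ξ, hξ⟩ := h x₀ hx₀
    refine (Form.contMDiffAt (ξ i) hW).congr_of_eventuallyEq ?_
    filter_upwards [U.isOpen.mem_nhds hx₀, hξ] with x hx hx1
    have hx' : x ∈ U := hx
    simp only [coordForm, if_pos hx', hx1]
  refine ⟨DirectSum.mk (fun i : ℕ × ℕ => Form E (F i.2) (V i.2) i.1 U) s
    fun i => ⟨_, h1 i, fun x hx => if_neg hx⟩, fun z hz i => ?_⟩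
  by_cases hi : i ∈ s
  · rw [DirectSum.mk_apply_of_mem hi]
    exact if_pos hz
  · rw [DirectSum.mk_apply_of_notMem hi, h0 i hi z hz]
    rfl

/-- Multiplication of forms on `U` by a smooth function supported in `U`, followed by extension
by zero. -/
def Form.extend {F' : Type*} [NormedAddCommGroup F'] [NormedSpace ℂ F'] {V' : B → Type*}
    [TopologicalSpace (TotalSpace F' V')] [∀ x, AddCommGroup (V' x)] [∀ x, Module ℂ (V' x)]
    [∀ x, TopologicalSpace (V' x)] [∀ x, IsTopologicalAddGroup (V' x)]
    [∀ x, ContinuousSMul ℂ (V' x)] [FiberBundle F' V'] [VectorBundle ℂ F' V']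
    [VectorBundle ℝ F' V'] {f : B → ℝ} (hf : ContMDiff 𝓘(ℝ, E) 𝓘(ℝ, ℝ) ∞ f)
    (hfs : tsupport f ⊆ U) (p : ℕ) : Form E F' V' p U →ₗ[ℂ] Form E F' V' p (⊤ : Opens B) where
  toFun ξ := ⟨fun x => (f x : ℂ) • ξ.1 x, by
    refine ⟨?_, fun x hx => (hx trivial).elim⟩
    rw [isSmoothOn_iff]
    intro x₀ _
    by_cases hx₀ : x₀ ∈ U
    · have h1 : ContMDiffAt 𝓘(ℝ, E) 𝓘(ℝ, E [⋀^Fin p]→L[ℝ] F') ∞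
          (fun x => f x • coordForm F' V' x₀ ξ.1 x) x₀ :=
        hf.contMDiffAt.smul (Form.contMDiffAt ξ hx₀)
      refine h1.congr_of_eventuallyEq (.of_forall fun x => ?_)
      ext v
      exact trivialization_map_smul F' V' x₀ x (f x : ℂ) _
    · have h1 : x₀ ∉ tsupport f := fun h => hx₀ (hfs h)
      refine (contMDiffAt_const (c := 0)).congr_of_eventuallyEq ?_
      filter_upwards [notMem_tsupport_iff_eventuallyEq.1 h1] with x hx
      ext v
      rw [coordForm_apply, hx]
      simp⟩
  map_add' ξ ξ' := Subtype.ext (funext fun x => smul_add _ _ _)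
  map_smul' c ξ := Subtype.ext (funext fun x => smul_comm (f x : ℂ) c (ξ.1 x))

/-- A form on `U` agrees near a given point of `U` with a form on all of `B`. -/
theorem TotalForm.exists_extension (η : TotalForm E F V U) {z : B} (hz : z ∈ U) :
    ∃ ζ : TotalForm E F V (⊤ : Opens B), (∀ i, η i = 0 → ζ i = 0) ∧
      ∀ᶠ x in 𝓝 z, ∀ i, (ζ i).1 x = (η i).1 x := by
  obtain ⟨f, hf, hf1, hfs⟩ := exists_bump (E := E) (U.isOpen.mem_nhds hz)
  refine ⟨DirectSum.lmap (fun i : ℕ × ℕ => Form.extend hf hfs i.1) η, fun i hi => ?_, ?_⟩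
  · rw [DirectSum.lmap_apply, hi, map_zero]
  · filter_upwards [hf1] with x hx i
    rw [DirectSum.lmap_apply]
    change (f x : ℂ) • (η i).1 x = (η i).1 x
    rw [hx, Pi.one_apply, Complex.ofReal_one, one_smul]

theorem op_apply_eq_zero (D : Superconnection E F V U) {η : TotalForm E F V U} {i : ℕ × ℕ}
    (h : ∀ k : ℕ × ℕ, k.1 + k.2 + 1 = i.1 + i.2 → η k = 0) : D.op η i = 0 := by
  classical
  rw [← DirectSum.sum_support_of η, map_sum, DFinsupp.finsetSum_apply]
  refine Finset.sum_eq_zero fun k _ => ?_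
  by_cases hk : k.1 + k.2 + 1 = i.1 + i.2
  · rw [h k hk, map_zero, map_zero]
    rfl
  · refine D.degree_one (k.1 + k.2) _ ?_ i (fun h => hk h.symm)
    intro l hl
    exact DirectSum.of_eq_of_ne _ _ _ fun h => hl (h ▸ rfl)

theorem ScalarForm.d_apply {k : ℕ} (α : ScalarForm E k U) {z : B} (hz : z ∈ U) :
    (ScalarForm.d α).1 z = extDerivAt α.1 z := if_pos hz

theorem extDerivAt_congr {k : ℕ} {α β : ∀ x : B, FormFibre E (Bundle.Trivial B ℂ) k x} {z : B}
    (h : ∀ᶠ x in 𝓝 z, α x = β x) : extDerivAt α z = extDerivAt β z := by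
  refine Filter.EventuallyEq.extDeriv_eq ?_
  have h1 := continuousAt_extChartAt_symm (I := 𝓘(ℝ, E)) z
  rw [ContinuousAt, extChartAt_to_inv] at h1
  filter_upwards [h1 h] with y hy
  simp only [mem_preimage, mem_ofPred_eq] at hy
  simp only [coordForm, hy]

/-- The restriction of `D` to `U` applied to `η`: near every point, extend `η` to `B` and apply `D`. By
locality the result does not depend on the extension. -/
theorem exists_local_op (g : ∀ q, Generators E (F q) (V q))
    (D : Superconnection E F V (⊤ : Opens B)) (η : TotalForm E F V U) :
    ∃ θ : TotalForm E F V U, ∀ ζ : TotalForm E F V (⊤ : Opens B), ∀ z ∈ U,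
      (∀ᶠ x in 𝓝 z, ∀ i, (ζ i).1 x = (η i).1 x) → ∀ i, (θ i).1 z = (D.op ζ i).1 z := by
  classical
  choose! ζ hζ0 hζ using fun (z : B) (hz : z ∈ U) => TotalForm.exists_extension η hz
  have hc : ∀ z ∈ U, ∀ ζ' : TotalForm E F V (⊤ : Opens B),
      (∀ᶠ x in 𝓝 z, ∀ i, (ζ' i).1 x = (η i).1 x) → ∀ i,
        (D.op (ζ z) i).1 z = (D.op ζ' i).1 z := by
    intro z hz ζ' h i
    refine op_congr g D trivial ?_ i
    filter_upwards [hζ z hz, h] with x hx hx' i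
    rw [hx, hx']
  obtain ⟨θ, hθ⟩ := exists_totalForm (U := U) (F := F)
    ((DFinsupp.support η).biUnion fun k => Finset.HasAntidiagonal.antidiagonal (k.1 + k.2 + 1))
    (fun i z => (D.op (ζ z) i).1 z) (by
      intro i hi z hz
      have hη : D.op (ζ z) i = 0 := by
        refine op_apply_eq_zero D fun k hk => hζ0 z hz k ?_
        by_contra hne
        exact hi (Finset.mem_biUnion.2 ⟨k, DFinsupp.mem_support_iff.2 hne,
          Finset.HasAntidiagonal.mem_antidiagonal.2 hk.symm⟩)
      exact congrArg (fun ξ : Form E (F i.2) (V i.2) i.1 (⊤ : Opens B) => ξ.1 z) hη)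
    (fun z hz => ⟨⊤, trivial, D.op (ζ z), by
      filter_upwards [(hζ z hz).eventually_nhds, U.isOpen.mem_nhds hz] with x hx hxU i
      exact hc x hxU _ hx i⟩)
  exact ⟨θ, fun ζ' z hz h i => (hθ z hz i).trans (hc z hz ζ' h i)⟩

theorem TotalForm.add_apply_apply (η η' : TotalForm E F V U) (i : ℕ × ℕ) (x : B) :
    ((η + η') i).1 x = (η i).1 x + (η' i).1 x := rfl

theorem TotalForm.smul_apply_apply (c : ℂ) (η : TotalForm E F V U) (i : ℕ × ℕ) (x : B) :
    ((c • η) i).1 x = c • (η i).1 x := rfl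

/-- The restriction of a superconnection to an open set, characterized by its locality. -/
theorem exists_restriction (g : ∀ q, Generators E (F q) (V q))
    (D : Superconnection E F V (⊤ : Opens B)) (U : Opens B) :
    ∃ DU : Superconnection E F V U, ∀ (η : TotalForm E F V U) (ζ : TotalForm E F V (⊤ : Opens B)),
      ∀ z ∈ U, (∀ᶠ x in 𝓝 z, ∀ i, (ζ i).1 x = (η i).1 x) →
        ∀ i, (DU.op η i).1 z = (D.op ζ i).1 z := by
  choose op hop using fun η : TotalForm E F V U => exists_local_op g D η
  have hdeg : ∀ n, ∀ η ∈ degreePart totalDegree (fun i => Form E (F i.2) (V i.2) i.1 U) n,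
      ∀ i, totalDegree i ≠ n + 1 → op η i = 0 := by
    intro n η hη i hi
    have h2 : ∀ z ∈ U, (op η i).1 z = 0 := by
      intro z hz
      obtain ⟨ζ, hζ0, hζ⟩ := TotalForm.exists_extension η hz
      have h0 : D.op ζ i = 0 := by
        refine op_apply_eq_zero D fun k hk => hζ0 k (hη k fun h => hi ?_)
        rw [totalDegree] at h ⊢
        rw [← hk, h]
      rw [hop η ζ z hz hζ i, h0]
      rfl
    refine Subtype.ext (funext fun z => ?_)
    by_cases hz : z ∈ U
    · exact h2 z hz
    · exact (op η i).2.2 z hz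
  have hadd : ∀ η η', op (η + η') = op η + op η' := by
    intro η η'
    refine totalForm_ext_coefAt (g := g) fun z hz j => ?_
    obtain ⟨ζ, -, hζ⟩ := TotalForm.exists_extension η hz
    obtain ⟨ζ', -, hζ'⟩ := TotalForm.exists_extension η' hz
    have h1 : ∀ᶠ x in 𝓝 z, ∀ i, ((ζ + ζ') i).1 x = ((η + η') i).1 x := by
      filter_upwards [hζ, hζ'] with x hx hx' i
      rw [TotalForm.add_apply_apply, TotalForm.add_apply_apply, hx, hx']
    rw [map_add, coefAt_congr (hop _ _ z hz h1), coefAt_congr (hop _ _ z hz hζ),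
      coefAt_congr (hop _ _ z hz hζ'), map_add, map_add]
  have hsmul : ∀ (c : ℂ) η, op (c • η) = c • op η := by
    intro c η
    refine totalForm_ext_coefAt (g := g) fun z hz j => ?_
    obtain ⟨ζ, -, hζ⟩ := TotalForm.exists_extension η hz
    have h1 : ∀ᶠ x in 𝓝 z, ∀ i, ((c • ζ) i).1 x = ((c • η) i).1 x := by
      filter_upwards [hζ] with x hx i
      rw [TotalForm.smul_apply_apply, TotalForm.smul_apply_apply, hx]
    rw [map_smul, coefAt_congr (hop _ _ z hz h1), coefAt_congr (hop _ _ z hz hζ),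
      map_smul, map_smul]
  have hleib : ∀ (k : ℕ) (α : ScalarForm E k U) (η : TotalForm E F V U), op (TotalForm.wedge α η) =
      TotalForm.wedge (ScalarForm.d α) η + (-1 : ℂ) ^ k • TotalForm.wedge α (op η) := by
    intro k α η
    refine totalForm_ext_coefAt (g := g) fun z hz j => ?_
    obtain ⟨ζ, -, hζ⟩ := TotalForm.exists_extension η hz
    obtain ⟨f, hf, hf1, hfs⟩ := exists_bump (E := E) (U.isOpen.mem_nhds hz)
    let β : ScalarForm E k (⊤ : Opens B) := Form.extend hf hfs k α
    have hβ : ∀ᶠ x in 𝓝 z, β.1 x = α.1 x := by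
      filter_upwards [hf1] with x hx
      change (f x : ℂ) • α.1 x = α.1 x
      rw [hx, Pi.one_apply, Complex.ofReal_one, one_smul]
    have h1 : ∀ᶠ x in 𝓝 z, ∀ i,
        (TotalForm.wedge β ζ i).1 x = (TotalForm.wedge α η i).1 x := by
      filter_upwards [hβ, hζ] with x hx hx'
      refine eq_at_of_coefAt (g := g) fun j => ?_
      rw [coefAt_wedge, coefAt_wedge, hx, coefAt_congr hx']
    have h2 : coefAt j z (op (TotalForm.wedge α η)) = coefAt j z (D.op (TotalForm.wedge β ζ)) :=
      coefAt_congr (hop _ _ z hz h1) j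
    have h3 : coefAt j z (op η) = coefAt j z (D.op ζ) := coefAt_congr (hop _ _ z hz hζ) j
    have h4 : (ScalarForm.d β).1 z = (ScalarForm.d α).1 z := by
      rw [ScalarForm.d_apply _ hz, ScalarForm.d_apply β (U := ⊤) trivial]
      exact extDerivAt_congr hβ
    refine h2.trans ?_
    rw [D.leibniz, map_add, map_add, map_smul, map_smul, coefAt_wedge, coefAt_wedge, coefAt_wedge,
      coefAt_wedge, h4, hβ.self_of_nhds]
    rw [coefAt_congr hζ.self_of_nhds j, h3]
  exact ⟨⟨⟨⟨op, hadd⟩, hsmul⟩, hdeg, hleib⟩, hop⟩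

theorem TotalForm.restrict_apply {W : Opens B} (h : U ≤ W) (η : TotalForm E F V W) (i : ℕ × ℕ)
    {x : B} (hx : x ∈ U) : (TotalForm.restrict h η i).1 x = (η i).1 x := by
  rw [TotalForm.restrict, DirectSum.lmap_apply]
  exact if_pos hx

theorem Superconnection.ext_op {D D' : Superconnection E F V U} (h : ∀ η, D.op η = D'.op η) :
    D = D' := by
  obtain ⟨op, _, _⟩ := D
  obtain ⟨op', _, _⟩ := D'
  obtain rfl : op = op' := LinearMap.ext h
  rfl

/-- A superconnection restricts uniquely to open sets. The last clause, the locality of the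
restriction, computes it without extending forms from `U` to `B`. -/
theorem exists_unique_restrictsTo (g : ∀ q, Generators E (F q) (V q))
    (D : Superconnection E F V (⊤ : Opens B)) (hD : D.IsFlat) (U : Opens B) :
    ∃ DU : Superconnection E F V U, (D.RestrictsTo le_top DU ∧
      ∀ DU' : Superconnection E F V U, D.RestrictsTo le_top DU' → DU' = DU) ∧ DU.IsFlat ∧
      ∀ (η : TotalForm E F V U) (ζ : TotalForm E F V (⊤ : Opens B)),
        ∀ z ∈ U, (∀ᶠ x in 𝓝 z, ∀ i, (ζ i).1 x = (η i).1 x) →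
          ∀ i, (DU.op η i).1 z = (D.op ζ i).1 z := by
  obtain ⟨DU, h⟩ := exists_restriction g D U
  refine ⟨DU, ⟨fun η => totalForm_ext fun z hz i => ?_, fun DU' h' => ?_⟩, ?_, h⟩
  · rw [TotalForm.restrict_apply le_top _ _ hz]
    refine h _ _ z hz ?_ i
    filter_upwards [U.isOpen.mem_nhds hz] with x hx i
    rw [TotalForm.restrict_apply le_top _ _ hx]
  · refine Superconnection.ext_op fun η => totalForm_ext fun z hz i => ?_
    obtain ⟨ζ, -, hζ⟩ := TotalForm.exists_extension η hz
    rw [h η ζ z hz hζ, op_congr g DU' hz (η' := TotalForm.restrict le_top ζ), h',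
      TotalForm.restrict_apply le_top _ _ hz]
    filter_upwards [hζ, U.isOpen.mem_nhds hz] with x hx hxU i
    rw [TotalForm.restrict_apply le_top _ _ hxU, hx]
  · refine LinearMap.ext fun η => totalForm_ext fun z hz i => ?_
    obtain ⟨ζ, -, hζ⟩ := TotalForm.exists_extension η hz
    have h1 : D.op (D.op ζ) = 0 := LinearMap.congr_fun hD ζ
    refine (h (DU.op η) (D.op ζ) z hz ?_ i).trans ?_
    · filter_upwards [hζ.eventually_nhds, U.isOpen.mem_nhds hz] with x hx hxU i
      exact (h η ζ x hxU hx i).symm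
    · rw [h1]
      rfl

end Restriction

/-! ### The endomorphism of form degree zero -/

section DegreeZero

attribute [local instance] continuousSMul_real

open Filter Set Topology

set_option linter.unusedSectionVars false

universe uB

variable {E : Type*} [NormedAddCommGroup E] [NormedSpace ℝ E] [FiniteDimensional ℝ E]
  {B : Type uB} [TopologicalSpace B] [T2Space B] [SecondCountableTopology B]
  [ChartedSpace E B] [IsManifold 𝓘(ℝ, E) ∞ B]
  {F : ℕ → Type*} [∀ q, NormedAddCommGroup (F q)] [∀ q, NormedSpace ℂ (F q)]
  {V : ℕ → B → Type*} [∀ q, TopologicalSpace (TotalSpace (F q) (V q))]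
  [∀ q x, AddCommGroup (V q x)] [∀ q x, Module ℂ (V q x)] [∀ q x, TopologicalSpace (V q x)]
  [∀ q x, IsTopologicalAddGroup (V q x)] [∀ q x, ContinuousSMul ℂ (V q x)]
  [∀ q, FiberBundle (F q) (V q)] [∀ q, VectorBundle ℂ (F q) (V q)]
  [∀ q, VectorBundle ℝ (F q) (V q)]
  {U : Opens B}

theorem ExtAlg.mul_apply_zero {T : Type*} [NormedAddCommGroup T] [NormedSpace ℝ T]
    (a b : ExtAlg T) : (a * b) 0 ![] = a 0 ![] * b 0 ![] := by
  rw [ExtAlg.mul_apply, Finset.Nat.antidiagonal_zero, Finset.sum_singleton,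
    wedge_zero_left]
  simp

variable {g : ∀ q, Generators E (F q) (V q)}

theorem Generators.eq_of_σ {q : ℕ} {x : B} {v w : V q x}
    (h : ∀ i, (g q).σ i x v = (g q).σ i x w) : v = w := by
  have hf := (g q).locallyFinite.point_finite x
  have hJ : ∀ i, x ∈ (g q).S i → i ∈ hf.toFinset := fun i hi => by simpa using hi
  rw [← (g q).sum_eq x _ hJ v, ← (g q).sum_eq x _ hJ w]
  exact Finset.sum_congr rfl fun i _ => by rw [h]

/-- The generators span every fibre. -/
theorem exists_section (g : ∀ q, Generators E (F q) (V q)) {q : ℕ} {x : B} (v : V q x) :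
    ∃ s : Form E (F q) (V q) 0 (⊤ : Opens B), s.1 x ![] = v := by
  have hf := (g q).locallyFinite.point_finite x
  have hJ : ∀ i, x ∈ (g q).S i → i ∈ hf.toFinset := fun i hi => by simpa using hi
  refine ⟨∑ i ∈ hf.toFinset, (g q).σ i x v • (g q).s i, ?_⟩
  conv_rhs => rw [← (g q).sum_eq x _ hJ v]
  change Form.evalPoint x 0 _ = _
  rw [map_sum]
  exact Finset.sum_congr rfl fun i _ => map_smul _ _ _

/-- The coefficient functional of a generator as a complex linear map. -/
def Generators.σℂ {q : ℕ} (i : (g q).idx) (x : B) : V q x →ₗ[ℂ] ℂ where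
  toFun := (g q).σ i x
  map_add' := map_add _
  map_smul' := (g q).σ_smul i x

/-- The endomorphism `A₀`, computed with the generators. -/
def degreeZeroPart (g : ∀ q, Generators E (F q) (V q)) (D : Superconnection E F V (⊤ : Opens B))
    (q : ℕ) (x : B) : V q x →ₗ[ℂ] V (q + 1) x :=
  -∑ k ∈ ((g q).locallyFinite.point_finite x).toFinset, (Generators.σℂ (g := g) k x).smulRight
    ((D.op (genForm ⊤ (⟨q, k⟩ : GenIdx g)) (0, q + 1)).1 x ![])

theorem exists_completeAt (g : ∀ q, Generators E (F q) (V q)) (N : ℕ) (z : B) :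
    ∃ J : Finset (GenIdx g), CompleteAt J N z :=
  ⟨(finite_setOf_mem z N).toFinset, fun j hj hz => by simpa using ⟨hj, hz⟩⟩

theorem exists_degree_bound (η : TotalForm E F V U) : ∃ N, ∀ i : ℕ × ℕ, N < i.2 → η i = 0 := by
  classical
  refine ⟨(DFinsupp.support η).sup Prod.snd, fun i hi => ?_⟩
  by_contra hne
  exact absurd (Finset.le_sup (f := Prod.snd) (DFinsupp.mem_support_iff.2 hne)) (not_le.2 hi)

/-- The component of form degree `0` of `D η` is `-A₀` applied to that of `η`: the other terms in
`coefAt_op` have a factor of positive form degree. -/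
theorem op_apply_zero (D : Superconnection E F V (⊤ : Opens B))
    (η : TotalForm E F V (⊤ : Opens B)) (q : ℕ) (x : B) :
    (D.op η (0, q + 1)).1 x ![] = -degreeZeroPart g D q x ((η (0, q)).1 x ![]) := by
  classical
  obtain ⟨N, hN⟩ := exists_degree_bound η
  obtain ⟨J, hJ⟩ := exists_completeAt g (max N q) x
  refine Generators.eq_of_σ (g := g) fun i => ?_
  have h1 := coefAt_op D trivial hJ (fun i hi => hN i ((le_max_left _ _).trans_lt hi)) ⟨q + 1, i⟩
  have h2 := congrArg (fun a : ExtAlg E => a 0 ![]) h1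
  simp only [ExtAlg.sum_apply, Pi.add_apply, ContinuousAlternatingMap.sum_apply,
    ContinuousAlternatingMap.add_apply, ExtAlg.mul_apply_zero, ExtAlg.eps_apply] at h2
  refine h2.trans ?_
  have h0 : ∀ k : GenIdx g, formVal (formD (coef k η)) x 0 ![] = 0 := fun k => rfl
  have h3 : ∀ k : GenIdx g, k ∉ Set.range (Sigma.mk q) →
      coefAt (⟨q + 1, i⟩ : GenIdx g) x (D.op (genForm ⊤ k)) 0 ![] = 0 := by
    intro k hk
    have hne : k.1 ≠ q := by
      rintro rfl
      exact hk ⟨k.2, rfl⟩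
    rw [coefAt_apply, op_genForm_apply D k (by simpa [eq_comm] using hne), map_zero]
    rfl
  simp only [h0, zero_mul, zero_add, pow_zero, one_smul]
  rw [← Finset.sum_preimage (Sigma.mk q) J sigma_mk_injective.injOn _ fun k _ hk => by
    rw [h3 k hk, mul_zero], degreeZeroPart, LinearMap.neg_apply, neg_neg, LinearMap.sum_apply,
    map_sum]
  symm
  refine (Finset.sum_subset (fun k hk => ?_) fun k _ hk => ?_).trans
    (Finset.sum_congr rfl fun k _ => ?_)
  · exact Finset.mem_preimage.2 (hJ _ (le_max_right _ _) (by simpa using hk))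
  · rw [LinearMap.smulRight_apply, (g (q + 1)).σ_smul]
    have h4 : Generators.σℂ (g := g) k x ((η (0, q)).1 x ![]) = 0 := by
      change (g q).σ k x _ = 0
      rw [(g q).σ_eq_zero k x (by simpa using hk)]
      rfl
    rw [h4, zero_smul]
  · rw [LinearMap.smulRight_apply, (g (q + 1)).σ_smul]
    rfl

theorem hasDegreeZeroPart_degreeZeroPart (g : ∀ q, Generators E (F q) (V q))
    (D : Superconnection E F V (⊤ : Opens B)) : D.HasDegreeZeroPart (degreeZeroPart g D) := by
  intro q s x
  rw [op_apply_zero (g := g), DirectSum.lof_apply]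

theorem HasDegreeZeroPart.eq (g : ∀ q, Generators E (F q) (V q))
    {D : Superconnection E F V (⊤ : Opens B)}
    {A A' : ∀ (q : ℕ) (x : B), V q x →ₗ[ℂ] V (q + 1) x} (hA : D.HasDegreeZeroPart A)
    (hA' : D.HasDegreeZeroPart A') : A = A' := by
  funext q x
  ext v
  obtain ⟨s, rfl⟩ := exists_section g v
  exact neg_injective ((hA q s x).symm.trans (hA' q s x))

theorem Form.evalPoint_apply_zero {q : ℕ} (x : B) (ξ : Form E (F q) (V q) 0 U) :
    Form.evalPoint x 0 ξ = ξ.1 x ![] := rfl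

theorem evalPoint_apply (x : B) (η : TotalForm E F V U) (q : ℕ) :
    TotalForm.evalPoint x η q = (η (0, q)).1 x ![] := by
  classical
  induction η using DirectSum.induction_on with
  | zero => rw [map_zero]; rfl
  | add η η' h h' =>
    rw [map_add, DirectSum.add_apply, h, h']
    rfl
  | of i ξ =>
    obtain ⟨p, r⟩ := i
    rw [← DirectSum.lof_eq_of ℂ, TotalForm.evalPoint, DirectSum.toModule_lof, LinearMap.comp_apply]
    by_cases hr : r = q
    · subst hr
      rw [DirectSum.lof_apply]
      cases p with
      | zero => rw [DirectSum.lof_apply, Form.evalPoint_apply_zero]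
      | succ p =>
        rw [DirectSum.lof_eq_of, DirectSum.of_eq_of_ne _ _ _ (by simp)]
        rfl
    · rw [DirectSum.lof_eq_of, DirectSum.lof_eq_of, DirectSum.of_eq_of_ne _ _ _ (Ne.symm hr),
        DirectSum.of_eq_of_ne _ _ _ (by simpa using fun _ => Ne.symm hr)]
      rfl

theorem fibreOp_apply_zero (A : ∀ (q : ℕ) (x : B), V q x →ₗ[ℂ] V (q + 1) x) (x : B)
    (w : ⨁ q, V q x) : fibreOp A x w 0 = 0 := by
  classical
  induction w using DirectSum.induction_on with
  | zero => rw [map_zero]; rfl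
  | add w w' h h' => rw [map_add, DirectSum.add_apply, h, h', add_zero]
  | of r v =>
    rw [← DirectSum.lof_eq_of ℂ, fibreOp, DirectSum.toModule_lof, LinearMap.comp_apply,
      DirectSum.lof_eq_of, DirectSum.of_eq_of_ne _ _ _ (by simp)]

theorem fibreOp_apply_succ (A : ∀ (q : ℕ) (x : B), V q x →ₗ[ℂ] V (q + 1) x) (x : B)
    (w : ⨁ q, V q x) (q : ℕ) : fibreOp A x w (q + 1) = A q x (w q) := by
  classical
  induction w using DirectSum.induction_on with
  | zero => rw [map_zero, DirectSum.zero_apply, DirectSum.zero_apply, map_zero]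
  | add w w' h h' => rw [map_add, DirectSum.add_apply, h, h', DirectSum.add_apply, map_add]
  | of r v =>
    rw [← DirectSum.lof_eq_of ℂ, fibreOp, DirectSum.toModule_lof, LinearMap.comp_apply]
    by_cases hr : r = q
    · subst hr
      rw [DirectSum.lof_apply, DirectSum.lof_apply]
    · rw [DirectSum.lof_eq_of, DirectSum.of_eq_of_ne _ _ _ (by simpa using Ne.symm hr),
        DirectSum.lof_eq_of, DirectSum.of_eq_of_ne _ _ _ (Ne.symm hr), map_zero]

/-- Restriction to a point intertwines the superconnection with `-A₀`. -/
theorem evalPoint_op_top (D : Superconnection E F V (⊤ : Opens B))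
    (η : TotalForm E F V (⊤ : Opens B)) (x : B) :
    TotalForm.evalPoint x (D.op η) = -fibreOp (degreeZeroPart g D) x (TotalForm.evalPoint x η) := by
  refine DirectSum.ext_component ℂ fun q => ?_
  change TotalForm.evalPoint x (D.op η) q = -(fibreOp (degreeZeroPart g D) x _ q)
  rw [evalPoint_apply]
  cases q with
  | zero =>
    rw [fibreOp_apply_zero, op_apply_eq_zero D (fun k hk => by simp at hk)]
    exact neg_zero.symm
  | succ q => rw [fibreOp_apply_succ, op_apply_zero (g := g), evalPoint_apply]

/-- Since `D² = 0` and every vector is a value of a section, `A₀² = 0`. -/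
theorem fibreOp_degreeZeroPart_comp_self (D : Superconnection E F V (⊤ : Opens B)) (hD : D.IsFlat)
    (x : B) : fibreOp (degreeZeroPart g D) x ∘ₗ fibreOp (degreeZeroPart g D) x = 0 := by
  ext q v : 2
  obtain ⟨s, rfl⟩ := exists_section g v
  have h1 : TotalForm.evalPoint x (DirectSum.lof ℂ (ℕ × ℕ)
      (fun i => Form E (F i.2) (V i.2) i.1 (⊤ : Opens B)) (0, q) s) =
      DirectSum.lof ℂ ℕ (fun q => V q x) q (s.1 x ![]) := by
    rw [TotalForm.evalPoint, DirectSum.toModule_lof]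
    rfl
  rw [LinearMap.comp_apply, LinearMap.comp_apply, ← h1]
  have h2 := evalPoint_op_top (g := g) D (D.op (DirectSum.lof ℂ (ℕ × ℕ)
      (fun i => Form E (F i.2) (V i.2) i.1 (⊤ : Opens B)) (0, q) s)) x
  have h3 : ∀ ζ, D.op (D.op ζ) = 0 := fun ζ => LinearMap.congr_fun hD ζ
  rw [h3, map_zero, evalPoint_op_top (g := g), map_neg, neg_neg] at h2
  rw [← h2]
  rfl

/-- Restriction to a point intertwines the restricted superconnection with `-A₀`. -/
theorem evalPoint_op {D : Superconnection E F V (⊤ : Opens B)} {DU : Superconnection E F V U}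
    (h : ∀ (η : TotalForm E F V U) (ζ : TotalForm E F V (⊤ : Opens B)),
        ∀ z ∈ U, (∀ᶠ x in 𝓝 z, ∀ i, (ζ i).1 x = (η i).1 x) →
          ∀ i, (DU.op η i).1 z = (D.op ζ i).1 z) {x : B} (hx : x ∈ U) (η : TotalForm E F V U) :
    TotalForm.evalPoint x (DU.op η) = -fibreOp (degreeZeroPart g D) x (TotalForm.evalPoint x η) := by
  obtain ⟨ζ, -, hζ⟩ := TotalForm.exists_extension η hx
  have h1 : ∀ {U' : Opens B} (η₁ : TotalForm E F V U) (η₂ : TotalForm E F V U'),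
      (∀ i, (η₁ i).1 x = (η₂ i).1 x) → TotalForm.evalPoint x η₁ = TotalForm.evalPoint x η₂ := by
    intro U' η₁ η₂ h
    refine DirectSum.ext_component ℂ fun q => ?_
    change TotalForm.evalPoint x η₁ q = TotalForm.evalPoint x η₂ q
    rw [evalPoint_apply, evalPoint_apply, h]
  rw [h1 _ _ (h η ζ x hx hζ), h1 η ζ fun i => (hζ.self_of_nhds i).symm, evalPoint_op_top]

end DegreeZero

/-! ### Pull back of differential forms -/

section PullbackForms

attribute [local instance] continuousSMul_real

open Filter Set Topology

set_option linter.unusedSectionVars false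

universe uB

variable {E : Type*} [NormedAddCommGroup E] [NormedSpace ℝ E] [FiniteDimensional ℝ E]
  {B : Type uB} [TopologicalSpace B] [T2Space B] [SecondCountableTopology B]
  [ChartedSpace E B] [IsManifold 𝓘(ℝ, E) ∞ B]
  {F : ℕ → Type*} [∀ q, NormedAddCommGroup (F q)] [∀ q, NormedSpace ℂ (F q)]
  {V : ℕ → B → Type*} [∀ q, TopologicalSpace (TotalSpace (F q) (V q))]
  [∀ q x, AddCommGroup (V q x)] [∀ q x, Module ℂ (V q x)] [∀ q x, TopologicalSpace (V q x)]
  [∀ q x, IsTopologicalAddGroup (V q x)] [∀ q x, ContinuousSMul ℂ (V q x)]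
  [∀ q, FiberBundle (F q) (V q)] [∀ q, VectorBundle ℂ (F q) (V q)]
  [∀ q, VectorBundle ℝ (F q) (V q)]
  {U : Opens B}

section Smooth

variable {T T' X : Type*} [NormedAddCommGroup T] [NormedSpace ℝ T] [NormedAddCommGroup T']
  [NormedSpace ℝ T'] [NormedAddCommGroup X] [NormedSpace ℝ X]

/-- The projection of continuous multilinear maps to the alternating ones. -/
def alternatizationCLM (T : Type*) [NormedAddCommGroup T] [NormedSpace ℝ T] (p : ℕ) :
    ContinuousMultilinearMap ℝ (fun _ : Fin p => T) ℂ →L[ℝ] T [⋀^Fin p]→L[ℝ] ℂ :=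
  LinearMap.mkContinuous
    { toFun := fun f => ((p.factorial : ℝ)⁻¹) • ContinuousMultilinearMap.alternatization f
      map_add' := fun f f' => by rw [map_add, smul_add]
      map_smul' := fun c f => by
        ext v
        simp [ContinuousMultilinearMap.alternatization_apply_apply, Finset.mul_sum,
          mul_left_comm, Units.smul_def] } 1 fun f => by
    refine ContinuousAlternatingMap.opNorm_le_bound _ (by positivity) fun v => ?_
    change ‖((p.factorial : ℝ)⁻¹) • ContinuousMultilinearMap.alternatization f v‖ ≤ _
    have h1 : ∀ σ : Equiv.Perm (Fin p), ‖Equiv.Perm.sign σ • f (v ∘ σ)‖ ≤ ‖f‖ * ∏ i, ‖v i‖ := by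
      intro σ
      have h2 : ‖Equiv.Perm.sign σ • f (v ∘ σ)‖ = ‖f (v ∘ σ)‖ := by
        rcases Int.units_eq_one_or (Equiv.Perm.sign σ) with h | h <;> rw [h] <;> simp
      rw [h2, ← Equiv.prod_comp σ fun i => ‖v i‖]
      exact f.le_opNorm _
    rw [ContinuousMultilinearMap.alternatization_apply_apply, norm_smul, norm_inv,
      Real.norm_natCast, one_mul, inv_mul_le_iff₀ (by positivity)]
    refine (norm_sum_le _ _).trans ((Finset.sum_le_sum fun σ _ => h1 σ).trans ?_)
    simp [Fintype.card_perm]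

theorem alternatizationCLM_apply {p : ℕ} (α : T [⋀^Fin p]→L[ℝ] ℂ) :
    alternatizationCLM T p α.toContinuousMultilinearMap = α := by
  ext v
  change ((p.factorial : ℝ)⁻¹) •
    ContinuousMultilinearMap.alternatization α.toContinuousMultilinearMap v = _
  have h1 : ContinuousMultilinearMap.alternatization α.toContinuousMultilinearMap v =
      (p.factorial : ℝ) • α v := by
    rw [ContinuousMultilinearMap.alternatization_apply_apply]
    have h2 : ∀ σ : Equiv.Perm (Fin p),
        Equiv.Perm.sign σ • α.toContinuousMultilinearMap (v ∘ σ) = α v := by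
      intro σ
      change Equiv.Perm.sign σ • α (v ∘ σ) = α v
      rw [show α (v ∘ σ) = _ from α.toAlternatingMap.map_perm v σ, smul_smul, Int.units_mul_self,
        one_smul]
      rfl
    rw [Finset.sum_congr rfl fun σ _ => h2 σ]
    simp [Fintype.card_perm]
  rw [h1, smul_smul, inv_mul_cancel₀ (by positivity), one_smul]

set_option synthInstance.maxHeartbeats 200000 in
theorem ContDiffAt.compContinuousLinearMap {n : WithTop ℕ∞} {p : ℕ}
    {α : X → T [⋀^Fin p]→L[ℝ] ℂ} {L : X → T' →L[ℝ] T} {x : X} (hα : ContDiffAt ℝ n α x)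
    (hL : ContDiffAt ℝ n L x) :
    ContDiffAt ℝ n (fun x => (α x).compContinuousLinearMap (L x)) x := by
  have h1 : ContDiffAt ℝ n (fun x => ContinuousMultilinearMap.compContinuousLinearMapContinuousMultilinear
      ℝ (fun _ : Fin p => T') (fun _ : Fin p => T) ℂ (fun _ => L x)) x :=
    (ContinuousMultilinearMap.contDiff _).contDiffAt.comp x (contDiffAt_pi.2 fun _ => hL)
  have h2 : ContDiffAt ℝ n (fun x => (α x).toContinuousMultilinearMap) x :=
    (ContinuousAlternatingMap.toContinuousMultilinearMapLI (𝕜 := ℝ) (E := T) (F := ℂ)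
      (ι := Fin p)).contDiff.contDiffAt.comp x hα
  have h3 := (alternatizationCLM T' p).contDiff.contDiffAt.comp x (h1.clm_apply h2)
  refine h3.congr_of_eventuallyEq (.of_forall fun y => ?_)
  exact (alternatizationCLM_apply ((α y).compContinuousLinearMap (L y))).symm

end Smooth

namespace ExtAlg

variable {T T' : Type*} [NormedAddCommGroup T] [NormedSpace ℝ T] [NormedAddCommGroup T']
  [NormedSpace ℝ T']

/-- The contraction of an inhomogeneous form with a vector. -/
def contr (v : T) : ExtAlg T →ₗ[ℂ] ExtAlg T where
  toFun a := fun p => (a (p + 1)).curryLeft v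
  map_add' _ _ := rfl
  map_smul' _ _ := rfl

theorem contr_apply (v : T) (a : ExtAlg T) (p : ℕ) : contr v a p = (a (p + 1)).curryLeft v := rfl

theorem contr_contr (v : T) (a : ExtAlg T) : contr v (contr v a) = 0 := by
  ext1 p
  exact ContinuousAlternatingMap.curryLeft_same _ _

theorem contr_pull (f : T' →L[ℝ] T) (v : T') (a : ExtAlg T) :
    contr v (pull f a) = pull f (contr (f v) a) := by
  ext1 p
  exact ContinuousAlternatingMap.curryLeft_compContinuousLinearMap _ _ _

theorem contr_mul_of_right (v : T) (a : ExtAlg T) {b : ExtAlg T} (hb : ∀ p, p ≠ 0 → b p = 0) :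
    contr v (a * b) = contr v a * b := by
  ext1 p
  rw [contr_apply, mul_apply_of_right _ hb, mul_apply_of_right _ hb]
  rfl

/-- Cartan's formula for a form without component in the direction `v`. -/
theorem contr_extD {a : T → ExtAlg T} {w : T} (ha : Diff a w) {v : T}
    (h : ∀ᶠ w' in 𝓝 w, contr v (a w') = 0) (p : ℕ) :
    contr v (extD a w) p = fderiv ℝ (fun w' => a w' p) w v := by
  ext m
  change extDeriv (fun w' => a w' p) w (Matrix.vecCons v m) = _
  rw [extDeriv, ContinuousAlternatingMap.alternatizeUncurryFin_apply, Fin.sum_univ_succ]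
  have h1 : ∀ i : Fin p, fderiv ℝ (fun w' => a w' p) w (Matrix.vecCons v m i.succ)
      (i.succ.removeNth (Matrix.vecCons v m)) = 0 := by
    intro i
    cases p with
    | zero => exact i.elim0
    | succ p =>
      have h2 : HasFDerivAt (fun w' => (a w' (p + 1)) (i.succ.removeNth (Matrix.vecCons v m)))
          ((ContinuousAlternatingMap.apply ℝ T ℂ (i.succ.removeNth (Matrix.vecCons v m))).comp
            (fderiv ℝ (fun w' => a w' (p + 1)) w)) w :=
        HasFDerivAt.comp w (f := fun w' => a w' (p + 1))
          (ContinuousAlternatingMap.apply ℝ T ℂ (i.succ.removeNth (Matrix.vecCons v m))).hasFDerivAt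
          (ha (p + 1)).hasFDerivAt
      have h3 : (fun w' => (a w' (p + 1)) (i.succ.removeNth (Matrix.vecCons v m))) =ᶠ[𝓝 w]
          fun _ => 0 := by
        filter_upwards [h] with w' hw'
        have h4 : i.succ.removeNth (Matrix.vecCons v m) =
            Matrix.vecCons v (i.removeNth m) := by
          funext j
          refine Fin.cases ?_ (fun j => ?_) j
          · simp [Fin.removeNth]
          · simp [Fin.removeNth]
        rw [h4]
        exact DFunLike.congr_fun (congrFun hw' p) _
      have h5 := h2.unique ((hasFDerivAt_const (0 : ℂ) w).congr_of_eventuallyEq h3)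
      exact DFunLike.congr_fun h5 _
  rw [Finset.sum_eq_zero fun i _ => by rw [h1, smul_zero], add_zero]
  simp

end ExtAlg

section Pullback

variable {W : Type*} [NormedAddCommGroup W] [NormedSpace ℝ W]

/-- The derivative of `k : W → B` at `w`, in the preferred chart at `k w`. -/
def derivAt (E : Type*) [NormedAddCommGroup E] [NormedSpace ℝ E] {B : Type*} [TopologicalSpace B]
    [ChartedSpace E B] {W : Type*} [NormedAddCommGroup W] [NormedSpace ℝ W] (k : W → B) (w : W) :
    W →L[ℝ] E :=
  fderiv ℝ (fun w' => extChartAt 𝓘(ℝ, E) (k w) (k w')) w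

theorem contDiffAt_extChartAt_comp {k : W → B} {w : W}
    {n : WithTop ℕ∞} (hn : n ≤ ∞) (hk : ContMDiffAt 𝓘(ℝ, W) 𝓘(ℝ, E) n k w) {x₀ : B}
    (hx : k w ∈ (chartAt E x₀).source) :
    ContDiffAt ℝ n (fun w' => extChartAt 𝓘(ℝ, E) x₀ (k w')) w :=
  (((contMDiffAt_extChartAt' (n := ∞) hx).of_le hn).comp w hk).contDiffAt

theorem fderiv_extChartAt_comp {k : W → B} {w : W}
    (hk : ContMDiffAt 𝓘(ℝ, W) 𝓘(ℝ, E) 1 k w) {x₀ : B} (hx : k w ∈ (chartAt E x₀).source) :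
    fderiv ℝ (fun w' => extChartAt 𝓘(ℝ, E) x₀ (k w')) w =
      (tangentCoordChange 𝓘(ℝ, E) (k w) x₀ (k w)).comp (derivAt E k w) := by
  have h1 := hasFDerivWithinAt_tangentCoordChange (I := 𝓘(ℝ, E)) (x := k w) (y := x₀) (z := k w)
    ⟨mem_extChartAt_source _, by simpa using hx⟩
  simp only [modelWithCornersSelf_coe, Set.range_id, hasFDerivWithinAt_univ] at h1
  have h2 : HasFDerivAt (fun w' => extChartAt 𝓘(ℝ, E) (k w) (k w')) (derivAt E k w) w :=
    ((contDiffAt_extChartAt_comp (by simp) hk (mem_chart_source E _)).differentiableAt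
      (by simp)).hasFDerivAt
  refine ((h1.comp w h2).congr_of_eventuallyEq ?_).fderiv
  filter_upwards [hk.continuousAt (extChartAt_source_mem_nhds (I := 𝓘(ℝ, E)) (k w))] with w' hw'
  simp only [Function.comp_apply]
  rw [(extChartAt 𝓘(ℝ, E) (k w)).left_inv hw']

theorem compContinuousLinearMap_derivAt {k : W → B} {w : W}
    (hk : ContMDiffAt 𝓘(ℝ, W) 𝓘(ℝ, E) 1 k w) {x₀ : B} (hx : k w ∈ (chartAt E x₀).source) {p : ℕ}
    (α : ∀ x : B, FormFibre E (Bundle.Trivial B ℂ) p x) :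
    ContinuousAlternatingMap.compContinuousLinearMap
        (show E [⋀^Fin p]→L[ℝ] ℂ from α (k w)) (derivAt E k w) =
      (coordForm ℂ (Bundle.Trivial B ℂ) x₀ α (k w)).compContinuousLinearMap
        (fderiv ℝ (fun w' => extChartAt 𝓘(ℝ, E) x₀ (k w')) w) := by
  rw [coordForm_trivial α x₀ _ hx, fderiv_extChartAt_comp hk hx]
  ext v
  refine congrArg (show E [⋀^Fin p]→L[ℝ] ℂ from α (k w)) (funext fun i => ?_)
  have h1 : k w ∈ (extChartAt 𝓘(ℝ, E) x₀).source := by simpa using hx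
  have h2 := mem_extChartAt_source (I := 𝓘(ℝ, E)) (k w)
  refine Eq.trans ?_ (tangentCoordChange_comp (I := 𝓘(ℝ, E)) ⟨⟨h2, h1⟩, h2⟩).symm
  exact (tangentCoordChange_self h2).symm

/-- The pull back of an inhomogeneous scalar form along `k`. -/
def pullback (k : W → B) (α : ∀ p, ScalarForm E p U) (w : W) : ExtAlg W :=
  ExtAlg.pull (derivAt E k w) (formVal α (k w))

theorem pullback_eventuallyEq {k : W → B} {w : W} (hk : ContMDiffAt 𝓘(ℝ, W) 𝓘(ℝ, E) ∞ k w)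
    (α : ∀ p, ScalarForm E p U) (p : ℕ) :
    (fun w' => pullback k α w' p) =ᶠ[𝓝 w] fun w' =>
      (coordForm ℂ (Bundle.Trivial B ℂ) (k w) (α p).1 (k w')).compContinuousLinearMap
        (fderiv ℝ (fun w' => extChartAt 𝓘(ℝ, E) (k w) (k w')) w') := by
  have h1 : ∀ᶠ w' in 𝓝 w, ContMDiffAt 𝓘(ℝ, W) 𝓘(ℝ, E) 1 k w' :=
    (contMDiffAt_iff_contMDiffAt_nhds (by simp)).1 (hk.of_le (by simp))
  filter_upwards [h1, hk.continuousAt (chart_source_mem_nhds E (k w))] with w' hw' hx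
  exact compContinuousLinearMap_derivAt hw' hx (α p).1

theorem contDiffAt_pullback {k : W → B} {w : W} (hk : ContMDiffAt 𝓘(ℝ, W) 𝓘(ℝ, E) ∞ k w)
    (hw : k w ∈ U) (α : ∀ p, ScalarForm E p U) (p : ℕ) :
    ContDiffAt ℝ ∞ (fun w' => pullback k α w' p) w := by
  refine ContDiffAt.congr_of_eventuallyEq ?_ (pullback_eventuallyEq hk α p)
  refine ContDiffAt.compContinuousLinearMap ?_ ?_
  · exact (ContMDiffAt.comp w (Form.contMDiffAt (α p) hw) hk).contDiffAt
  · exact (contDiffAt_extChartAt_comp le_rfl hk (mem_chart_source E _)).fderiv_right (by simp)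

theorem extD_pullback {k : W → B} {w : W} (hk : ContMDiffAt 𝓘(ℝ, W) 𝓘(ℝ, E) ∞ k w)
    (hw : k w ∈ U) (α : ∀ p, ScalarForm E p U) :
    ExtAlg.extD (pullback k α) w = pullback k (formD α) w := by
  ext1 p
  cases p with
  | zero => rfl
  | succ p =>
    change extDeriv (fun w' => pullback k α w' p) w = _
    rw [(pullback_eventuallyEq hk α p).extDeriv_eq]
    set φ := extChartAt 𝓘(ℝ, E) (k w) with hφ
    set rep := fun y => coordForm ℂ (Bundle.Trivial B ℂ) (k w) (α p).1 (φ.symm y) with hrep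
    have h1 : (fun w' => (coordForm ℂ (Bundle.Trivial B ℂ) (k w) (α p).1
        (k w')).compContinuousLinearMap (fderiv ℝ (fun w' => φ (k w')) w')) =ᶠ[𝓝 w]
        fun w' => (rep (φ (k w'))).compContinuousLinearMap (fderiv ℝ (fun w' => φ (k w')) w') := by
      filter_upwards [hk.continuousAt (extChartAt_source_mem_nhds (I := 𝓘(ℝ, E)) (k w))] with w' hw'
      rw [hrep]
      simp only
      rw [φ.left_inv hw']
    have h2 : DifferentiableAt ℝ rep (φ (k w)) := by
      have h3 : ContMDiffAt 𝓘(ℝ, E) 𝓘(ℝ, E [⋀^Fin p]→L[ℝ] ℂ) ∞ rep (φ (k w)) := by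
        refine ContMDiffAt.comp (g := coordForm ℂ (Bundle.Trivial B ℂ) (k w) (α p).1) _ ?_
          ((contMDiffOn_extChartAt_symm (k w)).contMDiffAt (extChartAt_target_mem_nhds (k w)))
        rw [extChartAt_to_inv]
        exact Form.contMDiffAt (α p) hw
      exact h3.contDiffAt.differentiableAt (by simp)
    have h3 : ContDiffAt ℝ 2 (fun w' => φ (k w')) w :=
      (contDiffAt_extChartAt_comp le_rfl hk (mem_chart_source E _)).of_le (WithTop.coe_le_coe.2 le_top)
    rw [h1.extDeriv_eq, extDeriv_pullback (f := fun w' => φ (k w')) h2 h3 (by simp)]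
    refine congrArg (fun ζ : E [⋀^Fin (p + 1)]→L[ℝ] ℂ => ζ.compContinuousLinearMap _) ?_
    exact (ScalarForm.d_apply (α p) hw).symm

end Pullback

end PullbackForms

/-! ### The transport equation -/

section TransportEquation

attribute [local instance] continuousSMul_real

open Filter Set Topology

set_option linter.unusedSectionVars false

universe uB

variable {E : Type*} [NormedAddCommGroup E] [NormedSpace ℝ E] [FiniteDimensional ℝ E]
  {B : Type uB} [TopologicalSpace B] [T2Space B] [SecondCountableTopology B]
  [ChartedSpace E B] [IsManifold 𝓘(ℝ, E) ∞ B]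
  {F : ℕ → Type*} [∀ q, NormedAddCommGroup (F q)] [∀ q, NormedSpace ℂ (F q)]
  {V : ℕ → B → Type*} [∀ q, TopologicalSpace (TotalSpace (F q) (V q))]
  [∀ q x, AddCommGroup (V q x)] [∀ q x, Module ℂ (V q x)] [∀ q x, TopologicalSpace (V q x)]
  [∀ q x, IsTopologicalAddGroup (V q x)] [∀ q x, ContinuousSMul ℂ (V q x)]
  [∀ q, FiberBundle (F q) (V q)] [∀ q, VectorBundle ℂ (F q) (V q)]
  [∀ q, VectorBundle ℝ (F q) (V q)]
  {U : Opens B}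

universe u v

instance finiteDimensional_alternating {T : Type*} [NormedAddCommGroup T] [NormedSpace ℝ T]
    [FiniteDimensional ℝ T] (p : ℕ) : FiniteDimensional ℝ (T [⋀^Fin p]→L[ℝ] ℂ) := by
  refine Module.Finite.of_injective (N := MultilinearMap ℝ (fun _ : Fin p => T) ℂ)
    ({ toFun := fun α => α.toAlternatingMap.toMultilinearMap
       map_add' := fun _ _ => rfl
       map_smul' := fun _ _ => rfl } : T [⋀^Fin p]→L[ℝ] ℂ →ₗ[ℝ]
        MultilinearMap ℝ (fun _ : Fin p => T) ℂ) fun α β h => ?_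
  ext v
  exact congrArg (fun f : MultilinearMap ℝ (fun _ : Fin p => T) ℂ => f v) h

namespace ExtAlg

variable {X T : Type*} [NormedAddCommGroup X] [NormedSpace ℝ X] [NormedAddCommGroup T]
  [NormedSpace ℝ T]

/-- Smoothness, in every degree, of a family of inhomogeneous forms. -/
def Smooth (a : X → ExtAlg T) (x : X) : Prop := ∀ p, ContDiffAt ℝ ∞ (fun x => a x p) x

theorem Smooth.diff {a : T → ExtAlg T} {w : T} (h : Smooth a w) : Diff a w :=
  fun p => (h p).differentiableAt (by simp)

theorem Smooth.const (a : ExtAlg T) (x : X) : Smooth (fun _ => a) x := fun _ => contDiffAt_const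

theorem Smooth.add {a b : X → ExtAlg T} {x : X} (ha : Smooth a x) (hb : Smooth b x) :
    Smooth (fun x => a x + b x) x := fun p => (ha p).add (hb p)

theorem Smooth.sub {a b : X → ExtAlg T} {x : X} (ha : Smooth a x) (hb : Smooth b x) :
    Smooth (fun x => a x - b x) x := fun p => (ha p).sub (hb p)

theorem Smooth.sum {ι : Type*} {s : Finset ι} {a : ι → X → ExtAlg T} {x : X}
    (h : ∀ i ∈ s, Smooth (a i) x) : Smooth (fun x => ∑ i ∈ s, a i x) x := by
  intro p
  simp only [sum_apply]
  exact ContDiffAt.sum fun i hi => h i hi p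

theorem Smooth.mul {a b : X → ExtAlg T} {x : X} (ha : Smooth a x) (hb : Smooth b x) :
    Smooth (fun x => a x * b x) x := by
  intro p
  simp only [mul_apply]
  refine ContDiffAt.sum fun i _ => ?_
  exact (castForm (i.1 + i.2) p).contDiff.contDiffAt.comp x
    ((isBoundedBilinearMap_wedge i.1 i.2).contDiff.contDiffAt.comp x ((ha i.1).prodMk (hb i.2)))

theorem Smooth.eps {a : X → ExtAlg T} {x : X} (ha : Smooth a x) :
    Smooth (fun x => eps (a x)) x := by
  intro p
  exact (contDiff_const_smul ((-1 : ℂ) ^ p)).contDiffAt.comp x (ha p)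

/-- Contraction with a vector, in a single degree, as a continuous linear map. -/
def contrCLM (v : T) (p : ℕ) : T [⋀^Fin (p + 1)]→L[ℝ] ℂ →L[ℝ] T [⋀^Fin p]→L[ℝ] ℂ :=
  (ContinuousLinearMap.apply ℝ (T [⋀^Fin p]→L[ℝ] ℂ) v).comp
    (ContinuousAlternatingMap.curryLeftLI (𝕜 := ℝ) (E := T) (F := ℂ) (n := p)).toContinuousLinearMap

theorem Smooth.contr {a : X → ExtAlg T} {x : X} (ha : Smooth a x) (v : T) :
    Smooth (fun x => contr v (a x)) x := by
  intro p
  exact (contrCLM v p).contDiff.contDiffAt.comp x (ha (p + 1))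

theorem real_smul_eq (c : ℝ) (a : ExtAlg T) : c • a = (c : ℂ) • a := by
  ext p v
  simp

theorem smul_eq_const_mul (c : ℂ) (a : ExtAlg T) : c • a = const c * a := by
  ext1 p
  rw [mul_apply_of_left (a := const c) fun p hp => of_apply_of_ne hp.symm _, const, of_apply_self]
  simp

theorem smul_mul' (c : ℂ) (a b : ExtAlg T) : c • a * b = c • (a * b) := by
  rw [smul_eq_const_mul, smul_eq_const_mul, mul_assoc]

theorem eps_smul (c : ℂ) (a : ExtAlg T) : eps (c • a) = c • eps a := by
  ext1 p
  exact smul_comm ((-1 : ℂ) ^ p) c (a p)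

theorem exists_of_mul_apply_ne_zero {a b : ExtAlg T} {p : ℕ} (h : (a * b) p ≠ 0) :
    ∃ i k, i + k = p ∧ a i ≠ 0 ∧ b k ≠ 0 := by
  rw [mul_apply] at h
  obtain ⟨⟨i, k⟩, hik, h⟩ := Finset.exists_ne_zero_of_sum_ne_zero h
  refine ⟨i, k, Finset.HasAntidiagonal.mem_antidiagonal.1 hik, fun h0 => h ?_, fun h0 => h ?_⟩
  · simp only [h0, zero_wedge', map_zero]
  · simp only [h0, wedge_zero', map_zero]

end ExtAlg

section Transport

variable {𝓙 : Type v} {T : Type u} [NormedAddCommGroup T] [NormedSpace ℝ T]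

/-- A family of inhomogeneous forms is of total degree `m` if its member with index `j` is
homogeneous of degree `m - q j`, and zero unless `j` belongs to the finite set `J`. -/
def HasTotalDegree (J : Finset 𝓙) (q : 𝓙 → ℕ) (m : ℕ) (a : 𝓙 → ExtAlg T) : Prop :=
  ∀ j p, a j p ≠ 0 → j ∈ J ∧ p + q j = m

/-- The indices of the components of a family of total degree `m`. -/
def degreeIndices (J : Finset 𝓙) (q : 𝓙 → ℕ) (m : ℕ) : Finset (𝓙 × ℕ) :=
  open Classical in (J ×ˢ Finset.range (m + 1)).filter fun s => s.2 + q s.1 = m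

theorem mem_degreeIndices {J : Finset 𝓙} {q : 𝓙 → ℕ} {m : ℕ} {s : 𝓙 × ℕ} :
    s ∈ degreeIndices J q m ↔ s.1 ∈ J ∧ s.2 + q s.1 = m := by
  simp only [degreeIndices, Finset.mem_filter, Finset.mem_product, Finset.mem_range]
  constructor
  · exact fun h => ⟨h.1.1, h.2⟩
  · exact fun h => ⟨⟨h.1, by omega⟩, h.2⟩

/-- The finite dimensional space of families with components indexed by `S`. -/
abbrev FinFamily (T : Type u) [NormedAddCommGroup T] [NormedSpace ℝ T] (S : Finset (𝓙 × ℕ)) :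
    Type (max u v) :=
  ∀ s : S, T [⋀^Fin s.1.2]→L[ℝ] ℂ

/-- The family with given components. -/
def FinFamily.incl (S : Finset (𝓙 × ℕ)) : FinFamily T S →ₗ[ℝ] (𝓙 → ExtAlg T) where
  toFun a := fun j p => open Classical in if h : (j, p) ∈ S then a ⟨(j, p), h⟩ else 0
  map_add' a b := by
    funext j p
    by_cases h : (j, p) ∈ S <;> simp [h]
  map_smul' c a := by
    funext j p
    by_cases h : (j, p) ∈ S
    · simp [h]
    · ext w
      simp [h]

/-- The components of a family. -/
def FinFamily.res (S : Finset (𝓙 × ℕ)) : (𝓙 → ExtAlg T) →ₗ[ℝ] FinFamily T S where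
  toFun a := fun s => a s.1.1 s.1.2
  map_add' _ _ := rfl
  map_smul' _ _ := rfl

theorem FinFamily.incl_apply_of_mem {S : Finset (𝓙 × ℕ)} (a : FinFamily T S) {j : 𝓙} {p : ℕ}
    (h : (j, p) ∈ S) : FinFamily.incl S a j p = a ⟨(j, p), h⟩ := dif_pos h

theorem FinFamily.incl_apply_of_notMem {S : Finset (𝓙 × ℕ)} (a : FinFamily T S) {j : 𝓙} {p : ℕ}
    (h : (j, p) ∉ S) : FinFamily.incl S a j p = 0 := dif_neg h

theorem FinFamily.incl_res {J : Finset 𝓙} {q : 𝓙 → ℕ} {m : ℕ} {a : 𝓙 → ExtAlg T}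
    (ha : HasTotalDegree J q m a) :
    FinFamily.incl (degreeIndices J q m) (FinFamily.res (degreeIndices J q m) a) = a := by
  funext j p
  by_cases h : (j, p) ∈ degreeIndices J q m
  · exact FinFamily.incl_apply_of_mem _ h
  · rw [FinFamily.incl_apply_of_notMem _ h]
    by_contra hne
    exact h (mem_degreeIndices.2 (ha j p (Ne.symm hne)))

theorem FinFamily.hasTotalDegree_incl {J : Finset 𝓙} {q : 𝓙 → ℕ} {m : ℕ}
    (a : FinFamily T (degreeIndices J q m)) :
    HasTotalDegree J q m (FinFamily.incl (degreeIndices J q m) a) := by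
  intro j p h
  by_contra hne
  exact h (FinFamily.incl_apply_of_notMem _ fun h' => hne (mem_degreeIndices.1 h'))

/-- The operator `a ↦ a A - ι_v (ε(a) B)` on families of inhomogeneous forms. -/
def transportOp (J : Finset 𝓙) (v : T) (A B : 𝓙 → 𝓙 → ExtAlg T) :
    (𝓙 → ExtAlg T) →ₗ[ℝ] (𝓙 → ExtAlg T) where
  toFun a := fun j => ∑ i ∈ J, (a i * A i j - ExtAlg.contr v (ExtAlg.eps (a i) * B i j))
  map_add' a b := by
    funext j
    simp only [Pi.add_apply, map_add, add_mul, ← Finset.sum_add_distrib]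
    exact Finset.sum_congr rfl fun i _ => by abel
  map_smul' c a := by
    funext j
    have h1 : ∀ i, (c • a) i = (c : ℂ) • a i := fun i => ExtAlg.real_smul_eq c (a i)
    simp only [h1, ExtAlg.eps_smul, ExtAlg.smul_mul', map_smul, ← smul_sub]
    rw [← Finset.smul_sum, ← ExtAlg.real_smul_eq]
    rfl

theorem transportOp_apply (J : Finset 𝓙) (v : T) (A B : 𝓙 → 𝓙 → ExtAlg T) (a : 𝓙 → ExtAlg T)
    (j : 𝓙) : transportOp J v A B a j =
      ∑ i ∈ J, (a i * A i j - ExtAlg.contr v (ExtAlg.eps (a i) * B i j)) := rfl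

theorem ExtAlg.Smooth.transportOp {X : Type*} [NormedAddCommGroup X] [NormedSpace ℝ X]
    {J : Finset 𝓙} {v : T} {A B : X → 𝓙 → 𝓙 → ExtAlg T} {a : X → 𝓙 → ExtAlg T} {x : X} {j : 𝓙}
    (ha : ∀ i ∈ J, ExtAlg.Smooth (fun x => a x i) x)
    (hA : ∀ i ∈ J, ExtAlg.Smooth (fun x => A x i j) x)
    (hB : ∀ i ∈ J, ExtAlg.Smooth (fun x => B x i j) x) :
    ExtAlg.Smooth (fun x => SuperConn.transportOp J v (A x) (B x) (a x) j) x :=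
  ExtAlg.Smooth.sum fun i hi => ((ha i hi).mul (hA i hi)).sub (((ha i hi).eps.mul (hB i hi)).contr v)

theorem transportOp_hasTotalDegree {J : Finset 𝓙} {v : T} {A B : 𝓙 → 𝓙 → ExtAlg T}
    {q : 𝓙 → ℕ} {m : ℕ} {a : 𝓙 → ExtAlg T} (ha : HasTotalDegree J q m a)
    (hA : ∀ i j p, A i j p ≠ 0 → p + q j = q i) (hB : ∀ i j p, B i j p ≠ 0 → p + q j = q i + 1)
    {j : 𝓙} {p : ℕ} (h : transportOp J v A B a j p ≠ 0) : p + q j = m := by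
  rw [transportOp_apply, ExtAlg.sum_apply] at h
  obtain ⟨i, hi, h⟩ := Finset.exists_ne_zero_of_sum_ne_zero h
  by_cases h1 : (a i * A i j) p = 0
  · have h2 : (ExtAlg.eps (a i) * B i j) (p + 1) ≠ 0 := by
      intro h2
      refine h ?_
      rw [Pi.sub_apply, h1, ExtAlg.contr_apply, h2, ContinuousAlternatingMap.curryLeft_zero]
      exact sub_zero (0 : T [⋀^Fin p]→L[ℝ] ℂ)
    obtain ⟨r, k, hrk, hr, hk⟩ := ExtAlg.exists_of_mul_apply_ne_zero h2
    have h3 : a i r ≠ 0 := by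
      intro h3
      refine hr ?_
      rw [ExtAlg.eps_apply, h3]
      exact smul_zero (A := T [⋀^Fin r]→L[ℝ] ℂ) ((-1 : ℂ) ^ r)
    have h4 := (ha i r h3).2
    have h5 := hB i j k hk
    omega
  · obtain ⟨r, k, hrk, hr, hk⟩ := ExtAlg.exists_of_mul_apply_ne_zero h1
    have h4 := (ha i r hr).2
    have h5 := hA i j k hk
    omega

variable [FiniteDimensional ℝ T]

/-- `transportOp` on the finite dimensional space of families of total degree `m`. -/
def transportCLM (J : Finset 𝓙) (v : T) (S : Finset (𝓙 × ℕ)) (A B : 𝓙 → 𝓙 → ExtAlg T) :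
    FinFamily T S →L[ℝ] FinFamily T S :=
  LinearMap.toContinuousLinearMap
    (FinFamily.res S ∘ₗ transportOp J v A B ∘ₗ FinFamily.incl S)

theorem transportCLM_apply (J : Finset 𝓙) (v : T) (S : Finset (𝓙 × ℕ)) (A B : 𝓙 → 𝓙 → ExtAlg T)
    (a : FinFamily T S) (s : S) : transportCLM J v S A B a s =
      transportOp J v A B (FinFamily.incl S a) s.1.1 s.1.2 := rfl

theorem contDiffAt_transportCLM_apply {X : Type*} [NormedAddCommGroup X] [NormedSpace ℝ X]
    {J : Finset 𝓙} {q : 𝓙 → ℕ} {m : ℕ} {v : T} {A B : X → 𝓙 → 𝓙 → ExtAlg T} {x : X}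
    (hA : ∀ i ∈ J, ∀ j ∈ J, ExtAlg.Smooth (fun x => A x i j) x)
    (hB : ∀ i ∈ J, ∀ j ∈ J, ExtAlg.Smooth (fun x => B x i j) x)
    (a : FinFamily T (degreeIndices J q m)) :
    ContDiffAt ℝ ∞ (fun x => transportCLM J v (degreeIndices J q m) (A x) (B x) a) x := by
  have h1 : ∀ s : degreeIndices J q m, ContDiffAt ℝ ∞ (fun x => transportOp J v (A x) (B x)
      (FinFamily.incl (degreeIndices J q m) a) s.1.1 s.1.2) x := by
    intro s
    have hs : s.1.1 ∈ J := (mem_degreeIndices.1 s.2).1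
    have h2 : ExtAlg.Smooth (fun x => transportOp J v (A x) (B x)
        (FinFamily.incl (degreeIndices J q m) a) s.1.1) x :=
      ExtAlg.Smooth.transportOp (a := fun _ => FinFamily.incl (degreeIndices J q m) a)
        (fun i _ => ExtAlg.Smooth.const _ _) (fun i hi => hA i hi _ hs) (fun i hi => hB i hi _ hs)
    exact h2 s.1.2
  exact contDiffAt_pi.2 h1

/-- Uniqueness for the linear transport equation. -/
theorem transport_unique {J : Finset 𝓙} {q : 𝓙 → ℕ} {m : ℕ} {v : T}
    {A B : ℝ → 𝓙 → 𝓙 → ExtAlg T}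
    (hA : ∀ i ∈ J, ∀ j ∈ J, ∀ t, ExtAlg.Smooth (fun t => A t i j) t)
    (hB : ∀ i ∈ J, ∀ j ∈ J, ∀ t, ExtAlg.Smooth (fun t => B t i j) t) {b f h : ℝ → 𝓙 → ExtAlg T}
    (hf : ∀ t, HasTotalDegree J q m (f t)) (hh : ∀ t, HasTotalDegree J q m (h t))
    (hf' : ∀ t, ∀ j ∈ J, ∀ p,
      HasDerivAt (fun t => f t j p) ((transportOp J v (A t) (B t) (f t) j + b t j) p) t)
    (hh' : ∀ t, ∀ j ∈ J, ∀ p,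
      HasDerivAt (fun t => h t j p) ((transportOp J v (A t) (B t) (h t) j + b t j) p) t)
    {t₀ : ℝ} (h0 : f t₀ = h t₀) : f = h := by
  set S := degreeIndices J q m with hS
  have hL : Continuous fun t => transportCLM J v S (A t) (B t) := by
    refine continuous_clm_apply.2 fun a => ?_
    refine (contDiff_iff_contDiffAt.2 fun t => ?_ : ContDiff ℝ ∞ _).continuous
    exact contDiffAt_transportCLM_apply (fun i hi j hj => hA i hi j hj t)
      (fun i hi j hj => hB i hi j hj t) a
  have key : ∀ {f : ℝ → 𝓙 → ExtAlg T}, (∀ t, HasTotalDegree J q m (f t)) →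
      (∀ t, ∀ j ∈ J, ∀ p, HasDerivAt (fun t => f t j p)
        ((transportOp J v (A t) (B t) (f t) j + b t j) p) t) →
      ∀ t, HasDerivAt (fun t => FinFamily.res S (f t)) (transportCLM J v S (A t) (B t)
        (FinFamily.res S (f t)) + FinFamily.res S (b t)) t := by
    intro f hf hf' t
    refine hasDerivAt_pi.2 fun s => ?_
    rw [Pi.add_apply, transportCLM_apply, FinFamily.incl_res (hf t)]
    exact hf' t _ (mem_degreeIndices.1 s.2).1 _
  have h1 := linearODE_unique hL (key hf hf') (key hh hh') (t₀ := t₀) (by rw [h0])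
  funext t
  rw [← FinFamily.incl_res (hf t), ← FinFamily.incl_res (hh t), congrFun h1 t]

/-- Existence and smooth dependence on parameters for the linear transport equation. -/
theorem exists_transport {X : Type u} [NormedAddCommGroup X] [NormedSpace ℝ X] {O : Set X}
    (hO : IsOpen O) {J : Finset 𝓙} {q : 𝓙 → ℕ} {m : ℕ} {v : T} {A B : X × ℝ → 𝓙 → 𝓙 → ExtAlg T}
    {b : X × ℝ → 𝓙 → ExtAlg T} {c : X → 𝓙 → ExtAlg T}
    (hA : ∀ i ∈ J, ∀ j ∈ J, ∀ x ∈ O, ∀ t, ExtAlg.Smooth (fun x => A x i j) (x, t))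
    (hB : ∀ i ∈ J, ∀ j ∈ J, ∀ x ∈ O, ∀ t, ExtAlg.Smooth (fun x => B x i j) (x, t))
    (hb : ∀ j ∈ J, ∀ x ∈ O, ∀ t, ExtAlg.Smooth (fun x => b x j) (x, t))
    (hc : ∀ j ∈ J, ∀ x ∈ O, ExtAlg.Smooth (fun x => c x j) x)
    (hAd : ∀ x i j p, A x i j p ≠ 0 → p + q j = q i)
    (hBd : ∀ x i j p, B x i j p ≠ 0 → p + q j = q i + 1)
    (hbd : ∀ x j p, b x j p ≠ 0 → p + q j = m) (hcd : ∀ x, HasTotalDegree J q m (c x)) (t₀ : ℝ) :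
    ∃ a : X × ℝ → 𝓙 → ExtAlg T,
      (∀ x ∈ O, ∀ t, ∀ j, ExtAlg.Smooth (fun x => a x j) (x, t)) ∧
      (∀ x, HasTotalDegree J q m (a x)) ∧ (∀ x ∈ O, a (x, t₀) = c x) ∧
      ∀ x ∈ O, ∀ t, ∀ j ∈ J, ∀ p, HasDerivAt (fun t => a (x, t) j p)
        ((transportOp J v (A (x, t)) (B (x, t)) (a (x, t)) j + b (x, t) j) p) t := by
  set S := degreeIndices J q m with hS
  have hA' : ContDiffOn ℝ ∞ (fun x => transportCLM J v S (A x) (B x)) (O ×ˢ Set.univ) := by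
    refine contDiffOn_clm_apply.2 fun a x hx => ContDiffAt.contDiffWithinAt ?_
    exact contDiffAt_transportCLM_apply (fun i hi j hj => hA i hi j hj x.1 hx.1 x.2)
      (fun i hi j hj => hB i hi j hj x.1 hx.1 x.2) a
  have hb' : ContDiffOn ℝ ∞ (fun x => FinFamily.res S (b x)) (O ×ˢ Set.univ) :=
    fun x hx => (contDiffAt_pi.2 fun s =>
      hb _ (mem_degreeIndices.1 s.2).1 x.1 hx.1 x.2 _).contDiffWithinAt
  have hc' : ContDiffOn ℝ ∞ (fun x => FinFamily.res S (c x)) O :=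
    fun x hx => (contDiffAt_pi.2 fun s => hc _ (mem_degreeIndices.1 s.2).1 x hx _).contDiffWithinAt
  obtain ⟨a, ha, ha'⟩ := exists_solution_linearODE.{u, v} hO hA' hb' hc' t₀
  have hd : ∀ x, HasTotalDegree J q m (FinFamily.incl S (a x)) := fun x =>
    FinFamily.hasTotalDegree_incl (a x)
  refine ⟨fun x => FinFamily.incl S (a x), fun x hx t j p => ?_, hd, fun x hx => ?_,
    fun x hx t j hj p => ?_⟩
  · by_cases h : (j, p) ∈ S
    · have h1 : (fun x => FinFamily.incl S (a x) j p) = fun x => a x ⟨(j, p), h⟩ :=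
        funext fun x => FinFamily.incl_apply_of_mem _ h
      rw [h1]
      exact contDiffAt_pi.1 (ha.contDiffAt ((hO.prod isOpen_univ).mem_nhds ⟨hx, trivial⟩)) ⟨(j, p), h⟩
    · have h1 : (fun x => FinFamily.incl S (a x) j p) = fun x => 0 :=
        funext fun x => FinFamily.incl_apply_of_notMem _ h
      rw [h1]
      exact contDiffAt_const
  · change FinFamily.incl S (a (x, t₀)) = c x
    rw [(ha' x hx).1, FinFamily.incl_res (hcd x)]
  · by_cases h : (j, p) ∈ S
    · have h1 : (fun t => FinFamily.incl S (a (x, t)) j p) = fun t => a (x, t) ⟨(j, p), h⟩ :=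
        funext fun x => FinFamily.incl_apply_of_mem _ h
      rw [h1]
      exact hasDerivAt_pi.1 ((ha' x hx).2 t) ⟨(j, p), h⟩
    · have h1 : (fun t => FinFamily.incl S (a (x, t)) j p) = fun t => 0 :=
        funext fun x => FinFamily.incl_apply_of_notMem _ h
      have h2 : (transportOp J v (A (x, t)) (B (x, t)) (FinFamily.incl S (a (x, t))) j +
          b (x, t) j) p = 0 := by
        have h3 : p + q j ≠ m := fun h3 => h (mem_degreeIndices.2 ⟨hj, h3⟩)
        rw [Pi.add_apply, not_not.1 (mt (transportOp_hasTotalDegree (hd (x, t)) (hAd (x, t))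
          (hBd (x, t))) h3), not_not.1 (mt (hbd (x, t) j p) h3)]
        exact add_zero (0 : T [⋀^Fin p]→L[ℝ] ℂ)
      rw [h1, h2]
      exact hasDerivAt_const t _

end Transport

end TransportEquation

/-! ### Primitives on a cylinder -/

section CylinderPrimitive

attribute [local instance] continuousSMul_real

open Filter Set Topology

set_option linter.unusedSectionVars false

universe uB

variable {E : Type*} [NormedAddCommGroup E] [NormedSpace ℝ E] [FiniteDimensional ℝ E]
  {B : Type uB} [TopologicalSpace B] [T2Space B] [SecondCountableTopology B]
  [ChartedSpace E B] [IsManifold 𝓘(ℝ, E) ∞ B]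
  {F : ℕ → Type*} [∀ q, NormedAddCommGroup (F q)] [∀ q, NormedSpace ℂ (F q)]
  {V : ℕ → B → Type*} [∀ q, TopologicalSpace (TotalSpace (F q) (V q))]
  [∀ q x, AddCommGroup (V q x)] [∀ q x, Module ℂ (V q x)] [∀ q x, TopologicalSpace (V q x)]
  [∀ q x, IsTopologicalAddGroup (V q x)] [∀ q x, ContinuousSMul ℂ (V q x)]
  [∀ q, FiberBundle (F q) (V q)] [∀ q, VectorBundle ℂ (F q) (V q)]
  [∀ q, VectorBundle ℝ (F q) (V q)]
  {U : Opens B}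

universe u v

namespace ExtAlg

variable {X T : Type*} [NormedAddCommGroup X] [NormedSpace ℝ X] [NormedAddCommGroup T]
  [NormedSpace ℝ T]

/-- The directional derivative of a family of inhomogeneous forms. -/
def dirDeriv (v : X) (a : X → ExtAlg T) (x : X) : ExtAlg T :=
  fun p => fderiv ℝ (fun x => a x p) x v

theorem dirDeriv_apply (v : X) (a : X → ExtAlg T) (x : X) (p : ℕ) :
    dirDeriv v a x p = fderiv ℝ (fun x => a x p) x v := rfl

theorem dirDeriv_congr {v : X} {a b : X → ExtAlg T} {x : X} (h : a =ᶠ[𝓝 x] b) :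
    dirDeriv v a x = dirDeriv v b x := by
  ext1 p
  exact congrArg (fun L : X →L[ℝ] _ => L v)
    (Filter.EventuallyEq.fderiv_eq (h.mono fun y hy => congrFun hy p))

theorem Smooth.dirDeriv {a : X → ExtAlg T} {x : X} (ha : Smooth a x) (v : X) :
    Smooth (ExtAlg.dirDeriv v a) x := fun p =>
  ((ha p).fderiv_right (m := ∞) (by simp)).clm_apply contDiffAt_const

theorem dirDeriv_sum {ι : Type*} {s : Finset ι} {a : ι → X → ExtAlg T} {x : X} (v : X)
    (h : ∀ i ∈ s, Smooth (a i) x) :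
    dirDeriv v (fun x => ∑ i ∈ s, a i x) x = ∑ i ∈ s, dirDeriv v (a i) x := by
  ext1 p
  rw [sum_apply]
  simp only [dirDeriv_apply, sum_apply]
  rw [fderiv_fun_sum fun i hi => (h i hi p).differentiableAt (by simp)]
  exact _root_.sum_apply _ _ _

theorem dirDeriv_mul {a b : X → ExtAlg T} {x : X} (v : X) (ha : Smooth a x) (hb : Smooth b x) :
    dirDeriv v (fun x => a x * b x) x = dirDeriv v a x * b x + a x * dirDeriv v b x := by
  ext1 p
  simp only [dirDeriv_apply, mul_apply, Pi.add_apply]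
  have h1 : ∀ i ∈ Finset.HasAntidiagonal.antidiagonal p, HasFDerivAt
      (fun x => castForm (i.1 + i.2) p (wedge (a x i.1) (b x i.2)))
      ((castForm (i.1 + i.2) p).comp (((isBoundedBilinearMap_wedge i.1 i.2).deriv
        (a x i.1, b x i.2)).comp ((fderiv ℝ (fun x => a x i.1) x).prod
          (fderiv ℝ (fun x => b x i.2) x)))) x := by
    intro i _
    have h2 := IsBoundedBilinearMap.hasFDerivAt_comp (isBoundedBilinearMap_wedge i.1 i.2)
      ((ha i.1).differentiableAt (by simp)).hasFDerivAt
      ((hb i.2).differentiableAt (by simp)).hasFDerivAt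
    exact (HasFDerivAt.comp x (ContinuousLinearMap.hasFDerivAt
      (castForm (T := T) (N := ℂ) (i.1 + i.2) p)) h2 :)
  rw [(HasFDerivAt.fun_sum h1).fderiv, _root_.sum_apply, ← Finset.sum_add_distrib]
  refine Finset.sum_congr rfl fun i _ => ?_
  rw [ContinuousLinearMap.comp_apply, ContinuousLinearMap.comp_apply,
    IsBoundedBilinearMap.deriv_apply, map_add, add_comm]
  rfl

theorem contr_extD_eq {a : T → ExtAlg T} {w : T} (ha : Smooth a w) {v : T}
    (h : ∀ᶠ w' in 𝓝 w, contr v (a w') = 0) : contr v (extD a w) = dirDeriv v a w := by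
  ext1 p
  exact contr_extD ha.diff h p

theorem Smooth.extD {a : T → ExtAlg T} {w : T} (ha : Smooth a w) :
    Smooth (ExtAlg.extD a) w := by
  intro p
  cases p with
  | zero => exact contDiffAt_const
  | succ p => exact contDiffAt_extDeriv (ha p)

theorem extD_sum {ι : Type*} {s : Finset ι} {a : ι → T → ExtAlg T} {w : T}
    (h : ∀ i ∈ s, Smooth (a i) w) :
    extD (fun w => ∑ i ∈ s, a i w) w = ∑ i ∈ s, extD (a i) w := by
  ext1 p
  rw [sum_apply]
  cases p with
  | zero => exact (Finset.sum_eq_zero fun i _ => rfl).symm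
  | succ p =>
    change extDeriv (fun w => (∑ i ∈ s, a i w) p) w = _
    simp only [sum_apply]
    exact extDeriv_sum s fun i hi => (h i hi p).differentiableAt (by simp)

theorem extD_add {a b : T → ExtAlg T} {w : T} (ha : Smooth a w) (hb : Smooth b w) :
    extD (fun w => a w + b w) w = extD a w + extD b w := by
  ext1 p
  cases p with
  | zero => exact (add_zero _).symm
  | succ p => exact extDeriv_fun_add (ha.diff p) (hb.diff p)

theorem extD_sub {a b : T → ExtAlg T} {w : T} (ha : Smooth a w) (hb : Smooth b w) :
    extD (fun w => a w - b w) w = extD a w - extD b w := by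
  have h := extD_add (ha.sub hb) hb
  simp only [sub_add_cancel] at h
  exact eq_sub_of_add_eq h.symm

theorem extD_ne_zero {a : T → ExtAlg T} {w : T} {p : ℕ} (h : extD a w p ≠ 0) :
    ∃ r w', r + 1 = p ∧ a w' r ≠ 0 := by
  cases p with
  | zero => exact (h rfl).elim
  | succ p =>
    by_contra! hne
    refine h ?_
    have h1 : (fun w => a w p) = fun _ => 0 := funext fun w' => hne p w' rfl
    change extDeriv (fun w => a w p) w = 0
    rw [h1, extDeriv, fderiv_fun_const]
    exact alternatizeUncurryFin_zero

theorem Smooth.comp {Y : Type*} [NormedAddCommGroup Y] [NormedSpace ℝ Y] {a : X → ExtAlg T}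
    {f : Y → X} {y : Y} (ha : Smooth a (f y)) (hf : ContDiffAt ℝ ∞ f y) :
    Smooth (fun y => a (f y)) y := fun p => (ha p).comp y hf

end ExtAlg

section Primitive

open ExtAlg

variable {𝓙 : Type v} {X : Type u} [NormedAddCommGroup X] [NormedSpace ℝ X]
  [FiniteDimensional ℝ X]

/-- The hypotheses on the matrices of a flat superconnection and on the coefficients of a closed
form, pulled back to the cylinder `O × ℝ`: `P` is the projection onto the bundle, `Θ` the connection
matrix, and `om` the closed form of degree `m`. The finite set `J` contains the generators of small
degree only, so that the identities for the rows of `P` and `Θ` are restricted to degrees below `m`;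
these are the only rows that act on a primitive of `om`. -/
structure CylinderData (O : Set X) (J : Finset 𝓙) (d : 𝓙 → ℕ) (m : ℕ)
    (P Θ : X × ℝ → 𝓙 → 𝓙 → ExtAlg (X × ℝ)) (om : X × ℝ → 𝓙 → ExtAlg (X × ℝ)) : Prop where
  smooth_P : ∀ i j, ∀ x ∈ O, ∀ t, Smooth (fun w => P w i j) (x, t)
  smooth_Θ : ∀ i j, ∀ x ∈ O, ∀ t, Smooth (fun w => Θ w i j) (x, t)
  smooth_om : ∀ j, ∀ x ∈ O, ∀ t, Smooth (fun w => om w j) (x, t)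
  degree_P : ∀ w i j p, P w i j p ≠ 0 → p = 0 ∧ d i = d j
  degree_Θ : ∀ w i j p, Θ w i j p ≠ 0 → p + d j = d i + 1
  degree_om : ∀ w j p, om w j p ≠ 0 → p + d j = m
  P_mul_P : ∀ x ∈ O, ∀ t, ∀ i, d i < m → ∀ j,
    ∑ k ∈ J, P (x, t) i k * P (x, t) k j = P (x, t) i j
  Θ_mul_P : ∀ x ∈ O, ∀ t, ∀ i, d i < m → ∀ j,
    ∑ k ∈ J, Θ (x, t) i k * P (x, t) k j = Θ (x, t) i j
  om_mul_P : ∀ x ∈ O, ∀ t, ∀ j, ∑ k ∈ J, om (x, t) k * P (x, t) k j = om (x, t) j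
  connection : ∀ x ∈ O, ∀ t, ∀ i, d i < m → ∀ j, Θ (x, t) i j =
    ∑ k ∈ J, (extD (fun w => P w i k) (x, t) * P (x, t) k j + P (x, t) i k * Θ (x, t) k j)
  flat : ∀ x ∈ O, ∀ t, ∀ i, d i < m → ∀ j,
    ∑ k ∈ J, (extD (fun w => Θ w i k) (x, t) * P (x, t) k j + eps (Θ (x, t) i k) * Θ (x, t) k j) = 0
  closed : ∀ x ∈ O, ∀ t, ∀ j,
    ∑ k ∈ J, (extD (fun w => om w k) (x, t) * P (x, t) k j + eps (om (x, t) k) * Θ (x, t) k j) = 0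

/-- The superconnection `a ↦ da P + ε(a) Θ`: the coefficients of `D (∑ₖ aₖ sₖ)` for generating
sections `sₖ`, where `sₖ` has the coefficients `Pₖⱼ` and `D sₖ` has the coefficients `Θₖⱼ`. -/
def matrixOp (J : Finset 𝓙) (P Θ : X × ℝ → 𝓙 → 𝓙 → ExtAlg (X × ℝ))
    (a : X × ℝ → 𝓙 → ExtAlg (X × ℝ)) (w : X × ℝ) (j : 𝓙) : ExtAlg (X × ℝ) :=
  ∑ k ∈ J, (extD (fun w => a w k) w * P w k j + eps (a w k) * Θ w k j)

variable {O : Set X} {J : Finset 𝓙} {d : 𝓙 → ℕ} {m : ℕ}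
  {P Θ : X × ℝ → 𝓙 → 𝓙 → ExtAlg (X × ℝ)} {om : X × ℝ → 𝓙 → ExtAlg (X × ℝ)}

theorem CylinderData.smooth_matrixOp (H : CylinderData O J d m P Θ om)
    {a : X × ℝ → 𝓙 → ExtAlg (X × ℝ)} {x : X} {t : ℝ} (hx : x ∈ O)
    (ha : ∀ j, Smooth (fun w => a w j) (x, t)) (j : 𝓙) :
    Smooth (fun w => matrixOp J P Θ a w j) (x, t) :=
  Smooth.sum fun k _ => ((ha k).extD.mul (H.smooth_P k j x hx t)).add
    ((ha k).eps.mul (H.smooth_Θ k j x hx t))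

theorem CylinderData.matrixOp_hasTotalDegree (H : CylinderData O J d m P Θ om)
    {a : X × ℝ → 𝓙 → ExtAlg (X × ℝ)} (ha : ∀ w, HasTotalDegree J (fun j => d j + 1) m (a w))
    {w : X × ℝ} {j : 𝓙} {p : ℕ} (h : matrixOp J P Θ a w j p ≠ 0) : p + d j = m := by
  rw [matrixOp, ExtAlg.sum_apply] at h
  obtain ⟨i, hi, h⟩ := Finset.exists_ne_zero_of_sum_ne_zero h
  by_cases h1 : (extD (fun w => a w i) w * P w i j) p = 0
  · have h2 : (eps (a w i) * Θ w i j) p ≠ 0 := by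
      intro h2
      refine h ?_
      rw [Pi.add_apply, h1, h2, add_zero]
    obtain ⟨r, k, hrk, hr, hk⟩ := exists_of_mul_apply_ne_zero h2
    have h3 : a w i r ≠ 0 := by
      intro h3
      refine hr ?_
      rw [eps_apply, h3]
      exact smul_zero (A := (X × ℝ) [⋀^Fin r]→L[ℝ] ℂ) ((-1 : ℂ) ^ r)
    have h4 : r + (d i + 1) = m := (ha w i r h3).2
    have h5 := H.degree_Θ w i j k hk
    omega
  · obtain ⟨r, k, hrk, hr, hk⟩ := exists_of_mul_apply_ne_zero h1
    obtain ⟨r', w', hr', hr⟩ := extD_ne_zero hr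
    have h4 : r' + (d i + 1) = m := (ha w' i r' hr).2
    have h5 := H.degree_P w i j k hk
    omega

theorem eq_zero_of_hasTotalDegree {T : Type*} [NormedAddCommGroup T] [NormedSpace ℝ T]
    {a : 𝓙 → ExtAlg T} (ha : HasTotalDegree J (fun j => d j + 1) m a) {i : 𝓙} (hi : ¬ d i < m) :
    a i = 0 := by
  ext1 p
  by_contra h
  have h1 : p + (d i + 1) = m := (ha i p h).2
  omega

/-- The square of a flat superconnection vanishes, in matrix form. -/
theorem CylinderData.matrixOp_matrixOp (H : CylinderData O J d m P Θ om)
    {a : X × ℝ → 𝓙 → ExtAlg (X × ℝ)} (hd : ∀ w, HasTotalDegree J (fun j => d j + 1) m (a w))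
    (ha : ∀ x ∈ O, ∀ t, ∀ j, Smooth (fun w => a w j) (x, t)) {x : X} (hx : x ∈ O) (t : ℝ) (j : 𝓙) :
    matrixOp J P Θ (matrixOp J P Θ a) (x, t) j = 0 := by
  have hP := fun i j => H.smooth_P i j x hx t
  have hΘ := fun i j => H.smooth_Θ i j x hx t
  have ha' := ha x hx t
  have h1 : ∀ k, extD (fun w => matrixOp J P Θ a w k) (x, t) = ∑ i ∈ J,
      (eps (extD (fun w => a w i) (x, t)) * extD (fun w => P w i k) (x, t)
        - eps (extD (fun w => a w i) (x, t)) * Θ (x, t) i k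
        + a (x, t) i * extD (fun w => Θ w i k) (x, t)) := by
    intro k
    unfold matrixOp
    rw [extD_sum fun i _ => ((ha' i).extD.mul (hP i k)).add ((ha' i).eps.mul (hΘ i k))]
    refine Finset.sum_congr rfl fun i _ => ?_
    rw [extD_add ((ha' i).extD.mul (hP i k)) ((ha' i).eps.mul (hΘ i k)),
      extD_mul (ha' i).extD.diff (hP i k).diff, extD_mul (ha' i).eps.diff (hΘ i k).diff,
      extD_extD (ha' i), extD_eps, eps_eps, zero_mul, zero_add, neg_mul]
    abel
  have h2 : ∀ k, eps (matrixOp J P Θ a (x, t) k) = ∑ i ∈ J,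
      (eps (extD (fun w => a w i) (x, t)) * P (x, t) i k
        + a (x, t) i * eps (Θ (x, t) i k)) := by
    intro k
    rw [matrixOp, map_sum]
    refine Finset.sum_congr rfl fun i _ => ?_
    rw [map_add, map_mul, map_mul, eps_eps, eps_eq_self (a := P (x, t) i k)]
    intro p hp
    by_contra hne
    exact hp (H.degree_P _ _ _ _ hne).1
  rw [matrixOp]
  simp only [h1, h2, Finset.sum_mul]
  simp only [← Finset.sum_add_distrib]
  rw [Finset.sum_comm]
  refine Finset.sum_eq_zero fun i _ => ?_
  by_cases hi : d i < m
  · have h3 : ∑ k ∈ J, ((eps (extD (fun w => a w i) (x, t)) * extD (fun w => P w i k) (x, t)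
        - eps (extD (fun w => a w i) (x, t)) * Θ (x, t) i k
        + a (x, t) i * extD (fun w => Θ w i k) (x, t)) * P (x, t) k j +
        (eps (extD (fun w => a w i) (x, t)) * P (x, t) i k
        + a (x, t) i * eps (Θ (x, t) i k)) * Θ (x, t) k j) =
      eps (extD (fun w => a w i) (x, t)) * (∑ k ∈ J, (extD (fun w => P w i k) (x, t) * P (x, t) k j
        + P (x, t) i k * Θ (x, t) k j) - ∑ k ∈ J, Θ (x, t) i k * P (x, t) k j) +
      a (x, t) i * ∑ k ∈ J, (extD (fun w => Θ w i k) (x, t) * P (x, t) k j +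
        eps (Θ (x, t) i k) * Θ (x, t) k j) := by
      rw [← Finset.sum_sub_distrib, Finset.mul_sum, Finset.mul_sum, ← Finset.sum_add_distrib]
      exact Finset.sum_congr rfl fun k _ => by noncomm_ring
    rw [h3, H.flat x hx t i hi, ← H.connection x hx t i hi, H.Θ_mul_P x hx t i hi, sub_self,
      mul_zero, mul_zero, add_zero]
  · have h4 : ∀ w, a w i = 0 := fun w => eq_zero_of_hasTotalDegree (hd w) hi
    have h5 : extD (fun w => a w i) (x, t) = 0 := by
      ext1 p
      by_contra hne
      obtain ⟨r, w', -, hr⟩ := extD_ne_zero hne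
      exact hr (congrFun (h4 w') r)
    refine Finset.sum_eq_zero fun k _ => ?_
    rw [h5, h4, map_zero]
    simp

/-- The transport equation `∂ₜ a = ι_∂t (om - ε(a) Θ)`. For a family `a` without component along
`∂t`, and with `a P = a`, it is the contraction of `matrixOp J P Θ a = om` with `∂t`. -/
def IsTransport (O : Set X) (J : Finset 𝓙) (Θ : X × ℝ → 𝓙 → 𝓙 → ExtAlg (X × ℝ))
    (om : X × ℝ → 𝓙 → ExtAlg (X × ℝ)) (a : X × ℝ → 𝓙 → ExtAlg (X × ℝ)) : Prop :=
  ∀ x ∈ O, ∀ t, ∀ j ∈ J, dirDeriv (0, 1) (fun w => a w j) (x, t) =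
    contr (0, 1) (om (x, t) j) - ∑ i ∈ J, contr (0, 1) (eps (a (x, t) i) * Θ (x, t) i j)

theorem hasDerivAt_of_smooth {T : Type*} [NormedAddCommGroup T] [NormedSpace ℝ T]
    {a : X × ℝ → ExtAlg T} {x : X} {t : ℝ} (ha : Smooth a (x, t)) (p : ℕ) :
    HasDerivAt (fun t => a (x, t) p) (dirDeriv (0, 1) a (x, t) p) t := by
  have h1 : HasDerivAt (fun t : ℝ => (x, t)) ((0 : X), (1 : ℝ)) t :=
    (hasDerivAt_const t x).prodMk (hasDerivAt_id t)
  exact HasFDerivAt.comp_hasDerivAt t (f := fun t : ℝ => (x, t)) (l := fun w => a w p)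
    ((ha p).differentiableAt (by simp)).hasFDerivAt h1

theorem smooth_prodMk {T : Type*} [NormedAddCommGroup T] [NormedSpace ℝ T]
    {a : X × ℝ → ExtAlg T} {x : X} {t : ℝ} (ha : Smooth a (x, t)) :
    Smooth (fun t => a (x, t)) t :=
  ha.comp (f := fun t : ℝ => (x, t)) (contDiff_prodMk_right x).contDiffAt

theorem eq_of_dirDeriv_eq_zero {T : Type*} [NormedAddCommGroup T] [NormedSpace ℝ T]
    {a : X × ℝ → ExtAlg T} {x : X} (ha : ∀ t, Smooth a (x, t))
    (h : ∀ t, dirDeriv (0, 1) a (x, t) = 0) (t t' : ℝ) : a (x, t) = a (x, t') := by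
  ext1 p
  have h1 : ∀ t, HasDerivAt (fun t => a (x, t) p) 0 t := by
    intro t
    have h2 := hasDerivAt_of_smooth (ha t) p
    rwa [h t] at h2
  exact is_const_of_deriv_eq_zero (fun t => (h1 t).differentiableAt) (fun t => (h1 t).deriv) t t'

theorem dirDeriv_contr {Y T : Type*} [NormedAddCommGroup Y] [NormedSpace ℝ Y]
    [NormedAddCommGroup T] [NormedSpace ℝ T] {a : Y → ExtAlg T} {y : Y}
    (ha : Smooth a y) (v : Y) (u : T) :
    dirDeriv v (fun y => contr u (a y)) y = contr u (dirDeriv v a y) := by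
  ext1 p
  rw [dirDeriv_apply]
  have h1 : HasFDerivAt (fun y => contr u (a y) p)
      ((contrCLM u p).comp (fderiv ℝ (fun y => a y (p + 1)) y)) y :=
    HasFDerivAt.comp y (f := fun y => a y (p + 1)) (contrCLM u p).hasFDerivAt
      ((ha (p + 1)).differentiableAt (by simp)).hasFDerivAt
  rw [h1.fderiv]
  rfl

/-- A transported family has no component along the cylinder if it has none initially. -/
theorem IsTransport.contr_eq_zero {a : X × ℝ → 𝓙 → ExtAlg (X × ℝ)} (h : IsTransport O J Θ om a)
    (ha : ∀ x ∈ O, ∀ t, ∀ j, Smooth (fun w => a w j) (x, t))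
    {x : X} (hx : x ∈ O) {j : 𝓙} (hj : j ∈ J) {t₀ : ℝ} (h0 : contr (0, 1) (a (x, t₀) j) = 0)
    (t : ℝ) : contr (0, 1) (a (x, t) j) = 0 := by
  refine (eq_of_dirDeriv_eq_zero (a := fun w => contr (0, 1) (a w j))
    (fun t => (ha x hx t j).contr _) (fun t => ?_) t t₀).trans h0
  rw [dirDeriv_contr (ha x hx t j), h x hx t j hj]
  simp [contr_contr]

theorem transportOp_zero {T : Type*} [NormedAddCommGroup T] [NormedSpace ℝ T] (J : Finset 𝓙)
    (v : T) (A B : 𝓙 → 𝓙 → ExtAlg T) (j : 𝓙) (p : ℕ) :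
    (transportOp J v A B 0 j + (0 : 𝓙 → ExtAlg T) j) p = 0 := by
  rw [transportOp_apply]
  simp

set_option maxHeartbeats 800000 in
/-- A solution of the transport equation is a primitive of the closed form on the whole cylinder if
it is one at the time `t₀`. The defect `D a - om` has no component along the cylinder, by the
transport equation, and is closed, so that it satisfies the homogeneous transport equation. As it
is zero at the time `t₀`, it is zero. -/
theorem CylinderData.matrixOp_eq (H : CylinderData O J d m P Θ om) (hO : IsOpen O)
    {a : X × ℝ → 𝓙 → ExtAlg (X × ℝ)} (hd : ∀ w, HasTotalDegree J (fun j => d j + 1) m (a w))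
    (ha : ∀ x ∈ O, ∀ t, ∀ j, Smooth (fun w => a w j) (x, t)) (hat : IsTransport O J Θ om a)
    {t₀ : ℝ} (h0 : ∀ x ∈ O, ∀ j ∈ J, contr (0, 1) (a (x, t₀) j) = 0)
    (h0' : ∀ x ∈ O, ∀ j ∈ J, matrixOp J P Θ a (x, t₀) j = om (x, t₀) j)
    {x : X} (hx : x ∈ O) (t : ℝ) {j : 𝓙} (hj : j ∈ J) :
    matrixOp J P Θ a (x, t) j = om (x, t) j := by
  classical
  have hnear : ∀ {x : X}, x ∈ O → ∀ t : ℝ, ∀ᶠ w in 𝓝 (x, t), w.1 ∈ O := fun hx t =>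
    continuousAt_fst (hO.mem_nhds hx)
  have hPe : ∀ w i j p, p ≠ 0 → P w i j p = 0 := by
    intro w i j p hp
    by_contra hne
    exact hp (H.degree_P _ _ _ _ hne).1
  have hιa : ∀ x ∈ O, ∀ t, ∀ j, contr (0, 1) (a (x, t) j) = 0 := by
    intro x hx t j
    by_cases hj : j ∈ J
    · exact hat.contr_eq_zero ha hx hj (h0 x hx j hj) t
    · have h1 : a (x, t) j = 0 := by
        ext1 p
        by_contra hne
        exact hj (hd _ j p hne).1
      rw [h1, map_zero]
  -- Cartan: without component along the cylinder, contracting `da` gives `∂ₜ a`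
  have hιda : ∀ x ∈ O, ∀ t, ∀ j, contr (0, 1) (extD (fun w => a w j) (x, t)) =
      dirDeriv (0, 1) (fun w => a w j) (x, t) := fun x hx t j =>
    contr_extD_eq (ha x hx t j) ((hnear hx t).mono fun w hw => hιa w.1 hw w.2 j)
  -- the defect, set to zero off `J` so that it is a family of total degree `m`
  set c : X × ℝ → 𝓙 → ExtAlg (X × ℝ) := fun w j =>
    if j ∈ J then matrixOp J P Θ a w j - om w j else 0 with hc
  have hcJ : ∀ w, ∀ j ∈ J, c w j = matrixOp J P Θ a w j - om w j := fun w j hj => if_pos hj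
  have hcs : ∀ x ∈ O, ∀ t, ∀ j ∈ J, Smooth (fun w => c w j) (x, t) := by
    intro x hx t j hj
    simp only [hcJ _ j hj]
    exact (H.smooth_matrixOp hx (ha x hx t) j).sub (H.smooth_om j x hx t)
  have hcd : ∀ w, HasTotalDegree J d m (c w) := by
    intro w j p hne
    by_cases hj : j ∈ J
    · refine ⟨hj, ?_⟩
      rw [hcJ w j hj] at hne
      by_cases h1 : matrixOp J P Θ a w j p = 0
      · refine H.degree_om w j p fun h2 => hne ?_
        rw [Pi.sub_apply, h1, h2, sub_zero]
      · exact H.matrixOp_hasTotalDegree hd h1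
    · exact (hne (congrFun (if_neg hj) p)).elim
  -- the transport equation says that the defect has no component along the cylinder
  have hcι : ∀ x ∈ O, ∀ t, ∀ j ∈ J, contr (0, 1) (c (x, t) j) = 0 := by
    intro x hx t j hj
    have h1 : ∑ k ∈ J, dirDeriv (0, 1) (fun w => a w k) (x, t) * P (x, t) k j =
        dirDeriv (0, 1) (fun w => a w j) (x, t) := by
      rw [hat x hx t j hj]
      have h2 : ∀ k ∈ J, dirDeriv (0, 1) (fun w => a w k) (x, t) * P (x, t) k j =
          contr (0, 1) (om (x, t) k * P (x, t) k j) - ∑ i ∈ J, contr (0, 1)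
            (eps (a (x, t) i) * (Θ (x, t) i k * P (x, t) k j)) := by
        intro k hk
        rw [hat x hx t k hk, sub_mul, contr_mul_of_right _ _ (hPe _ _ _), Finset.sum_mul]
        congr 1
        refine Finset.sum_congr rfl fun i _ => ?_
        rw [← contr_mul_of_right _ _ (hPe _ _ _), mul_assoc]
      rw [Finset.sum_congr rfl h2, Finset.sum_sub_distrib, ← map_sum, H.om_mul_P x hx t j,
        Finset.sum_comm]
      congr 1
      refine Finset.sum_congr rfl fun i _ => ?_
      rw [← map_sum, ← Finset.mul_sum]
      by_cases hi : d i < m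
      · rw [H.Θ_mul_P x hx t i hi]
      · rw [eq_zero_of_hasTotalDegree (hd (x, t)) hi, map_zero, zero_mul, zero_mul]
    rw [hcJ _ j hj, map_sub, matrixOp, map_sum]
    simp only [map_add, contr_mul_of_right _ _ (hPe _ _ _), hιda x hx t]
    rw [Finset.sum_add_distrib, h1, hat x hx t j hj]
    abel
  have hcP : ∀ x ∈ O, ∀ t, ∀ j ∈ J, ∑ k ∈ J, c (x, t) k * P (x, t) k j = c (x, t) j := by
    intro x hx t j hj
    rw [hcJ _ j hj, Finset.sum_congr rfl fun k hk => by rw [hcJ _ k hk, sub_mul],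
      Finset.sum_sub_distrib, H.om_mul_P x hx t j]
    congr 1
    simp only [matrixOp, Finset.sum_mul]
    rw [Finset.sum_comm]
    refine Finset.sum_congr rfl fun i _ => ?_
    simp only [add_mul, mul_assoc]
    rw [Finset.sum_add_distrib, ← Finset.mul_sum, ← Finset.mul_sum]
    by_cases hi : d i < m
    · rw [H.Θ_mul_P x hx t i hi, H.P_mul_P x hx t i hi]
    · have h4 : ∀ w, a w i = 0 := fun w => eq_zero_of_hasTotalDegree (hd w) hi
      have h5 : extD (fun w => a w i) (x, t) = 0 := by
        ext1 p
        by_contra hne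
        obtain ⟨r, w', -, hr⟩ := extD_ne_zero hne
        exact hr (congrFun (h4 w') r)
      rw [h5, h4, map_zero, zero_mul, zero_mul, zero_mul, zero_mul]
  -- the defect is closed, as `D² a = 0` and `D om = 0`
  have hDc : ∀ x ∈ O, ∀ t, ∀ j, matrixOp J P Θ c (x, t) j = 0 := by
    intro x hx t j
    have h1 := H.matrixOp_matrixOp hd ha hx t j
    have h2 := H.closed x hx t j
    rw [matrixOp] at h1 ⊢
    rw [← sub_eq_zero.2 (h1.trans h2.symm), ← Finset.sum_sub_distrib]
    refine Finset.sum_congr rfl fun k hk => ?_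
    rw [hcJ _ k hk, show (fun w => c w k) = fun w => matrixOp J P Θ a w k - om w k from
      funext fun w => hcJ w k hk, extD_sub (H.smooth_matrixOp hx (ha x hx t) k)
      (H.smooth_om k x hx t), map_sub]
    noncomm_ring
  -- contract `D c = 0` with `∂t`, and differentiate `c = c P`
  have hct : ∀ x ∈ O, ∀ t, ∀ j ∈ J, dirDeriv (0, 1) (fun w => c w j) (x, t) =
      transportOp J (0, 1) (fun k j => dirDeriv (0, 1) (fun w => P w k j) (x, t)) (Θ (x, t))
        (c (x, t)) j := by
    intro x hx t j hj
    have hPs := fun i j => H.smooth_P i j x hx t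
    have h1 : (fun w => c w j) =ᶠ[𝓝 (x, t)] fun w => ∑ k ∈ J, c w k * P w k j :=
      (hnear hx t).mono fun w hw => (hcP w.1 hw w.2 j hj).symm
    rw [dirDeriv_congr h1, dirDeriv_sum _ fun k hk => (hcs x hx t k hk).mul (hPs k j),
      transportOp_apply]
    have h2 : ∀ k ∈ J, dirDeriv (0, 1) (fun w => c w k * P w k j) (x, t) =
        contr (0, 1) (extD (fun w => c w k) (x, t) * P (x, t) k j) +
          c (x, t) k * dirDeriv (0, 1) (fun w => P w k j) (x, t) := by
      intro k hk
      rw [dirDeriv_mul _ (hcs x hx t k hk) (hPs k j), contr_mul_of_right _ _ (hPe _ _ _),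
        contr_extD_eq (hcs x hx t k hk) ((hnear hx t).mono fun w hw => hcι w.1 hw w.2 k hk)]
    have h3 := congrArg (contr (0, 1)) (hDc x hx t j)
    rw [matrixOp, map_sum, map_zero] at h3
    rw [← sub_eq_zero, ← h3, ← Finset.sum_sub_distrib]
    refine Finset.sum_congr rfl fun k hk => ?_
    rw [h2 k hk, map_add]
    abel
  have hzero : (fun t => c (x, t)) = fun _ => 0 := by
    refine transport_unique (J := J) (q := d) (m := m) (v := (0, 1)) (b := fun _ => 0) (t₀ := t₀)
      (A := fun t k j => dirDeriv (0, 1) (fun w => P w k j) (x, t)) (B := fun t => Θ (x, t))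
      (fun i _ j _ t => smooth_prodMk ((H.smooth_P i j x hx t).dirDeriv _))
      (fun i _ j _ t => smooth_prodMk (H.smooth_Θ i j x hx t)) (fun t => hcd (x, t))
      (fun t j p hne => (hne rfl).elim) (fun t j hj p => ?_) (fun t j hj p => ?_) ?_
    · have h1 := hasDerivAt_of_smooth (hcs x hx t j hj) p
      rw [hct x hx t j hj] at h1
      simpa using h1
    · rw [transportOp_zero]
      exact hasDerivAt_const t _
    · funext j
      by_cases hj : j ∈ J
      · rw [hcJ _ j hj, h0' x hx j hj, sub_self]
        rfl
      · exact if_neg hj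
  exact sub_eq_zero.1 ((hcJ _ j hj).symm.trans (congrFun (congrFun hzero t) j))

end Primitive

end CylinderPrimitive

/-! ### Pull back of superconnections to cylinders -/

section Cylinders

attribute [local instance] continuousSMul_real

open Filter Set Topology

set_option linter.unusedSectionVars false

universe uB

variable {E : Type*} [NormedAddCommGroup E] [NormedSpace ℝ E] [FiniteDimensional ℝ E]
  {B : Type uB} [TopologicalSpace B] [T2Space B] [SecondCountableTopology B]
  [ChartedSpace E B] [IsManifold 𝓘(ℝ, E) ∞ B]
  {F : ℕ → Type*} [∀ q, NormedAddCommGroup (F q)] [∀ q, NormedSpace ℂ (F q)]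
  {V : ℕ → B → Type*} [∀ q, TopologicalSpace (TotalSpace (F q) (V q))]
  [∀ q x, AddCommGroup (V q x)] [∀ q x, Module ℂ (V q x)] [∀ q x, TopologicalSpace (V q x)]
  [∀ q x, IsTopologicalAddGroup (V q x)] [∀ q x, ContinuousSMul ℂ (V q x)]
  [∀ q, FiberBundle (F q) (V q)] [∀ q, VectorBundle ℂ (F q) (V q)]
  [∀ q, VectorBundle ℝ (F q) (V q)]
  {U : Opens B}

/-- Smooth paths `t ↦ path (y, t)` in `U` from the base point `x` to the points `y` of `U`, the path
to `x` itself being a loop that is even in `t`. -/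
structure SmoothPaths (E : Type*) [NormedAddCommGroup E] [NormedSpace ℝ E] {B : Type*}
    [TopologicalSpace B] [ChartedSpace E B] (U : Opens B) (x : B) where
  /-- The paths. -/
  path : B × ℝ → B
  mem : ∀ y ∈ U, ∀ t, path (y, t) ∈ U
  smooth : ∀ y ∈ U, ∀ t, ContMDiffAt (𝓘(ℝ, E).prod 𝓘(ℝ, ℝ)) 𝓘(ℝ, E) ∞ path (y, t)
  eq_start : ∀ y ∈ U, ∀ t ≤ -1, path (y, t) = x
  eq_end : ∀ y ∈ U, ∀ t, 1 ≤ t → path (y, t) = y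
  even : ∀ t, path (x, -t) = path (x, t)

variable {x : B} (C : SmoothPaths E U x)

/-- The paths ending near `y₀`, in the preferred chart at `y₀`. -/
def SmoothPaths.cyl (y₀ : B) (w : E × ℝ) : B :=
  C.path ((extChartAt 𝓘(ℝ, E) y₀).symm w.1, w.2)

variable {C}

theorem SmoothPaths.contMDiffAt_cyl {y₀ : B} {u : E} (hu : u ∈ (extChartAt 𝓘(ℝ, E) y₀).target)
    (huU : (extChartAt 𝓘(ℝ, E) y₀).symm u ∈ U) (t : ℝ) :
    ContMDiffAt 𝓘(ℝ, E × ℝ) 𝓘(ℝ, E) ∞ (C.cyl y₀) (u, t) := by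
  have h1 : ContMDiffAt 𝓘(ℝ, E) 𝓘(ℝ, E) ∞ (extChartAt 𝓘(ℝ, E) y₀).symm u :=
    (contMDiffOn_extChartAt_symm y₀).contMDiffAt ((isOpen_extChartAt_target y₀).mem_nhds hu)
  have h2 : ContMDiffAt 𝓘(ℝ, E × ℝ) 𝓘(ℝ, E) ∞
      (fun w : E × ℝ => (extChartAt 𝓘(ℝ, E) y₀).symm w.1) (u, t) :=
    ContMDiffAt.comp (u, t) (f := fun w : E × ℝ => w.1) h1 contDiff_fst.contMDiff.contMDiffAt
  have h3 : ContMDiffAt 𝓘(ℝ, E × ℝ) 𝓘(ℝ, ℝ) ∞ (fun w : E × ℝ => w.2) (u, t) :=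
    contDiff_snd.contMDiff.contMDiffAt
  exact ContMDiffAt.comp (u, t) (f := fun w : E × ℝ =>
    ((extChartAt 𝓘(ℝ, E) y₀).symm w.1, w.2)) (C.smooth _ huU t) (h2.prodMk h3)

variable {g : ∀ q, Generators E (F q) (V q)}

/-- The paths ending near `y₀` stay in a compact set, so only finitely many generators matter along
them. -/
theorem exists_nhds_completeAt (C : SmoothPaths E U x) (g : ∀ q, Generators E (F q) (V q)) (N : ℕ)
    {y₀ : B} (hy₀ : y₀ ∈ U) : ∃ O : Set E, IsOpen O ∧ extChartAt 𝓘(ℝ, E) y₀ y₀ ∈ O ∧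
      O ⊆ (extChartAt 𝓘(ℝ, E) y₀).target ∧ (∀ u ∈ O, (extChartAt 𝓘(ℝ, E) y₀).symm u ∈ U) ∧
      ∃ J : Finset (GenIdx g), ∀ u ∈ O, ∀ t, CompleteAt J N (C.cyl y₀ (u, t)) := by
  have : LocallyCompactSpace B := ChartedSpace.locallyCompactSpace E B
  obtain ⟨Q, hQ, hyQ, hQU⟩ := exists_compact_subset U.isOpen hy₀
  have hK : IsCompact (C.path '' (Q ×ˢ Icc (-1) 1)) :=
    (hQ.prod isCompact_Icc).image_of_continuousOn fun p hp =>
      (C.smooth p.1 (hQU hp.1) p.2).continuousAt.continuousWithinAt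
  have hmem : ∀ y ∈ Q, ∀ t, C.path (y, t) ∈ C.path '' (Q ×ˢ Icc (-1) 1) := by
    intro y hy t
    rcases le_total t (-1) with h | h
    · exact ⟨(y, -1), ⟨hy, by norm_num⟩, by
        rw [C.eq_start y (hQU hy) t h, C.eq_start y (hQU hy) _ le_rfl]⟩
    · rcases le_total 1 t with h' | h'
      · exact ⟨(y, 1), ⟨hy, by norm_num⟩, by
          rw [C.eq_end y (hQU hy) t h', C.eq_end y (hQU hy) _ le_rfl]⟩
      · exact ⟨(y, t), ⟨hy, h, h'⟩, rfl⟩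
  have hfin : {j : GenIdx g | j.1 ≤ N ∧
      ((g j.1).S j.2 ∩ C.path '' (Q ×ˢ Icc (-1) 1)).Nonempty}.Finite := by
    refine ((Set.finite_Iic N).biUnion fun q _ =>
      ((g q).locallyFinite.finite_nonempty_inter_compact hK).image (Sigma.mk q)).subset ?_
    rintro ⟨q, i⟩ ⟨hq, hi⟩
    exact mem_biUnion hq (mem_image_of_mem _ hi)
  set φ := extChartAt 𝓘(ℝ, E) y₀ with hφ
  refine ⟨φ.target ∩ φ.symm ⁻¹' interior Q,
    (continuousOn_extChartAt_symm y₀).isOpen_inter_preimage (isOpen_extChartAt_target y₀)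
      isOpen_interior, ⟨mem_extChartAt_target y₀, ?_⟩, inter_subset_left,
    fun u hu => hQU (interior_subset hu.2), hfin.toFinset, fun u hu t j hj hjS => ?_⟩
  · rw [mem_preimage, hφ, extChartAt_to_inv]
    exact hyQ
  · exact hfin.mem_toFinset.2 ⟨hj, _, hjS, hmem _ (interior_subset hu.2) t⟩

theorem pullback_coef {k : E × ℝ → B} (j : GenIdx g) (η : TotalForm E F V U) (w : E × ℝ) :
    pullback k (coef j η) w = ExtAlg.pull (derivAt E k w) (coefAt j (k w) η) := rfl

theorem pullback_coef_ne_zero {k : E × ℝ → B} {j : GenIdx g} {η : TotalForm E F V U} {w : E × ℝ}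
    {p : ℕ} (h : pullback k (coef j η) w p ≠ 0) : η (p, j.1) ≠ 0 := by
  intro h0
  refine h ?_
  rw [pullback_coef, ExtAlg.pull_apply, coefAt_apply, h0, map_zero]
  rfl

theorem genForm_apply_ne_zero {i : GenIdx g} {k : ℕ × ℕ} (h : genForm U i k ≠ 0) : k = (0, i.1) := by
  by_contra hne
  refine h ?_
  rw [genForm, DirectSum.lof_eq_of, DirectSum.of_eq_of_ne _ _ _ hne]

/-- The matrices of a flat superconnection and the coefficients of a closed form, pulled back to
a cylinder. -/
theorem cylinderData (D : Superconnection E F V U) (hD : D.IsFlat) {m : ℕ} {ξ : TotalForm E F V U}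
    (hξ : ξ ∈ degreePart totalDegree (fun i => Form E (F i.2) (V i.2) i.1 U) m) (hDξ : D.op ξ = 0)
    {O : Set E} {k : E × ℝ → B} (hk : ∀ u ∈ O, ∀ t, ContMDiffAt 𝓘(ℝ, E × ℝ) 𝓘(ℝ, E) ∞ k (u, t))
    (hkU : ∀ u ∈ O, ∀ t, k (u, t) ∈ U) {J : Finset (GenIdx g)}
    (hJ : ∀ u ∈ O, ∀ t, CompleteAt J (m + 1) (k (u, t))) :
    CylinderData O J (fun j : GenIdx g => j.1) m
      (fun w i j => pullback k (coef j (genForm U i)) w)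
      (fun w i j => pullback k (coef j (D.op (genForm U i))) w)
      (fun w j => pullback k (coef j ξ) w) := by
  have hDD : ∀ ζ, D.op (D.op ζ) = 0 := fun ζ => LinearMap.congr_fun hD ζ
  have hξN : ∀ i : ℕ × ℕ, m + 1 < i.2 → ξ i = 0 := fun i hi => hξ i (by
    rw [totalDegree]
    omega)
  have hgN : ∀ (i : GenIdx g), i.1 < m → ∀ l : ℕ × ℕ, m + 1 < l.2 → genForm U i l = 0 := by
    intro i hi l hl
    by_contra hne
    have h1 : l.2 = i.1 := congrArg Prod.snd (genForm_apply_ne_zero hne)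
    omega
  have hDgN : ∀ (i : GenIdx g), i.1 < m → ∀ l : ℕ × ℕ, m + 1 < l.2 → D.op (genForm U i) l = 0 :=
    fun i hi l hl => op_genForm_apply D i (by omega)
  have hproj : ∀ (η : TotalForm E F V U), (∀ i : ℕ × ℕ, m + 1 < i.2 → η i = 0) →
      ∀ u ∈ O, ∀ t, ∀ j : GenIdx g,
      ∑ l ∈ J, pullback k (coef l η) (u, t) * pullback k (coef j (genForm U l)) (u, t) =
        pullback k (coef j η) (u, t) := by
    intro η hη u hu t j
    have h1 := congrArg (ExtAlg.pull (derivAt E k (u, t)))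
      (sum_coefAt_mul (hkU u hu t) (hJ u hu t) hη j)
    rw [map_sum] at h1
    simpa only [map_mul, ← pullback_coef] using h1
  have hop : ∀ (η : TotalForm E F V U), (∀ i : ℕ × ℕ, m + 1 < i.2 → η i = 0) →
      ∀ u ∈ O, ∀ t, ∀ j : GenIdx g,
      pullback k (coef j (D.op η)) (u, t) =
      ∑ l ∈ J, (ExtAlg.extD (pullback k (coef l η)) (u, t) *
          pullback k (coef j (genForm U l)) (u, t) +
        ExtAlg.eps (pullback k (coef l η) (u, t)) *
          pullback k (coef j (D.op (genForm U l))) (u, t)) := by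
    intro η hη u hu t j
    rw [pullback_coef, coefAt_op D (hkU u hu t) (hJ u hu t) hη j, map_sum]
    refine Finset.sum_congr rfl fun l _ => ?_
    rw [map_add, map_mul, map_mul, ExtAlg.pull_eps, extD_pullback (hk u hu t) (hkU u hu t)]
    rfl
  refine
    { smooth_P := fun i j u hu t => contDiffAt_pullback (hk u hu t) (hkU u hu t) _
      smooth_Θ := fun i j u hu t => contDiffAt_pullback (hk u hu t) (hkU u hu t) _
      smooth_om := fun j u hu t => contDiffAt_pullback (hk u hu t) (hkU u hu t) _
      degree_P := fun w i j p h => ?_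
      degree_Θ := fun w i j p h => ?_
      degree_om := fun w j p h => ?_
      P_mul_P := fun u hu t i hi j => hproj _ (hgN i hi) u hu t j
      Θ_mul_P := fun u hu t i hi j => hproj _ (hDgN i hi) u hu t j
      om_mul_P := fun u hu t j => hproj _ hξN u hu t j
      connection := fun u hu t i hi j => ?_
      flat := fun u hu t i hi j => ?_
      closed := fun u hu t j => ?_ }
  · have h1 := genForm_apply_ne_zero (pullback_coef_ne_zero h)
    exact ⟨congrArg Prod.fst h1, (congrArg Prod.snd h1).symm⟩
  · by_contra hne
    exact pullback_coef_ne_zero h (op_genForm_apply D i hne)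
  · by_contra hne
    exact pullback_coef_ne_zero h (hξ (p, j.1) hne)
  · rw [hop _ (hgN i hi) u hu t j]
    refine Finset.sum_congr rfl fun l _ => ?_
    rw [ExtAlg.eps_eq_self (a := pullback k (coef l (genForm U i)) (u, t))]
    intro p hp
    by_contra hne
    exact hp (congrArg Prod.fst (genForm_apply_ne_zero (pullback_coef_ne_zero hne)))
  · have h1 := hop _ (hDgN i hi) u hu t j
    rw [hDD, pullback_coef, map_zero, map_zero] at h1
    exact h1.symm
  · have h1 := hop _ hξN u hu t j
    rw [hDξ, pullback_coef, map_zero, map_zero] at h1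
    exact h1.symm

theorem CompleteAt.coefAt_eq_zero {J : Finset (GenIdx g)} {N : ℕ} {z : B} (hJ : CompleteAt J N z)
    {j : GenIdx g} (hj : j ∉ J) {η : TotalForm E F V U} (hη : ∀ i : ℕ × ℕ, N < i.2 → η i = 0) :
    coefAt j z η = 0 := by
  by_cases hjN : j.1 ≤ N
  · exact coefAt_eq_zero_of_notMem j (fun h => hj (hJ j hjN h)) η
  · ext1 p
    rw [coefAt_apply, hη _ (not_le.1 hjN), map_zero]
    rfl

end Cylinders

/-! ### Transport along paths in a chart -/

section PathTransport

attribute [local instance] continuousSMul_real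

open Filter Set Topology

set_option linter.unusedSectionVars false

universe uB

variable {E : Type*} [NormedAddCommGroup E] [NormedSpace ℝ E] [FiniteDimensional ℝ E]
  {B : Type uB} [TopologicalSpace B] [T2Space B] [SecondCountableTopology B]
  [ChartedSpace E B] [IsManifold 𝓘(ℝ, E) ∞ B]
  {F : ℕ → Type*} [∀ q, NormedAddCommGroup (F q)] [∀ q, NormedSpace ℂ (F q)]
  {V : ℕ → B → Type*} [∀ q, TopologicalSpace (TotalSpace (F q) (V q))]
  [∀ q x, AddCommGroup (V q x)] [∀ q x, Module ℂ (V q x)] [∀ q x, TopologicalSpace (V q x)]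
  [∀ q x, IsTopologicalAddGroup (V q x)] [∀ q x, ContinuousSMul ℂ (V q x)]
  [∀ q, FiberBundle (F q) (V q)] [∀ q, VectorBundle ℂ (F q) (V q)]
  [∀ q, VectorBundle ℝ (F q) (V q)]
  {U : Opens B}

open ExtAlg

variable {x : B} {g : ∀ q, Generators E (F q) (V q)}

/-- A solution of the transport equation along the paths ending near `y₀`. The initial time is `-2`
rather than `-1`, since the paths are stationary on a neighbourhood of it. The transport equation is
recorded for all larger sets of generators, so that solutions in two charts can be compared. -/
structure LocalTransport (C : SmoothPaths E U x) (g : ∀ q, Generators E (F q) (V q))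
    (D : Superconnection E F V U) (m : ℕ) (ξ : TotalForm E F V U) (y₀ : B) where
  /-- The set of end points of the paths, in the preferred chart at `y₀`. -/
  O : Set E
  /-- The relevant generators. -/
  J : Finset (GenIdx g)
  /-- The solution. -/
  a : E × ℝ → GenIdx g → ExtAlg (E × ℝ)
  isOpen : IsOpen O
  mem : extChartAt 𝓘(ℝ, E) y₀ y₀ ∈ O
  subset : O ⊆ (extChartAt 𝓘(ℝ, E) y₀).target
  mem_U : ∀ u ∈ O, (extChartAt 𝓘(ℝ, E) y₀).symm u ∈ U
  complete : ∀ u ∈ O, ∀ t, CompleteAt J (m + 1) (C.cyl y₀ (u, t))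
  smooth : ∀ u ∈ O, ∀ t, ∀ j, Smooth (fun w => a w j) (u, t)
  degree : ∀ u, HasTotalDegree J (fun j : GenIdx g => j.1 + 1) m (a u)
  init : ∀ u ∈ O, a (u, -2) = 0
  transport : ∀ J', J ⊆ J' → IsTransport O J'
    (fun w i j => pullback (C.cyl y₀) (coef j (D.op (genForm U i))) w)
    (fun w j => pullback (C.cyl y₀) (coef j ξ) w) a

variable {C : SmoothPaths E U x} {D : Superconnection E F V U} {m : ℕ} {ξ : TotalForm E F V U}

/-- The transport equation for the generators that matter near the paths has a solution; the
equations for further generators hold trivially, as all their terms vanish. -/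
theorem nonempty_localTransport (C : SmoothPaths E U x) (g : ∀ q, Generators E (F q) (V q))
    (hD : D.IsFlat)
    (hξ : ξ ∈ degreePart totalDegree (fun i => Form E (F i.2) (V i.2) i.1 U) m) (hDξ : D.op ξ = 0)
    {y₀ : B} (hy₀ : y₀ ∈ U) :
    Nonempty (LocalTransport C g D m ξ y₀) := by
  obtain ⟨O, hO, hyO, hOt, hOU, J, hJ⟩ := exists_nhds_completeAt C g (m + 1) hy₀
  have hkU : ∀ u ∈ O, ∀ t, C.cyl y₀ (u, t) ∈ U := fun u hu t => C.mem _ (hOU u hu) t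
  have H := cylinderData D hD hξ hDξ (fun u hu t => C.contMDiffAt_cyl (hOt hu) (hOU u hu) t) hkU hJ
  obtain ⟨a, ha, had, ha0, ha'⟩ := exists_transport (v := ((0 : E), (1 : ℝ))) hO (J := J)
    (q := fun j : GenIdx g => j.1 + 1) (m := m) (A := fun _ _ _ => 0)
    (B := fun w i j => pullback (C.cyl y₀) (coef j (D.op (genForm U i))) w)
    (b := fun w j => contr (0, 1) (pullback (C.cyl y₀) (coef j ξ) w)) (c := fun _ _ => 0)
    (fun i _ j _ u hu t => Smooth.const _ _) (fun i _ j _ u hu t => H.smooth_Θ i j u hu t)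
    (fun j _ u hu t => (H.smooth_om j u hu t).contr _) (fun j _ u hu => Smooth.const _ _)
    (fun w i j p h => (h rfl).elim) (fun w i j p h => by
      have h1 := H.degree_Θ w i j p h
      omega) (fun w j p h => by
      have h1 : pullback (C.cyl y₀) (coef j ξ) w (p + 1) ≠ 0 := by
        intro h1
        refine h ?_
        rw [contr_apply, h1, ContinuousAlternatingMap.curryLeft_zero]
        rfl
      have h2 := H.degree_om w j (p + 1) h1
      omega) (fun _ j p h => (h rfl).elim) (-2)
  have hξN : ∀ i : ℕ × ℕ, m + 1 < i.2 → ξ i = 0 := fun i hi => hξ i (by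
    rw [totalDegree]
    omega)
  refine ⟨⟨O, J, a, hO, hyO, hOt, hOU, hJ, ha, had, ha0, fun J' hJJ' u hu t j hj => ?_⟩⟩
  have haJ : ∀ i ∉ J, ∀ w, a w i = 0 := by
    intro i hi w
    ext1 p
    by_contra hne
    exact hi (had w i p hne).1
  rw [← Finset.sum_subset hJJ' fun i _ hi => by rw [haJ i hi, map_zero, zero_mul, map_zero]]
  by_cases hjJ : j ∈ J
  · ext1 p
    refine (hasDerivAt_of_smooth (ha u hu t j) p).unique ((ha' u hu t j hjJ p).congr_deriv ?_)
    rw [transportOp_apply]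
    simp [sub_eq_neg_add]
  · have h1 : pullback (C.cyl y₀) (coef j ξ) (u, t) = 0 := by
      rw [pullback_coef, (hJ u hu t).coefAt_eq_zero hjJ hξN, map_zero]
    have h2 : ∀ i ∈ J, contr (0, 1) (eps (a (u, t) i) *
        pullback (C.cyl y₀) (coef j (D.op (genForm U i))) (u, t)) = 0 := by
      intro i _
      by_cases hi : i.1 < m
      · rw [pullback_coef, (hJ u hu t).coefAt_eq_zero hjJ (fun l hl =>
          op_genForm_apply D i (by omega)), map_zero, mul_zero, map_zero]
      · rw [eq_zero_of_hasTotalDegree (d := fun j : GenIdx g => j.1) (had (u, t)) hi, map_zero,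
          zero_mul, map_zero]
    beta_reduce
    rw [h1, map_zero, Finset.sum_eq_zero h2, sub_zero]
    ext1 p
    have h3 : (fun w => a w j p) = fun _ => 0 := funext fun w => by
      rw [haJ j hjJ w]
      rfl
    rw [dirDeriv_apply, h3, fderiv_const_apply]
    rfl

theorem hasFDerivAt_extChartAt_change {y₀ z : B} (hz : z ∈ (chartAt E y₀).source) :
    HasFDerivAt (fun u => extChartAt 𝓘(ℝ, E) y₀ ((extChartAt 𝓘(ℝ, E) z).symm u))
      (tangentCoordChange 𝓘(ℝ, E) z y₀ z) (extChartAt 𝓘(ℝ, E) z z) := by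
  have h1 := hasFDerivWithinAt_tangentCoordChange (I := 𝓘(ℝ, E)) (x := z) (y := y₀) (z := z)
    ⟨mem_extChartAt_source _, by simpa using hz⟩
  simp only [modelWithCornersSelf_coe, Set.range_id, hasFDerivWithinAt_univ] at h1
  exact h1

theorem cyl_extChartAt {y₀ z : B} (hz : z ∈ (chartAt E y₀).source) (t : ℝ) :
    C.cyl y₀ (extChartAt 𝓘(ℝ, E) y₀ z, t) = C.path (z, t) := by
  rw [SmoothPaths.cyl, (extChartAt 𝓘(ℝ, E) y₀).left_inv (by simpa using hz)]

/-- The cylinders in two charts differ by the change of charts on the end points. -/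
theorem derivAt_cyl_comp {y₀ z : B} (hz : z ∈ (chartAt E y₀).source) (hzU : z ∈ U) (t : ℝ) :
    (derivAt E (C.cyl y₀) (extChartAt 𝓘(ℝ, E) y₀ z, t)).comp
      ((tangentCoordChange 𝓘(ℝ, E) z y₀ z).prodMap (ContinuousLinearMap.id ℝ ℝ)) =
    derivAt E (C.cyl z) (extChartAt 𝓘(ℝ, E) z z, t) := by
  have hz' : z ∈ (extChartAt 𝓘(ℝ, E) y₀).source := by simpa using hz
  have h1 : HasFDerivAt (fun w : E × ℝ =>
      (extChartAt 𝓘(ℝ, E) y₀ ((extChartAt 𝓘(ℝ, E) z).symm w.1), w.2))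
      ((tangentCoordChange 𝓘(ℝ, E) z y₀ z).prodMap (ContinuousLinearMap.id ℝ ℝ))
      (extChartAt 𝓘(ℝ, E) z z, t) :=
    HasFDerivAt.prodMap (f := fun u => extChartAt 𝓘(ℝ, E) y₀ ((extChartAt 𝓘(ℝ, E) z).symm u))
      (f₂ := fun s : ℝ => s) (p := (extChartAt 𝓘(ℝ, E) z z, t))
      (hasFDerivAt_extChartAt_change hz) (hasFDerivAt_id t)
  have hk : ContMDiffAt 𝓘(ℝ, E × ℝ) 𝓘(ℝ, E) ∞ (C.cyl y₀) (extChartAt 𝓘(ℝ, E) y₀ z, t) :=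
    C.contMDiffAt_cyl ((extChartAt 𝓘(ℝ, E) y₀).map_source hz')
      (by rwa [(extChartAt 𝓘(ℝ, E) y₀).left_inv hz']) t
  have h2 : HasFDerivAt (fun w => extChartAt 𝓘(ℝ, E) (C.path (z, t)) (C.cyl y₀ w))
      (derivAt E (C.cyl y₀) (extChartAt 𝓘(ℝ, E) y₀ z, t)) (extChartAt 𝓘(ℝ, E) y₀ z, t) := by
    have h3 := (contDiffAt_extChartAt_comp le_rfl hk
      (mem_chart_source E (C.cyl y₀ (extChartAt 𝓘(ℝ, E) y₀ z, t)))).differentiableAt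
      (by simp)
    have h4 := h3.hasFDerivAt
    rw [derivAt]
    rwa [cyl_extChartAt hz] at h4 ⊢
  have h3 : HasFDerivAt (fun w : E × ℝ => extChartAt 𝓘(ℝ, E) (C.path (z, t)) (C.cyl y₀
      (extChartAt 𝓘(ℝ, E) y₀ ((extChartAt 𝓘(ℝ, E) z).symm w.1), w.2)))
      ((derivAt E (C.cyl y₀) (extChartAt 𝓘(ℝ, E) y₀ z, t)).comp
      ((tangentCoordChange 𝓘(ℝ, E) z y₀ z).prodMap (ContinuousLinearMap.id ℝ ℝ)))
      (extChartAt 𝓘(ℝ, E) z z, t) := by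
    refine HasFDerivAt.comp (g := fun w => extChartAt 𝓘(ℝ, E) (C.path (z, t)) (C.cyl y₀ w))
      (extChartAt 𝓘(ℝ, E) z z, t) ?_ h1
    simpa only [extChartAt_to_inv] using h2
  have h5 : derivAt E (C.cyl z) (extChartAt 𝓘(ℝ, E) z z, t) = fderiv ℝ
      (fun w => extChartAt 𝓘(ℝ, E) (C.path (z, t)) (C.cyl z w)) (extChartAt 𝓘(ℝ, E) z z, t) := by
    rw [← cyl_extChartAt (mem_chart_source E z)]
    rfl
  rw [h5]
  refine (h3.congr_of_eventuallyEq ?_).fderiv.symm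
  have h4 : ∀ᶠ w : E × ℝ in 𝓝 (extChartAt 𝓘(ℝ, E) z z, t),
      (extChartAt 𝓘(ℝ, E) z).symm w.1 ∈ (extChartAt 𝓘(ℝ, E) y₀).source := by
    have h5 : ContinuousAt (fun w : E × ℝ => (extChartAt 𝓘(ℝ, E) z).symm w.1)
        (extChartAt 𝓘(ℝ, E) z z, t) :=
      ContinuousAt.comp (f := fun w : E × ℝ => w.1) (continuousAt_extChartAt_symm z) continuousAt_fst
    refine h5.preimage_mem_nhds ?_
    simp only [extChartAt_to_inv]
    exact extChartAt_source_mem_nhds' hz'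
  filter_upwards [h4] with w hw
  rw [SmoothPaths.cyl, SmoothPaths.cyl, (extChartAt 𝓘(ℝ, E) y₀).left_inv hw]

end PathTransport

/-! ### Independence of the chart -/

section Gluing

attribute [local instance] continuousSMul_real

open Filter Set Topology

set_option linter.unusedSectionVars false

universe uB

variable {E : Type*} [NormedAddCommGroup E] [NormedSpace ℝ E] [FiniteDimensional ℝ E]
  {B : Type uB} [TopologicalSpace B] [T2Space B] [SecondCountableTopology B]
  [ChartedSpace E B] [IsManifold 𝓘(ℝ, E) ∞ B]
  {F : ℕ → Type*} [∀ q, NormedAddCommGroup (F q)] [∀ q, NormedSpace ℂ (F q)]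
  {V : ℕ → B → Type*} [∀ q, TopologicalSpace (TotalSpace (F q) (V q))]
  [∀ q x, AddCommGroup (V q x)] [∀ q x, Module ℂ (V q x)] [∀ q x, TopologicalSpace (V q x)]
  [∀ q x, IsTopologicalAddGroup (V q x)] [∀ q x, ContinuousSMul ℂ (V q x)]
  [∀ q, FiberBundle (F q) (V q)] [∀ q, VectorBundle ℂ (F q) (V q)]
  [∀ q, VectorBundle ℝ (F q) (V q)]
  {U : Opens B}

open ExtAlg

/-- The pull back, in a single degree, as a continuous linear map. -/
def ExtAlg.pullCLM {T T' : Type*} [NormedAddCommGroup T] [NormedSpace ℝ T]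
    [NormedAddCommGroup T'] [NormedSpace ℝ T'] (f : T' →L[ℝ] T) (p : ℕ) :
    T [⋀^Fin p]→L[ℝ] ℂ →L[ℝ] T' [⋀^Fin p]→L[ℝ] ℂ :=
  ContinuousAlternatingMap.compContinuousLinearMapCLM f

variable {x : B} {g : ∀ q, Generators E (F q) (V q)}
  {C : SmoothPaths E U x} {D : Superconnection E F V U} {m : ℕ} {ξ : TotalForm E F V U}

theorem IsTransport.hasDerivAt {𝓙 X : Type*} [NormedAddCommGroup X]
    [NormedSpace ℝ X] [FiniteDimensional ℝ X] {O : Set X} {J : Finset 𝓙}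
    {Θ : X × ℝ → 𝓙 → 𝓙 → ExtAlg (X × ℝ)} {om a : X × ℝ → 𝓙 → ExtAlg (X × ℝ)}
    (h : IsTransport O J Θ om a) {u : X} (hu : u ∈ O) {t : ℝ} {j : 𝓙} (hj : j ∈ J)
    (ha : Smooth (fun w => a w j) (u, t)) (p : ℕ) :
    HasDerivAt (fun t => a (u, t) j p)
      ((transportOp J (0, 1) (fun _ _ => 0) (Θ (u, t)) (a (u, t)) j + contr (0, 1) (om (u, t) j)) p)
      t := by
  have h1 := hasDerivAt_of_smooth ha p
  rw [h u hu t j hj] at h1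
  convert h1 using 2
  rw [transportOp_apply]
  simp [sub_eq_neg_add]

/-- The derivative of the change of charts at `z`, on the cylinder. -/
def cylChange (y₀ z : B) : E × ℝ →L[ℝ] E × ℝ :=
  (tangentCoordChange 𝓘(ℝ, E) z y₀ z).prodMap (ContinuousLinearMap.id ℝ ℝ)

theorem cylChange_apply (y₀ z : B) : cylChange y₀ z ((0 : E), (1 : ℝ)) = (0, 1) := by
  simp [cylChange]

theorem pull_cylChange_pullback {y₀ z : B} (hz : z ∈ (chartAt E y₀).source) (hzU : z ∈ U) (t : ℝ)
    (α : ∀ p, ScalarForm E p U) :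
    pull (cylChange y₀ z) (pullback (C.cyl y₀) α (extChartAt 𝓘(ℝ, E) y₀ z, t)) =
      pullback (C.cyl z) α (extChartAt 𝓘(ℝ, E) z z, t) := by
  rw [pullback, pullback, pull_pull, cylChange, derivAt_cyl_comp hz hzU, cyl_extChartAt hz,
    cyl_extChartAt (mem_chart_source E z)]

/-- The solutions of the transport equation in different charts agree, by uniqueness. -/
theorem LocalTransport.pull_eq {y₀ z : B} (L : LocalTransport C g D m ξ y₀)
    (L' : LocalTransport C g D m ξ z) (hz : z ∈ (chartAt E y₀).source) (hzU : z ∈ U)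
    (hzO : extChartAt 𝓘(ℝ, E) y₀ z ∈ L.O) (t : ℝ) (j : GenIdx g) :
    pull (cylChange y₀ z) (L.a (extChartAt 𝓘(ℝ, E) y₀ z, t) j) =
      L'.a (extChartAt 𝓘(ℝ, E) z z, t) j := by
  classical
  have hcyl : ∀ t, ContMDiffAt 𝓘(ℝ, E × ℝ) 𝓘(ℝ, E) ∞ (C.cyl z) (extChartAt 𝓘(ℝ, E) z z, t) :=
    fun t => C.contMDiffAt_cyl (mem_extChartAt_target z) (by rwa [extChartAt_to_inv]) t
  have hcylU : ∀ t, C.cyl z (extChartAt 𝓘(ℝ, E) z z, t) ∈ U := fun t => by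
    rw [cyl_extChartAt (mem_chart_source E z)]
    exact C.mem z hzU t
  have key := transport_unique (J := L.J ∪ L'.J) (q := fun j : GenIdx g => j.1 + 1) (m := m)
    (v := ((0 : E), (1 : ℝ))) (A := fun _ _ _ => 0)
    (B := fun t i j => pullback (C.cyl z) (coef j (D.op (genForm U i)))
      (extChartAt 𝓘(ℝ, E) z z, t))
    (b := fun t j => contr (0, 1) (pullback (C.cyl z) (coef j ξ) (extChartAt 𝓘(ℝ, E) z z, t)))
    (f := fun t j => pull (cylChange y₀ z) (L.a (extChartAt 𝓘(ℝ, E) y₀ z, t) j))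
    (h := fun t j => L'.a (extChartAt 𝓘(ℝ, E) z z, t) j) (t₀ := -2)
    (fun i _ j _ t => Smooth.const _ _)
    (fun i _ j _ t => smooth_prodMk (fun p => contDiffAt_pullback (hcyl t) (hcylU t) _ p))
    (fun t j p hne => ?_) (fun t j p hne => ?_) (fun t j hj p => ?_) (fun t j hj p => ?_) ?_
  · exact congrFun (congrFun key t) j
  · have h1 : L.a (extChartAt 𝓘(ℝ, E) y₀ z, t) j p ≠ 0 := by
      intro h1
      refine hne ?_
      beta_reduce
      rw [pull_apply, h1]
      rfl
    exact ⟨Finset.mem_union_left _ (L.degree _ j p h1).1, (L.degree _ j p h1).2⟩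
  · exact ⟨Finset.mem_union_right _ (L'.degree _ j p hne).1, (L'.degree _ j p hne).2⟩
  · have h1 := (L.transport _ Finset.subset_union_left).hasDerivAt hzO hj (L.smooth _ hzO t j) p
    have h2 := (pullCLM (T := E × ℝ) (T' := E × ℝ) (cylChange y₀ z) p).hasFDerivAt.comp_hasDerivAt t h1
    refine h2.congr_deriv ?_
    change (pull (T := E × ℝ) (T' := E × ℝ) (cylChange y₀ z) (transportOp _ _ _ _ _ _ + _)) p = _
    have h3 : ∀ a : ExtAlg (E × ℝ), pull (cylChange y₀ z) (contr (0, 1) a) =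
        contr (0, 1) (pull (cylChange y₀ z) a) := fun a => by
      rw [contr_pull, cylChange_apply]
    rw [map_add, transportOp_apply, transportOp_apply, map_sum, h3,
      pull_cylChange_pullback hz hzU]
    simp only [map_sub, map_mul, map_zero, mul_zero, h3, pull_eps, pull_cylChange_pullback hz hzU]
  · exact (L'.transport _ Finset.subset_union_right).hasDerivAt L'.mem hj (L'.smooth _ L'.mem t j) p
  · funext j
    rw [L.init _ hzO, L'.init _ L'.mem]
    exact map_zero _

/-- The inclusion of the end of the cylinder, on tangent vectors. -/
abbrev cylEnd (E : Type*) [NormedAddCommGroup E] [NormedSpace ℝ E] : E →L[ℝ] E × ℝ :=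
  ContinuousLinearMap.inl ℝ E ℝ

/-- The value at `z` of the transported coefficient: the solution at the time `2`, near which the
paths are stationary, restricted to the end of the cylinder. -/
def endValue (L : ∀ z ∈ U, LocalTransport C g D m ξ z) (j : GenIdx g) (z : B) (p : ℕ) :
    FormFibre E (Bundle.Trivial B ℂ) p z :=
  open Classical in
  if hz : z ∈ U then (show E [⋀^Fin p]→L[ℝ] ℂ from
    pull (cylEnd E) ((L z hz).a (extChartAt 𝓘(ℝ, E) z z, 2) j) p) else 0

/-- In the chart at `y₀`, the value at the end of the paths is that of the solution in the chart at
`y₀`, in particular it is smooth. -/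
theorem coordForm_endValue (L : ∀ z ∈ U, LocalTransport C g D m ξ z) (j : GenIdx g) (p : ℕ)
    {y₀ z : B} (hy₀ : y₀ ∈ U) (hz : z ∈ (chartAt E y₀).source) (hzU : z ∈ U)
    (hzO : extChartAt 𝓘(ℝ, E) y₀ z ∈ (L y₀ hy₀).O) :
    coordForm ℂ (Bundle.Trivial B ℂ) y₀ (fun z => endValue L j z p) z =
      pull (cylEnd E) ((L y₀ hy₀).a (extChartAt 𝓘(ℝ, E) y₀ z, 2) j) p := by
  rw [coordForm_trivial _ _ _ hz]
  have h1 : endValue L j z p = (show E [⋀^Fin p]→L[ℝ] ℂ from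
      pull (cylEnd E) (pull (cylChange y₀ z) ((L y₀ hy₀).a (extChartAt 𝓘(ℝ, E) y₀ z, 2) j)) p) := by
    rw [(L y₀ hy₀).pull_eq (L z hzU) hz hzU hzO]
    exact dif_pos hzU
  simp only [h1]
  ext v
  refine congrArg ((L y₀ hy₀).a (extChartAt 𝓘(ℝ, E) y₀ z, 2) j p) (funext fun i => ?_)
  have hz' : z ∈ (extChartAt 𝓘(ℝ, E) y₀).source := by simpa using hz
  have h2 := mem_extChartAt_source (I := 𝓘(ℝ, E)) z
  refine Prod.ext ?_ rfl
  refine (tangentCoordChange_comp (I := 𝓘(ℝ, E)) ⟨⟨hz', h2⟩, hz'⟩).trans ?_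
  exact tangentCoordChange_self hz'

theorem eventually_mem_localTransport {y₀ : B} (L : LocalTransport C g D m ξ y₀) (hy₀ : y₀ ∈ U) :
    ∀ᶠ z in 𝓝 y₀, z ∈ (chartAt E y₀).source ∧ z ∈ U ∧ extChartAt 𝓘(ℝ, E) y₀ z ∈ L.O := by
  filter_upwards [chart_source_mem_nhds E y₀, U.isOpen.mem_nhds hy₀,
    (continuousAt_extChartAt (I := 𝓘(ℝ, E)) y₀).preimage_mem_nhds (L.isOpen.mem_nhds L.mem)]
    with z h1 h2 h3
  exact ⟨h1, h2, h3⟩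

/-- The transported coefficients at the end of the paths, as differential forms. -/
def endForm (L : ∀ z ∈ U, LocalTransport C g D m ξ z) (j : GenIdx g) (p : ℕ) :
    ScalarForm E p U :=
  ⟨fun z => endValue L j z p, by
    refine ⟨?_, fun z hz => dif_neg hz⟩
    rw [isSmoothOn_iff]
    intro y₀ hy₀
    have h1 : ContMDiffAt 𝓘(ℝ, E) 𝓘(ℝ, E [⋀^Fin p]→L[ℝ] ℂ) ∞ (fun z : B =>
        pull (cylEnd E) ((L y₀ hy₀).a (extChartAt 𝓘(ℝ, E) y₀ z, 2) j) p) y₀ := by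
      have h2 : ContDiffAt ℝ ∞ (fun u : E => pull (cylEnd E) ((L y₀ hy₀).a (u, 2) j) p)
          (extChartAt 𝓘(ℝ, E) y₀ y₀) :=
        (pullCLM (cylEnd E) p).contDiff.contDiffAt.comp _ (ContDiffAt.comp (f := fun u : E => (u, (2 : ℝ))) _
            ((L y₀ hy₀).smooth _ (L y₀ hy₀).mem 2 j p) (contDiff_prodMk_left (2 : ℝ)).contDiffAt)
      exact ContMDiffAt.comp y₀ h2.contMDiffAt contMDiffAt_extChartAt
    refine h1.congr_of_eventuallyEq ?_
    filter_upwards [eventually_mem_localTransport (L y₀ hy₀) hy₀] with z hz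
    exact coordForm_endValue L j p hy₀ hz.1 hz.2.1 hz.2.2⟩

theorem formVal_endForm (L : ∀ z ∈ U, LocalTransport C g D m ξ z) (j : GenIdx g) {z : B}
    (hz : z ∈ U) : formVal (endForm L j) z =
      pull (cylEnd E) ((L z hz).a (extChartAt 𝓘(ℝ, E) z z, 2) j) := by
  ext1 p
  exact dif_pos hz

/-- The exterior derivative commutes with the restriction to the end of the cylinder. -/
theorem formVal_formD_endForm (L : ∀ z ∈ U, LocalTransport C g D m ξ z) (j : GenIdx g) {z : B}
    (hz : z ∈ U) : formVal (formD (endForm L j)) z =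
      pull (cylEnd E) (extD (fun w => (L z hz).a w j) (extChartAt 𝓘(ℝ, E) z z, 2)) := by
  ext1 p
  cases p with
  | zero => rfl
  | succ p =>
    refine (ScalarForm.d_apply (endForm L j p) hz).trans ?_
    change extDeriv _ _ = (extDeriv _ _).compContinuousLinearMap _
    have h1 : (fun y => coordForm ℂ (Bundle.Trivial B ℂ) z (endForm L j p).1
        ((extChartAt 𝓘(ℝ, E) z).symm y)) =ᶠ[𝓝 (extChartAt 𝓘(ℝ, E) z z)]
        fun u => ((L z hz).a (u, 2) j p).compContinuousLinearMap
          (fderiv ℝ (fun u : E => (u, (2 : ℝ))) u) := by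
      filter_upwards [extChartAt_target_mem_nhds (I := 𝓘(ℝ, E)) z,
        (L z hz).isOpen.mem_nhds (L z hz).mem] with u hu huO
      have h2 := (extChartAt 𝓘(ℝ, E) z).right_inv hu
      have h3 := coordForm_endValue L j p hz (z := (extChartAt 𝓘(ℝ, E) z).symm u)
        (by simpa using (extChartAt 𝓘(ℝ, E) z).map_target hu) ((L z hz).mem_U u huO)
        (by rwa [h2])
      rw [h2] at h3
      refine h3.trans ?_
      rw [(hasFDerivAt_prodMk_left u (2 : ℝ)).fderiv]
      rfl
    have h2 : ContDiffAt ℝ ∞ (fun u : E => (u, (2 : ℝ))) (extChartAt 𝓘(ℝ, E) z z) :=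
      (contDiff_prodMk_left (2 : ℝ)).contDiffAt
    rw [h1.extDeriv_eq, extDeriv_pullback (f := fun u : E => (u, (2 : ℝ)))
      (((L z hz).smooth _ (L z hz).mem 2 j p).differentiableAt (by simp)) h2
      (by rw [minSmoothness_of_isRCLikeNormedField]; exact WithTop.coe_le_coe.2 le_top),
      (hasFDerivAt_prodMk_left _ (2 : ℝ)).fderiv]

end Gluing

/-! ### The primitive on the cylinder and its value at the base point -/

section LoopTransport

attribute [local instance] continuousSMul_real

open Filter Set Topology

set_option linter.unusedSectionVars false

universe uB

variable {E : Type*} [NormedAddCommGroup E] [NormedSpace ℝ E] [FiniteDimensional ℝ E]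
  {B : Type uB} [TopologicalSpace B] [T2Space B] [SecondCountableTopology B]
  [ChartedSpace E B] [IsManifold 𝓘(ℝ, E) ∞ B]
  {F : ℕ → Type*} [∀ q, NormedAddCommGroup (F q)] [∀ q, NormedSpace ℂ (F q)]
  {V : ℕ → B → Type*} [∀ q, TopologicalSpace (TotalSpace (F q) (V q))]
  [∀ q x, AddCommGroup (V q x)] [∀ q x, Module ℂ (V q x)] [∀ q x, TopologicalSpace (V q x)]
  [∀ q x, IsTopologicalAddGroup (V q x)] [∀ q x, ContinuousSMul ℂ (V q x)]
  [∀ q, FiberBundle (F q) (V q)] [∀ q, VectorBundle ℂ (F q) (V q)]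
  [∀ q, VectorBundle ℝ (F q) (V q)]
  {U : Opens B}

open ExtAlg

section Pullback

variable {W W' : Type*} [NormedAddCommGroup W] [NormedSpace ℝ W] [NormedAddCommGroup W']
  [NormedSpace ℝ W']

theorem pull_pullback {k : W → B} {f : W' → W} {w : W'} {f' : W' →L[ℝ] W}
    (hk : ContMDiffAt 𝓘(ℝ, W) 𝓘(ℝ, E) ∞ k (f w)) (hf : HasFDerivAt f f' w)
    (α : ∀ p, ScalarForm E p U) :
    pull f' (pullback k α (f w)) = pullback (fun w => k (f w)) α w := by
  have h1 : derivAt E (fun w => k (f w)) w = (derivAt E k (f w)).comp f' :=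
    (HasFDerivAt.comp (g := fun w' => extChartAt 𝓘(ℝ, E) (k (f w)) (k w')) w
      (((contDiffAt_extChartAt_comp le_rfl hk (mem_chart_source E _)).differentiableAt
        (by simp)).hasFDerivAt) hf).fderiv
  rw [pullback, pullback, pull_pull, h1]

theorem pullback_congr {k k' : W → B} {w : W} (h : k =ᶠ[𝓝 w] k') (α : ∀ p, ScalarForm E p U) :
    pullback k α w = pullback k' α w := by
  have h1 : derivAt E k w = derivAt E k' w := by
    rw [derivAt, derivAt, h.self_of_nhds]
    exact Filter.EventuallyEq.fderiv_eq (h.mono fun w' hw' => by simp only [hw'])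
  rw [pullback, pullback, h1, h.self_of_nhds]

theorem pullback_extChartAt_symm (y₀ : B) (α : ∀ p, ScalarForm E p U) :
    pullback (extChartAt 𝓘(ℝ, E) y₀).symm α (extChartAt 𝓘(ℝ, E) y₀ y₀) = formVal α y₀ := by
  have h1 : derivAt E (extChartAt 𝓘(ℝ, E) y₀).symm (extChartAt 𝓘(ℝ, E) y₀ y₀) =
      ContinuousLinearMap.id ℝ E := by
    rw [derivAt, extChartAt_to_inv]
    refine HasFDerivAt.fderiv ((hasFDerivAt_id _).congr_of_eventuallyEq ?_)
    filter_upwards [extChartAt_target_mem_nhds (I := 𝓘(ℝ, E)) y₀] with u hu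
    exact (extChartAt 𝓘(ℝ, E) y₀).right_inv hu
  rw [pullback, h1, extChartAt_to_inv, pull_id]

theorem pullback_const (x : B) (α : ∀ p, ScalarForm E p U) (w : W) :
    pullback (fun _ : W => x) α w = pull 0 (formVal α x) := by
  rw [pullback, derivAt, fderiv_fun_const]
  rfl

end Pullback

theorem ExtAlg.pull_zero_eq_zero {T T' : Type*} [NormedAddCommGroup T] [NormedSpace ℝ T]
    [NormedAddCommGroup T'] [NormedSpace ℝ T'] {a : ExtAlg T} (h : a 0 = 0) :
    pull (0 : T' →L[ℝ] T) a = 0 := by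
  ext1 p
  cases p with
  | zero =>
    rw [pull_apply, h]
    rfl
  | succ p =>
    ext v
    exact (a (p + 1)).map_coord_zero 0 rfl

theorem ExtAlg.apply_eq_zero_of_contr_one {a : ExtAlg ℝ} (h : contr 1 a = 0) {p : ℕ} (hp : p ≠ 0) :
    a p = 0 := by
  obtain ⟨p, rfl⟩ := Nat.exists_eq_succ_of_ne_zero hp
  refine ContinuousAlternatingMap.ext fun v => ?_
  have h1 : a (p + 1) (Fin.cons 1 fun i : Fin p => v i.succ) = 0 :=
    DFunLike.congr_fun (congrFun h p) fun i : Fin p => v i.succ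
  have h2 : v = Fin.cons (v 0 • (1 : ℝ)) fun i => v i.succ := by
    rw [smul_eq_mul, mul_one]
    exact (Fin.cons_self_tail v).symm
  rw [h2]
  have h3 := (a (p + 1)).toMultilinearMap.cons_smul (fun i => v i.succ) (v 0) 1
  refine h3.trans ?_
  exact (congrArg (v 0 • ·) h1).trans (smul_zero _)

theorem ExtAlg.contr_neg {T : Type*} [NormedAddCommGroup T] [NormedSpace ℝ T] (v : T)
    (a : ExtAlg T) : contr (-v) a = -contr v a := by
  ext1 p
  rw [contr_apply, Pi.neg_apply, contr_apply, map_neg]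

variable {x : B} {g : ∀ q, Generators E (F q) (V q)}
  {C : SmoothPaths E U x} {D : Superconnection E F V U} {m : ℕ} {ξ : TotalForm E F V U}

theorem LocalTransport.eq_zero_of_notMem {y₀ : B} (L : LocalTransport C g D m ξ y₀) {j : GenIdx g}
    (hj : j ∉ L.J) (w : E × ℝ) : L.a w j = 0 := by
  ext1 p
  by_contra hne
  exact hj (L.degree w j p hne).1

theorem LocalTransport.contr_eq_zero {y₀ : B} (L : LocalTransport C g D m ξ y₀) {u : E}
    (hu : u ∈ L.O) (t : ℝ) (j : GenIdx g) : contr (0, 1) (L.a (u, t) j) = 0 := by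
  by_cases hj : j ∈ L.J
  · exact (L.transport _ subset_rfl).contr_eq_zero L.smooth hu hj (t₀ := -2)
      (by rw [L.init u hu]; exact map_zero _) t
  · rw [L.eq_zero_of_notMem hj, map_zero]

theorem HasTotalDegree.pull {𝓙 T T' : Type*} [NormedAddCommGroup T] [NormedSpace ℝ T]
    [NormedAddCommGroup T'] [NormedSpace ℝ T'] {J : Finset 𝓙} {q : 𝓙 → ℕ} {m : ℕ}
    {a : 𝓙 → ExtAlg T} (ha : HasTotalDegree J q m a) (f : T' →L[ℝ] T) :
    HasTotalDegree J q m fun j => ExtAlg.pull f (a j) := by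
  refine fun j p hne => ha j p fun h1 => hne ?_
  change (a j p).compContinuousLinearMap f = 0
  rw [h1]
  rfl

/-- Along the loop from `x` to itself, the solution of the transport equation is even, since so is
the loop; as it starts at `0`, it also ends there. -/
theorem LocalTransport.apply_two_zero (L : LocalTransport C g D m ξ x) (hx : x ∈ U)
    (j : GenIdx g) : L.a (extChartAt 𝓘(ℝ, E) x x, 2) j 0 = 0 := by
  set u := extChartAt 𝓘(ℝ, E) x x with hu
  have huO : u ∈ L.O := L.mem
  set c : ℝ → B := fun t => C.path (x, t) with hc
  have hcyl : ∀ t, ContMDiffAt 𝓘(ℝ, E × ℝ) 𝓘(ℝ, E) ∞ (C.cyl x) (u, t) := fun t =>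
    C.contMDiffAt_cyl (mem_extChartAt_target x) (by rwa [extChartAt_to_inv]) t
  have hcc : (fun t => C.cyl x (u, t)) = c := funext fun t => cyl_extChartAt (mem_chart_source E x) t
  have hcs : ∀ t, ContMDiffAt 𝓘(ℝ, ℝ) 𝓘(ℝ, E) ∞ c t := fun t => by
    rw [← hcc]
    exact ContMDiffAt.comp t (f := fun t : ℝ => (u, t)) (hcyl t)
      (contDiff_prodMk_right u).contDiffAt.contMDiffAt
  have hline : ∀ (α : ∀ p, ScalarForm E p U) t,
      pull (ContinuousLinearMap.inr ℝ E ℝ) (pullback (C.cyl x) α (u, t)) = pullback c α t := by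
    intro α t
    rw [← hcc]
    exact pull_pullback (f := fun t : ℝ => (u, t)) (hcyl t) (hasFDerivAt_prodMk_right u t) α
  -- the loop is even, so time reversal preserves the pulled back forms
  have hneg : ∀ (α : ∀ p, ScalarForm E p U) t,
      pull (-ContinuousLinearMap.id ℝ ℝ) (pullback c α (-t)) = pullback c α t := by
    intro α t
    have h1 := pull_pullback (f := fun t : ℝ => -t) (hcs (-t)) (hasFDerivAt_id t).neg α
    rw [h1]
    exact congrArg (fun k => pullback k α t) (funext fun t => C.even t)
  set Θ : ℝ → GenIdx g → GenIdx g → ExtAlg ℝ :=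
    fun t i j => pullback c (coef j (D.op (genForm U i))) t with hΘ
  set om : ℝ → GenIdx g → ExtAlg ℝ := fun t j => pullback c (coef j ξ) t with hom
  set b : ℝ → GenIdx g → ExtAlg ℝ :=
    fun t j => pull (ContinuousLinearMap.inr ℝ E ℝ) (L.a (u, t) j) with hb
  have hb' : ∀ t, ∀ j ∈ L.J, ∀ p, HasDerivAt (fun t => b t j p)
      ((transportOp L.J 1 (fun _ _ => 0) (Θ t) (b t) j + contr 1 (om t j)) p) t := by
    intro t j hj p
    have h1 := (L.transport _ subset_rfl).hasDerivAt huO hj (L.smooth u huO t j) p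
    have h2 := (pullCLM (ContinuousLinearMap.inr ℝ E ℝ) p).hasFDerivAt.comp_hasDerivAt t h1
    refine h2.congr_deriv ?_
    change (pull (ContinuousLinearMap.inr ℝ E ℝ) (transportOp _ _ _ _ _ _ + _)) p = _
    have h3 : ∀ a : ExtAlg (E × ℝ), pull (ContinuousLinearMap.inr ℝ E ℝ) (contr (0, 1) a) =
        contr 1 (pull (ContinuousLinearMap.inr ℝ E ℝ) a) := fun a => by
      rw [contr_pull, ContinuousLinearMap.inr_apply]
    rw [map_add, transportOp_apply, transportOp_apply, map_sum, h3, hline]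
    simp only [map_sub, map_mul, map_zero, mul_zero, h3, pull_eps, hline, hΘ, hom, hb]
  have hbc : ∀ t j, contr 1 (b t j) = 0 := by
    intro t j
    rw [hb, contr_pull, ContinuousLinearMap.inr_apply, L.contr_eq_zero huO, map_zero]
  have key := transport_unique (J := L.J) (q := fun j : GenIdx g => j.1 + 1) (m := m)
    (v := (1 : ℝ)) (A := fun _ _ _ => 0) (B := Θ) (b := fun t j => contr 1 (om t j))
    (f := fun t j => pull (-ContinuousLinearMap.id ℝ ℝ) (b (-t) j)) (h := b) (t₀ := 0)
    (fun i _ j _ t => Smooth.const _ _)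
    (fun i _ j _ t p => contDiffAt_pullback (hcs t) (C.mem x hx t) _ p)
    (fun t => ((L.degree (u, -t)).pull _).pull _) (fun t => (L.degree (u, t)).pull _)
    (fun t j hj p => ?_) hb' ?_
  -- the value at time `2` is that at time `-2`, which is zero
  · have h1 := congrFun (congrFun (congrFun key 2) j) 0
    rw [hb] at h1
    beta_reduce at h1
    rw [L.init u huO] at h1
    have h2 : pull (ContinuousLinearMap.inr ℝ E ℝ) (L.a (u, 2) j) 0 = 0 := by
      rw [← h1]
      rfl
    ext v
    rw [Subsingleton.elim v fun i => ContinuousLinearMap.inr ℝ E ℝ (i.elim0)]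
    exact DFunLike.congr_fun h2 fun i => i.elim0
  · have h1 : HasDerivAt (fun t => b (-t) j p) _ t :=
      HasDerivAt.scomp t (h := fun t => -t) (hb' (-t) j hj p) (hasDerivAt_neg t)
    have h2 := (pullCLM (-ContinuousLinearMap.id ℝ ℝ) p).hasFDerivAt.comp_hasDerivAt t h1
    refine h2.congr_deriv ?_
    rw [neg_one_smul, map_neg]
    change -(pull (-ContinuousLinearMap.id ℝ ℝ) (transportOp _ _ _ _ _ _ + _)) p = _
    have h3 : ∀ a : ExtAlg ℝ, pull (-ContinuousLinearMap.id ℝ ℝ) (contr 1 a) =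
        -contr 1 (pull (-ContinuousLinearMap.id ℝ ℝ) a) := fun a => by
      rw [contr_pull, _root_.neg_apply, ContinuousLinearMap.id_apply, contr_neg, map_neg,
        neg_neg]
    rw [map_add, transportOp_apply, transportOp_apply, map_sum, h3]
    simp only [map_sub, map_mul, map_zero, mul_zero, h3, pull_eps, hneg, hΘ, hom]
    rw [← Pi.neg_apply, neg_add, neg_neg, ← Finset.sum_neg_distrib]
    simp
  · funext j
    ext1 p
    rw [neg_zero]
    by_cases hp : p = 0
    · subst hp
      refine ContinuousAlternatingMap.ext fun v => ?_
      exact congrArg (b 0 j 0) (Subsingleton.elim _ _)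
    · rw [pull_apply, apply_eq_zero_of_contr_one (hbc 0 j) hp]
      rfl

/-- Near the initial time the cylinder is constant, so the pull back of a form depends only on its
component of degree `0` at `x`. -/
theorem LocalTransport.pullback_eq_zero {y₀ : B} (L : LocalTransport C g D m ξ y₀)
    {α : ∀ p, ScalarForm E p U} (hα : formVal α x 0 = 0) {u : E} (hu : u ∈ L.O) :
    pullback (C.cyl y₀) α (u, -2) = 0 := by
  have h1 : C.cyl y₀ =ᶠ[𝓝 (u, -2)] fun _ => x := by
    have h2 : L.O ×ˢ Iio (-1 : ℝ) ∈ 𝓝 (u, (-2 : ℝ)) :=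
      (L.isOpen.prod isOpen_Iio).mem_nhds ⟨hu, by norm_num⟩
    filter_upwards [h2] with w hw
    exact C.eq_start _ (L.mem_U _ hw.1) _ (le_of_lt hw.2)
  rw [pullback_congr h1, pullback_const, pull_zero_eq_zero hα]

/-- On the cylinder, the solution of the transport equation is a primitive: at the initial time the
closed form and all derivatives of the solution vanish. -/
theorem LocalTransport.matrixOp_eq {y₀ : B} (L : LocalTransport C g D m ξ y₀) (hD : D.IsFlat)
    (hξ : ξ ∈ degreePart totalDegree (fun i => Form E (F i.2) (V i.2) i.1 U) m) (hDξ : D.op ξ = 0)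
    (hξx : TotalForm.evalPoint x ξ = 0) {u : E} (hu : u ∈ L.O) (t : ℝ) {j : GenIdx g}
    (hj : j ∈ L.J) :
    matrixOp L.J (fun w i j => pullback (C.cyl y₀) (coef j (genForm U i)) w)
      (fun w i j => pullback (C.cyl y₀) (coef j (D.op (genForm U i))) w) L.a (u, t) j =
      pullback (C.cyl y₀) (coef j ξ) (u, t) := by
  have H := cylinderData D hD hξ hDξ
    (fun u hu t => C.contMDiffAt_cyl (L.subset hu) (L.mem_U u hu) t)
    (fun u hu t => C.mem _ (L.mem_U u hu) t) L.complete
  have hom : ∀ u ∈ L.O, ∀ j : GenIdx g, pullback (C.cyl y₀) (coef j ξ) (u, -2) = 0 := by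
    refine fun u hu j => L.pullback_eq_zero ?_ hu
    ext v
    have h1 := evalPoint_apply x ξ j.1
    rw [hξx] at h1
    rw [formVal_coef, coefAt_apply, coefHom_apply, Subsingleton.elim v ![]]
    exact (congrArg ((g j.1).σ j.2 x) h1.symm).trans (map_zero _)
  refine H.matrixOp_eq L.isOpen L.degree L.smooth (L.transport _ subset_rfl) (t₀ := -2)
    (fun u hu j _ => L.contr_eq_zero hu _ j) (fun u hu j _ => ?_) hu t hj
  rw [hom u hu, matrixOp]
  refine Finset.sum_eq_zero fun k hk => ?_
  -- the solution is zero at time `-2`, and the transport equation kills its time derivative there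
  have h1 : ∀ p, fderiv ℝ (fun w => L.a w k p) (u, -2) = 0 := by
    intro p
    have h2 := ((L.smooth u hu (-2) k p).differentiableAt (by simp)).hasFDerivAt
    have h3 : (fderiv ℝ (fun w => L.a w k p) (u, -2)).comp (ContinuousLinearMap.inl ℝ E ℝ) = 0 := by
      have h4 := HasFDerivAt.comp u (f := fun u : E => (u, (-2 : ℝ))) h2
        (hasFDerivAt_prodMk_left u (-2 : ℝ))
      refine h4.unique ((hasFDerivAt_const 0 u).congr_of_eventuallyEq ?_)
      filter_upwards [L.isOpen.mem_nhds hu] with u' hu'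
      rw [Function.comp_apply, L.init u' hu']
      rfl
    have h4 : fderiv ℝ (fun w => L.a w k p) (u, -2) (0, 1) = 0 := by
      have h5 := congrFun (L.transport _ subset_rfl u hu (-2) k hk) p
      beta_reduce at h5
      rw [hom u hu, map_zero, Finset.sum_eq_zero fun i _ => by
        rw [L.init u hu, Pi.zero_apply, map_zero, zero_mul, map_zero], sub_zero] at h5
      exact h5
    refine ContinuousLinearMap.ext fun v => ?_
    have h5 : v = ContinuousLinearMap.inl ℝ E ℝ v.1 + v.2 • ((0 : E), (1 : ℝ)) := by
      ext <;> simp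
    have h6 : v.2 • (0 : (E × ℝ) [⋀^Fin p]→L[ℝ] ℂ) = 0 :=
      smul_zero (A := (E × ℝ) [⋀^Fin p]→L[ℝ] ℂ) v.2
    rw [h5, map_add, map_smul, h4, h6, add_zero]
    exact DFunLike.congr_fun h3 v.1
  have h2 : extD (fun w => L.a w k) (u, -2) = 0 := by
    ext1 p
    cases p with
    | zero => rfl
    | succ p =>
      change extDeriv (fun w => L.a w k p) (u, -2) = 0
      rw [extDeriv, h1]
      exact alternatizeUncurryFin_zero
  rw [h2, L.init u hu, Pi.zero_apply, map_zero, zero_mul, zero_mul, add_zero]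

end LoopTransport

/-! ### Primitives of closed forms -/

section PrimitiveForms

attribute [local instance] continuousSMul_real

open Filter Set Topology

set_option linter.unusedSectionVars false

universe uB

variable {E : Type*} [NormedAddCommGroup E] [NormedSpace ℝ E] [FiniteDimensional ℝ E]
  {B : Type uB} [TopologicalSpace B] [T2Space B] [SecondCountableTopology B]
  [ChartedSpace E B] [IsManifold 𝓘(ℝ, E) ∞ B]
  {F : ℕ → Type*} [∀ q, NormedAddCommGroup (F q)] [∀ q, NormedSpace ℂ (F q)]
  {V : ℕ → B → Type*} [∀ q, TopologicalSpace (TotalSpace (F q) (V q))]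
  [∀ q x, AddCommGroup (V q x)] [∀ q x, Module ℂ (V q x)] [∀ q x, TopologicalSpace (V q x)]
  [∀ q x, IsTopologicalAddGroup (V q x)] [∀ q x, ContinuousSMul ℂ (V q x)]
  [∀ q, FiberBundle (F q) (V q)] [∀ q, VectorBundle ℂ (F q) (V q)]
  [∀ q, VectorBundle ℝ (F q) (V q)]
  {U : Opens B}

open ExtAlg

variable {x : B} {g : ∀ q, Generators E (F q) (V q)}
  {C : SmoothPaths E U x} {D : Superconnection E F V U} {m : ℕ} {ξ : TotalForm E F V U}

theorem coefAt_sum_wedgeInh (J : Finset (GenIdx g)) (α : GenIdx g → ∀ p, ScalarForm E p U) (z : B)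
    (j : GenIdx g) : coefAt j z (∑ k ∈ J, wedgeInh (α k) (genForm U k)) =
      ∑ k ∈ J, formVal (α k) z * coefAt j z (genForm U k) := by
  rw [map_sum]
  exact Finset.sum_congr rfl fun k _ => coefAt_wedgeInh j z _ _

/-- The form with given coefficients with respect to the generators, the family of coefficients
being locally finite. -/
theorem exists_form_of_coefficients (α : GenIdx g → ∀ p, ScalarForm E p U)
    (hα : ∀ j p, p + j.1 + 1 ≠ m → ∀ z ∈ U, formVal (α j) z p = 0) (J : B → Finset (GenIdx g))
    (hJ : ∀ z ∈ U, ∀ j ∉ J z, ∀ᶠ y in 𝓝 z, formVal (α j) y = 0)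
    (hJ' : ∀ y₀ ∈ U, ∀ᶠ z in 𝓝 y₀, ∀ j ∉ J y₀, formVal (α j) z = 0) :
    ∃ η : TotalForm E F V U, (∀ i : ℕ × ℕ, i.1 + i.2 + 1 ≠ m → η i = 0) ∧
      ∀ y₀ ∈ U, ∀ᶠ z in 𝓝 y₀, ∀ i,
        (η i).1 z = ((∑ k ∈ J y₀, wedgeInh (α k) (genForm U k)) i).1 z := by
  classical
  set val : ∀ (i : ℕ × ℕ) (z : B), FormFibre E (V i.2) i.1 z := fun i z =>
    ((∑ k ∈ J z, wedgeInh (α k) (genForm U k) : TotalForm E F V U) i).1 z with hval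
  have hnear : ∀ y₀ ∈ U, ∀ᶠ z in 𝓝 y₀, ∀ i,
      val i z = ((∑ k ∈ J y₀, wedgeInh (α k) (genForm U k) : TotalForm E F V U) i).1 z := by
    intro y₀ hy₀
    filter_upwards [hJ' y₀ hy₀, U.isOpen.mem_nhds hy₀] with z hz hzU i
    refine eq_at_of_coefAt (g := g) (fun j => ?_) i
    rw [coefAt_sum_wedgeInh, coefAt_sum_wedgeInh]
    refine (Finset.sum_subset (Finset.subset_union_left (s₂ := J y₀)) fun k _ hk => ?_).trans
      (Finset.sum_subset (Finset.subset_union_right (s₁ := J z)) fun k _ hk => ?_).symm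
    · rw [(hJ z hzU k hk).self_of_nhds, zero_mul]
    · rw [hz k hk, zero_mul]
  have hdeg : ∀ (i : ℕ × ℕ), i.1 + i.2 + 1 ≠ m → ∀ z ∈ U, val i z = 0 := by
    rintro ⟨p, q⟩ hi z hz
    refine (eq_at_of_coefAt_apply (g := g) (η' := (0 : TotalForm E F V U)) fun l => ?_).trans rfl
    rw [coefAt_sum_wedgeInh, map_zero, ExtAlg.sum_apply]
    refine Finset.sum_eq_zero fun k _ => ?_
    by_cases hk : k.1 = q
    · by_contra hne
      obtain ⟨r, s, hrs, hr, hs⟩ := exists_of_mul_apply_ne_zero hne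
      have hs0 : s = 0 := by
        by_contra hs0
        exact hs (coefAt_genForm_apply_of_ne k _ hz hs0)
      refine hr (hα k r ?_ z hz)
      have hi' : p + q + 1 ≠ m := hi
      omega
    · rw [coefAt_genForm_of_ne hk, mul_zero]
      rfl
  obtain ⟨η, hη⟩ := exists_totalForm (((Finset.range (m + 1)) ×ˢ (Finset.range (m + 1))).filter
      fun i : ℕ × ℕ => i.1 + i.2 + 1 = m) val (fun i hi z hz => hdeg i (fun h => hi (by
        simp only [Finset.mem_filter, Finset.mem_product, Finset.mem_range]
        omega)) z hz) fun z hz => ⟨U, hz, _, hnear z hz⟩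
  refine ⟨η, fun i hi => ?_, fun y₀ hy₀ => ?_⟩
  · refine Subtype.ext (funext fun z => ?_)
    by_cases hz : z ∈ U
    · exact (hη z hz i).trans (hdeg i hi z hz)
    · exact (η i).2.2 z hz
  · filter_upwards [hnear y₀ hy₀, U.isOpen.mem_nhds hy₀] with z hz hzU i
    rw [hη z hzU, hz]

theorem formVal_endForm_eq_zero (L : ∀ z ∈ U, LocalTransport C g D m ξ z) {y₀ : B} (hy₀ : y₀ ∈ U) :
    ∀ᶠ z in 𝓝 y₀, ∀ j ∉ (L y₀ hy₀).J, formVal (endForm L j) z = 0 := by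
  filter_upwards [eventually_mem_localTransport (L y₀ hy₀) hy₀] with z hz j hj
  rw [formVal_endForm L j hz.2.1, ← (L y₀ hy₀).pull_eq (L z hz.2.1) hz.1 hz.2.1 hz.2.2,
    (L y₀ hy₀).eq_zero_of_notMem hj, map_zero, map_zero]

/-- At the final time the cylinder is the identity map in the chart, so that pulling back to the
cylinder and restricting to its end changes nothing. -/
theorem pull_cylEnd_pullback {y₀ : B} (hy₀ : y₀ ∈ U) (α : ∀ p, ScalarForm E p U) :
    pull (cylEnd E) (pullback (C.cyl y₀) α (extChartAt 𝓘(ℝ, E) y₀ y₀, 2)) = formVal α y₀ := by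
  have h1 := pull_pullback (f := fun u : E => (u, (2 : ℝ))) (w := extChartAt 𝓘(ℝ, E) y₀ y₀)
    (C.contMDiffAt_cyl (mem_extChartAt_target y₀) (by rwa [extChartAt_to_inv]) 2)
    (hasFDerivAt_prodMk_left _ (2 : ℝ)) α
  refine h1.trans ?_
  rw [← pullback_extChartAt_symm]
  refine pullback_congr ?_ α
  have h2 : (extChartAt 𝓘(ℝ, E) y₀).symm ⁻¹' U ∈ 𝓝 (extChartAt 𝓘(ℝ, E) y₀ y₀) :=
    (continuousAt_extChartAt_symm y₀).preimage_mem_nhds (by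
      rw [extChartAt_to_inv]
      exact U.isOpen.mem_nhds hy₀)
  filter_upwards [h2] with u hu
  exact C.eq_end _ hu 2 (by norm_num)

/-- A closed form vanishing at `x` has a primitive vanishing at `x`. -/
theorem exists_primitive_of_evalPoint_eq_zero (C : SmoothPaths E U x)
    (g : ∀ q, Generators E (F q) (V q)) (hx : x ∈ U) (hD : D.IsFlat)
    (hξ : ξ ∈ degreePart totalDegree (fun i => Form E (F i.2) (V i.2) i.1 U) m) (hDξ : D.op ξ = 0)
    (hξx : TotalForm.evalPoint x ξ = 0) :
    ∃ η : TotalForm E F V U, (∀ i : ℕ × ℕ, i.1 + i.2 + 1 ≠ m → η i = 0) ∧ D.op η = ξ ∧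
      TotalForm.evalPoint x η = 0 := by
  classical
  have L : ∀ z ∈ U, LocalTransport C g D m ξ z := fun z hz =>
    (nonempty_localTransport C g hD hξ hDξ hz).some
  obtain ⟨η, hη, hη'⟩ := exists_form_of_coefficients (m := m) (endForm L)
    (fun j p hp z hz => by
      rw [formVal_endForm L j hz, pull_apply]
      have h1 : (L z hz).a (extChartAt 𝓘(ℝ, E) z z, 2) j p = 0 := by
        by_contra hne
        have h2 : p + (j.1 + 1) = m := ((L z hz).degree _ j p hne).2
        omega
      rw [h1]
      rfl) (fun z => if hz : z ∈ U then (L z hz).J else ∅)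
    (fun z hz j hj => by
      rw [dif_pos hz] at hj
      exact (formVal_endForm_eq_zero L hz).mono fun y hy => hy j hj)
    (fun z hz => by
      simp only [dif_pos hz]
      exact formVal_endForm_eq_zero L hz)
  refine ⟨η, hη, totalForm_ext_coefAt (g := g) fun y₀ hy₀ j => ?_, ?_⟩
  · by_cases hj : j ∈ (L y₀ hy₀).J
    · have h1 := hη' y₀ hy₀
      simp only [dif_pos hy₀] at h1
      have h2 := (L y₀ hy₀).matrixOp_eq hD hξ hDξ hξx (L y₀ hy₀).mem 2 hj
      rw [coefAt_op_of_eventuallyEq D hy₀ h1 j, ← formVal_coef j ξ y₀,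
        ← pull_cylEnd_pullback (C := C) hy₀, ← h2, matrixOp, map_sum]
      refine Finset.sum_congr rfl fun k _ => ?_
      rw [map_add, map_mul, map_mul, pull_eps, pull_cylEnd_pullback hy₀, pull_cylEnd_pullback hy₀,
        formVal_formD_endForm L k hy₀, formVal_endForm L k hy₀]
      rfl
    · have hc : CompleteAt (L y₀ hy₀).J (m + 1) y₀ := by
        have h1 := (L y₀ hy₀).complete _ (L y₀ hy₀).mem 2
        rwa [cyl_extChartAt (mem_chart_source E y₀), C.eq_end y₀ hy₀ 2 (by norm_num)] at h1
      rw [hc.coefAt_eq_zero hj fun i hi => hξ i (by rw [totalDegree]; omega),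
        hc.coefAt_eq_zero hj fun i hi => op_apply_eq_zero D fun k hk => hη k (by omega)]
  · refine DFinsupp.ext fun q => Generators.eq_of_σ (g := g) fun l => ?_
    rw [evalPoint_apply]
    have h1 : coefAt (⟨q, l⟩ : GenIdx g) x η 0 ![] = 0 := by
      rw [coefAt_congr (hη' x hx).self_of_nhds, coefAt_sum_wedgeInh, ExtAlg.sum_apply,
        ContinuousAlternatingMap.sum_apply]
      refine Finset.sum_eq_zero fun k _ => ?_
      rw [mul_apply_zero, formVal_endForm L k hx, pull_apply, (L x hx).apply_two_zero hx]
      exact zero_mul _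
    exact h1.trans (map_zero _).symm

/-- A closed form has a primitive with prescribed value at `x`, provided that this is possible up
to forms vanishing at `x`. -/
theorem exists_primitive (C : SmoothPaths E U x) (g : ∀ q, Generators E (F q) (V q)) (hx : x ∈ U)
    (hD : D.IsFlat)
    (hξ : ξ ∈ degreePart totalDegree (fun i => Form E (F i.2) (V i.2) i.1 U) m) (hDξ : D.op ξ = 0)
    {ζ : TotalForm E F V U} (hζ : ∀ i : ℕ × ℕ, i.1 + i.2 + 1 ≠ m → ζ i = 0)
    (hζξ : TotalForm.evalPoint x (D.op ζ) = TotalForm.evalPoint x ξ) :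
    ∃ η : TotalForm E F V U, (∀ i : ℕ × ℕ, i.1 + i.2 + 1 ≠ m → η i = 0) ∧ D.op η = ξ ∧
      TotalForm.evalPoint x η = TotalForm.evalPoint x ζ := by
  obtain ⟨η, hη, hDη, hηx⟩ := exists_primitive_of_evalPoint_eq_zero (ξ := ξ - D.op ζ) (m := m) C g
    hx hD (Submodule.sub_mem _ hξ fun i hi => op_apply_eq_zero D fun k hk => hζ k (by
      rw [totalDegree] at hi
      omega)) (by
      rw [map_sub, hDξ, sub_eq_zero]
      exact (LinearMap.congr_fun hD ζ).symm) (by rw [map_sub, hζξ, sub_self])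
  refine ⟨η + ζ, fun i hi => ?_, ?_, ?_⟩
  · rw [DirectSum.add_apply, hη i hi, hζ i hi, add_zero]
  · rw [map_add, hDη, sub_add_cancel]
  · rw [map_add, hηx, zero_add]

end PrimitiveForms

/-! ### Cohomology -/

section CohomologyIso

attribute [local instance] continuousSMul_real

open Filter Set Topology

set_option linter.unusedSectionVars false

universe uB

variable {E : Type*} [NormedAddCommGroup E] [NormedSpace ℝ E] [FiniteDimensional ℝ E]
  {B : Type uB} [TopologicalSpace B] [T2Space B] [SecondCountableTopology B]
  [ChartedSpace E B] [IsManifold 𝓘(ℝ, E) ∞ B]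
  {F : ℕ → Type*} [∀ q, NormedAddCommGroup (F q)] [∀ q, NormedSpace ℂ (F q)]
  {V : ℕ → B → Type*} [∀ q, TopologicalSpace (TotalSpace (F q) (V q))]
  [∀ q x, AddCommGroup (V q x)] [∀ q x, Module ℂ (V q x)] [∀ q x, TopologicalSpace (V q x)]
  [∀ q x, IsTopologicalAddGroup (V q x)] [∀ q x, ContinuousSMul ℂ (V q x)]
  [∀ q, FiberBundle (F q) (V q)] [∀ q, VectorBundle ℂ (F q) (V q)]
  [∀ q, VectorBundle ℝ (F q) (V q)]
  {U : Opens B}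

variable {x : B} {g : ∀ q, Generators E (F q) (V q)}

theorem exists_form_evalPoint_eq (g : ∀ q, Generators E (F q) (V q)) (hx : x ∈ U) {n : ℕ}
    {v : ⨁ q, V q x} (hv : v ∈ degreePart (fun q : ℕ => q) (fun q => V q x) n) :
    ∃ ζ : TotalForm E F V U, (∀ i : ℕ × ℕ, i.1 + i.2 ≠ n → ζ i = 0) ∧
      TotalForm.evalPoint x ζ = v := by
  obtain ⟨s, hs⟩ := exists_section g (v n)
  refine ⟨TotalForm.restrict le_top (DirectSum.lof ℂ (ℕ × ℕ)
    (fun i => Form E (F i.2) (V i.2) i.1 (⊤ : Opens B)) (0, n) s), fun i hi => ?_, ?_⟩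
  · have h1 : (0, n) ≠ i := by
      rintro rfl
      exact hi (zero_add n)
    refine Subtype.ext (funext fun z => ?_)
    by_cases hz : z ∈ U
    · rw [TotalForm.restrict_apply _ _ _ hz, DirectSum.lof_eq_of, DirectSum.of_eq_of_ne _ _ _ h1.symm]
      rfl
    · exact (Subtype.property (TotalForm.restrict _ _ i)).2 z hz
  · refine DFinsupp.ext fun q => ?_
    rw [evalPoint_apply, TotalForm.restrict_apply _ _ _ hx, DirectSum.lof_eq_of]
    by_cases hq : q = n
    · subst hq
      rw [DirectSum.of_eq_same]
      exact hs
    · rw [DirectSum.of_eq_of_ne _ _ _ fun h => hq (congrArg Prod.snd h), hv q hq]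
      rfl

theorem evalPoint_mem_degreePart {n : ℕ} {η : TotalForm E F V U}
    (hη : η ∈ degreePart totalDegree (fun i => Form E (F i.2) (V i.2) i.1 U) n) :
    TotalForm.evalPoint x η ∈ degreePart (fun q : ℕ => q) (fun q => V q x) n := by
  intro q hq
  have h1 : η (0, q) = 0 := hη (0, q) (by rwa [totalDegree, zero_add])
  rw [evalPoint_apply, h1]
  rfl

/-- A linear map induces an isomorphism of subquotients as soon as it maps `Z` onto `Z'` and an
element of `Z` lies in `R` if and only if its image lies in `R'`. -/
theorem exists_subquotient_equiv {M M' : Type*} [AddCommGroup M] [Module ℂ M] [AddCommGroup M']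
    [Module ℂ M'] {Z R : Submodule ℂ M} {Z' R' : Submodule ℂ M'} (f : M →ₗ[ℂ] M')
    (hf : ∀ a ∈ Z, f a ∈ Z') (hR : ∀ a ∈ Z, f a ∈ R' ↔ a ∈ R) (hsurj : ∀ b ∈ Z', ∃ a ∈ Z, f a = b) :
    ∃ e : (Z ⧸ R.comap Z.subtype) ≃ₗ[ℂ] (Z' ⧸ R'.comap Z'.subtype), ∀ a : Z, ∃ h : f a.1 ∈ Z',
      e (Submodule.Quotient.mk a) = Submodule.Quotient.mk ⟨f a.1, h⟩ := by
  have hle : R.comap Z.subtype ≤ (R'.comap Z'.subtype).comap (f.restrict hf) :=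
    fun a ha => (hR a.1 a.2).2 ha
  refine ⟨LinearEquiv.ofBijective (Submodule.mapQ _ _ _ hle) ⟨?_, ?_⟩, fun a => ⟨hf a.1 a.2, rfl⟩⟩
  · refine (injective_iff_map_eq_zero _).2 fun c hc => ?_
    obtain ⟨a, rfl⟩ := Submodule.Quotient.mk_surjective _ c
    exact (Submodule.Quotient.mk_eq_zero _).2
      ((hR a.1 a.2).1 ((Submodule.Quotient.mk_eq_zero (R'.comap Z'.subtype)).1 hc))
  · intro c
    obtain ⟨b, rfl⟩ := Submodule.Quotient.mk_surjective _ c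
    obtain ⟨a, ha, hab⟩ := hsurj b.1 b.2
    exact ⟨Submodule.Quotient.mk ⟨a, ha⟩, congrArg Submodule.Quotient.mk (Subtype.ext hab)⟩

section

variable {D : Superconnection E F V U} {A : ∀ (q : ℕ) (x : B), V q x →ₗ[ℂ] V (q + 1) x}

theorem evalPoint_mem_cocycles (hA : ∀ η : TotalForm E F V U,
      TotalForm.evalPoint x (D.op η) = -fibreOp A x (TotalForm.evalPoint x η)) {n : ℕ}
    {η : TotalForm E F V U} (hη : η ∈ cocycles totalDegree D.op n) :
    TotalForm.evalPoint x η ∈ cocycles (fun q : ℕ => q) (fibreOp A x) n := by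
  refine ⟨LinearMap.mem_ker.2 ?_, evalPoint_mem_degreePart hη.2⟩
  rw [← neg_eq_zero, ← hA, LinearMap.mem_ker.1 hη.1, map_zero]

/-- If the restriction of a form of degree `n` to `x` is exact, then it is the restriction of an
exact form of degree `n`. -/
theorem exists_form_evalPoint_op_eq (g : ∀ q, Generators E (F q) (V q)) (hx : x ∈ U)
    (hA : ∀ η : TotalForm E F V U,
      TotalForm.evalPoint x (D.op η) = -fibreOp A x (TotalForm.evalPoint x η)) {n : ℕ}
    {u v : ⨁ q, V q x} (hu : u ∈ degreePart (fun q : ℕ => q) (fun q => V q x) n)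
    (hv : fibreOp A x v = u) :
    ∃ ζ : TotalForm E F V U, (∀ i : ℕ × ℕ, i.1 + i.2 + 1 ≠ n → ζ i = 0) ∧
        TotalForm.evalPoint x (D.op ζ) = u := by
  -- only the component of degree `n - 1` of the primitive `v` matters
  cases n with
  | zero =>
    refine ⟨0, fun _ _ => rfl, ?_⟩
    rw [map_zero, map_zero]
    refine DFinsupp.ext fun q => ?_
    cases q with
    | zero => exact (fibreOp_apply_zero A x v).symm.trans (by rw [hv])
    | succ q => exact (hu (q + 1) (Nat.succ_ne_zero q)).symm
  | succ k =>
    obtain ⟨ζ, hζ, hζv⟩ := exists_form_evalPoint_eq (U := U) (n := k)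
      (v := -DirectSum.lof ℂ ℕ (fun q => V q x) k (v k)) g hx (Submodule.neg_mem _ fun q hq => by
        rw [DirectSum.lof_eq_of, DirectSum.of_eq_of_ne _ _ _ hq])
    refine ⟨ζ, fun i hi => hζ i (by omega), ?_⟩
    rw [hA, hζv, map_neg, neg_neg]
    refine DFinsupp.ext fun q => ?_
    cases q with
    | zero => rw [fibreOp_apply_zero, hu 0 (Nat.succ_ne_zero k).symm]
    | succ q =>
      rw [fibreOp_apply_succ, DirectSum.lof_eq_of]
      by_cases hq : q = k
      · subst hq
        rw [DirectSum.of_eq_same, ← hv, fibreOp_apply_succ]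
      · rw [DirectSum.of_eq_of_ne _ _ _ hq, map_zero,
          hu (q + 1) fun h => hq (Nat.succ_injective h)]

/-- Surjectivity in cohomology: a primitive of `0` with the given value at `x`. -/
theorem exists_cocycle_evalPoint_eq (C : SmoothPaths E U x) (g : ∀ q, Generators E (F q) (V q))
    (hx : x ∈ U) (hD : D.IsFlat) (hA : ∀ η : TotalForm E F V U,
      TotalForm.evalPoint x (D.op η) = -fibreOp A x (TotalForm.evalPoint x η)) {n : ℕ}
    {v : ⨁ q, V q x} (hv : v ∈ cocycles (fun q : ℕ => q) (fibreOp A x) n) :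
    ∃ η ∈ cocycles totalDegree D.op n, TotalForm.evalPoint x η = v := by
  obtain ⟨ζ, hζ, hζv⟩ := exists_form_evalPoint_eq (U := U) g hx hv.2
  have h1 : fibreOp A x v = 0 := LinearMap.mem_ker.1 hv.1
  have h2 : TotalForm.evalPoint x (D.op ζ) = TotalForm.evalPoint x (0 : TotalForm E F V U) := by
    rw [hA, hζv, h1, neg_zero, map_zero]
  obtain ⟨η, hη, hDη, hηv⟩ := exists_primitive (m := n + 1) C g hx hD
    (Submodule.zero_mem _) (map_zero _) (fun i hi => hζ i fun h => hi (by rw [h])) h2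
  exact ⟨η, ⟨LinearMap.mem_ker.2 hDη, fun i hi => hη i fun h => hi (Nat.succ_injective h)⟩,
    hηv.trans hζv⟩

/-- Injectivity in cohomology: a cocycle whose value at `x` is exact is exact. -/
theorem evalPoint_mem_range_iff (C : SmoothPaths E U x) (g : ∀ q, Generators E (F q) (V q))
    (hx : x ∈ U) (hD : D.IsFlat) (hA : ∀ η : TotalForm E F V U,
      TotalForm.evalPoint x (D.op η) = -fibreOp A x (TotalForm.evalPoint x η)) {n : ℕ}
    {η : TotalForm E F V U} (hη : η ∈ cocycles totalDegree D.op n) :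
    TotalForm.evalPoint x η ∈ LinearMap.range (fibreOp A x) ↔ η ∈ LinearMap.range D.op := by
  constructor
  · rintro ⟨v, hv⟩
    obtain ⟨ζ, hζ, hζη⟩ := exists_form_evalPoint_op_eq g hx hA (evalPoint_mem_degreePart hη.2) hv
    obtain ⟨η', -, hη', -⟩ := exists_primitive C g hx hD hη.2 (LinearMap.mem_ker.1 hη.1) hζ hζη
    exact ⟨η', hη'⟩
  · rintro ⟨ζ, rfl⟩
    exact ⟨-TotalForm.evalPoint x ζ, by rw [map_neg, ← hA]⟩

set_option maxHeartbeats 1000000 in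
/-- Restriction to a point is an isomorphism in cohomology. The hypothesis `hA` has a sign, which
affects neither cocycles nor coboundaries. -/
theorem exists_cohomology_equiv (C : SmoothPaths E U x) (g : ∀ q, Generators E (F q) (V q))
    (hx : x ∈ U) (hD : D.IsFlat) (hA : ∀ η : TotalForm E F V U,
      TotalForm.evalPoint x (D.op η) = -fibreOp A x (TotalForm.evalPoint x η)) (n : ℕ) :
    ∃ e : Cohomology totalDegree D.op n ≃ₗ[ℂ] Cohomology (fun q : ℕ => q) (fibreOp A x) n,
      ∀ η : cocycles totalDegree D.op n,
        ∃ h : TotalForm.evalPoint x η.1 ∈ cocycles (fun q : ℕ => q) (fibreOp A x) n,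
          e (Submodule.Quotient.mk η) =
            Submodule.Quotient.mk ⟨TotalForm.evalPoint x η.1, h⟩ :=
  exists_subquotient_equiv (TotalForm.evalPoint x) (fun _ hη => evalPoint_mem_cocycles hA hη)
    (fun _ hη => evalPoint_mem_range_iff C g hx hD hA hη)
    fun _ hv => exists_cocycle_evalPoint_eq C g hx hD hA hv

end

end CohomologyIso

end SuperConn

end

theorem mainTheorem6
    {E : Type*} [NormedAddCommGroup E] [NormedSpace ℝ E] [FiniteDimensional ℝ E]
    {B : Type*} [TopologicalSpace B] [T2Space B] [SecondCountableTopology B]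
    [ChartedSpace E B] [IsManifold 𝓘(ℝ, E) ∞ B]
    {F : ℕ → Type*} [∀ q, NormedAddCommGroup (F q)] [∀ q, NormedSpace ℂ (F q)]
    [∀ q, FiniteDimensional ℂ (F q)]
    {V : ℕ → B → Type*} [∀ q, TopologicalSpace (TotalSpace (F q) (V q))]
    [∀ q x, AddCommGroup (V q x)] [∀ q x, Module ℂ (V q x)] [∀ q x, TopologicalSpace (V q x)]
    [∀ q x, IsTopologicalAddGroup (V q x)] [∀ q x, ContinuousSMul ℂ (V q x)]
    [∀ q, FiberBundle (F q) (V q)] [∀ q, VectorBundle ℂ (F q) (V q)]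
    [∀ q, VectorBundle ℝ (F q) (V q)]
    [∀ q, ContMDiffVectorBundle ∞ (F q) (V q) 𝓘(ℝ, E)]
    (D : Superconnection E F V (⊤ : Opens B)) (hD : D.IsFlat)
    (U : Opens B) [ContractibleSpace U] :
    ∃ (DU : Superconnection E F V U) (A₀ : ∀ (q : ℕ) (x : B), V q x →ₗ[ℂ] V (q + 1) x),
      (D.RestrictsTo le_top DU ∧
        ∀ DU' : Superconnection E F V U, D.RestrictsTo le_top DU' → DU' = DU) ∧
      (D.HasDegreeZeroPart A₀ ∧
        ∀ A₀' : ∀ (q : ℕ) (x : B), V q x →ₗ[ℂ] V (q + 1) x, D.HasDegreeZeroPart A₀' → A₀' = A₀) ∧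
      DU.IsFlat ∧
      (∀ x, fibreOp A₀ x ∘ₗ fibreOp A₀ x = 0) ∧
      ∀ (n : ℕ) (x : B), x ∈ U →
        ∃ e : Cohomology totalDegree DU.op n ≃ₗ[ℂ] Cohomology (fun q : ℕ => q) (fibreOp A₀ x) n,
          ∀ η : cocycles totalDegree DU.op n,
            ∃ h : TotalForm.evalPoint x η.1 ∈ cocycles (fun q : ℕ => q) (fibreOp A₀ x) n,
              e (Submodule.Quotient.mk η) =
                Submodule.Quotient.mk ⟨TotalForm.evalPoint x η.1, h⟩ := by
  have g : ∀ q, Generators E (F q) (V q) := fun q => (nonempty_generators E (F q) (V q)).some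
  obtain ⟨DU, hDU, hDUflat, hloc⟩ := exists_unique_restrictsTo g D hD U
  refine ⟨DU, degreeZeroPart g D, hDU, ⟨hasDegreeZeroPart_degreeZeroPart g D, fun A hA =>
    HasDegreeZeroPart.eq g hA (hasDegreeZeroPart_degreeZeroPart g D)⟩, hDUflat,
    fibreOp_degreeZeroPart_comp_self D hD, fun n x hx => ?_⟩
  obtain ⟨G, hmem, hG, hstart, hend, heven⟩ := exists_smooth_paths (E := E) U hx
  exact exists_cohomology_equiv ⟨G, hmem, hG, hstart, hend, heven⟩ g hx hDUflat
    (fun η => evalPoint_op hloc hx η) n
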